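/- Let $0<s<1$, let $k\ge 4$ be an integer, let $0<T^*<\infty$, and let $c_s=\frac{(1-s)\Gamma(1-s)}{2^{2s-1}\pi\Gamma(s)}$ and $K_s(x)=c_s\,x^\perp/|x|^{4-2s}$ for $x\in\mathbb R^2\setminus\{0\}$, where $x^\perp$ is $x$ rotated counter-clockwise by $\pi/2$. Let $(\theta,z)$ be a strong solution on $[0,T^*)$ of the vortex-wave system $$\partial_t\theta+(v+H)\cdot\nabla\theta=0,\qquad \frac{dz}{dt}=v(t,z(t)),\qquad v=-\nabla^\perp(-\Delta)^{-s}\theta,\qquad H(t,x)=K_s(x-z(t)),$$ that is, $\theta\in L^\infty_{\rm loc}([0,T^*);H^k(\mathbb R^2))\cap C^1([0,T^*)\times\mathbb R^2)$, $z\in C^1([0,T^*);\mathbb R^2)$, the transport equation holds at all $(t,x)$ with $x\ne z(t)$, and $\theta(0,\cdot)$ is constant on a neighbourhood of $z(0)$. Let $$R(t)=\sup\{r\ge 0:\ \nabla\theta(t)\equiv 0\text{ on }B(z(t),r)\}\in[0,\infty],$$ let $t_0\in[0,T^*)$ be such that $R(t)<1$ for all $t\in[t_0,T^*)$ (for instance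 $t_0=0$, if $R<1$ on the whole of $[0,T^*)$), and for $t\in[t_0,T^*)$ put $$N(t)=\max_{|x-z(t)|=R(t)}\frac{-(x-z(t))\cdot\big(v(t,x)-v(t,z(t))\big)}{R(t)^2\,(1-\ln R(t))}.$$ Here $\int_{t_0}^{T^*}N\,dt=+\infty$ means that $N$ is measurable on $(t_0,T^*)$, that its positive part has infinite integral and that its negative part has finite integral. (a) If $R(t)\to 0$ as $t\to T^*$, then $\int_{t_0}^{T^*}N(t)\,dt=+\infty$. (b) If $\theta\in L^\infty([0,T^*);H^k(\mathbb R^2))$, or if $s>1/2$, or if $\int_0^{T^*}\|v(t)\|_{L^\infty}\,dt<\infty$, then $$R(t)\underset{t\to T^*}{\longrightarrow}0\quad\Longleftrightarrow\quad\int_{t_0}^{T^*}N(t)\,dt=+\infty.$$ -/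

import Mathlib

open MeasureTheory Set Filter Topology
open scoped ENNReal NNReal FourierTransform

noncomputable section

namespace VortexWave

/-- The Euclidean plane. -/
abbrev Plane : Type := EuclideanSpace ℝ (Fin 2)

/-- Counter-clockwise rotation by a right angle. -/
def perp (x : Plane) : Plane := !₂[-(x 1), x 0]

/-- The constant of the Biot-Savart kernel. -/
def biotSavartConst (s : ℝ) : ℝ :=
  (1 - s) * Real.Gamma (1 - s) / (2 ^ (2 * s - 1) * Real.pi * Real.Gamma s)

/-- The Biot-Savart kernel `K_s(x) = c_s x^⊥ / |x|^(4-2s)`, for `x ≠ 0`. -/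
def kernel (s : ℝ) (x : Plane) : Plane :=
  (biotSavartConst s / ‖x‖ ^ (4 - 2 * s)) • perp x

open Classical in
/-- The Fourier-Plancherel transform of a real square-integrable function, with the convention
`∫ f(x) exp(-2πi x·ξ) dx` (and `0` for a function that is not in `L²`). The angular frequency is
therefore `2πξ`. -/
def fourierL2 (f : Plane → ℝ) : Plane → ℂ :=
  if h : MemLp (fun x => (f x : ℂ)) 2 volume then
    ((𝓕 (h.toLp (fun x => (f x : ℂ))) : Lp ℂ 2 (volume : Measure Plane)) : Plane → ℂ)
  else 0

/-- The `H^k` norm `‖(1 + |2πξ|²)^(k/2) f̂(ξ)‖_{L²}` of a square-integrable function. -/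
def sobolevNorm (k : ℕ) (f : Plane → ℝ) : ℝ≥0∞ :=
  eLpNorm (fun ξ => (((1 + (2 * Real.pi * ‖ξ‖) ^ 2) ^ ((k : ℝ) / 2) : ℝ) : ℂ) * fourierL2 f ξ)
    2 volume

/-- Membership in `H^k(ℝ²)`. -/
def MemHk (k : ℕ) (f : Plane → ℝ) : Prop :=
  MemLp f 2 volume ∧ sobolevNorm k f < ∞

/-- The velocity `v = -∇^⊥ (-Δ)^(-s) f`, as a Fourier multiplier: the inverse Fourier transform of
`-(2πi ξ^⊥) |2πξ|^(-2s) f̂(ξ)`. For `0 < s < 1` and `f ∈ H^k`, `k ≥ 4`, this symbol times `f̂` is an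
integrable function, and its inverse transform is real. -/
def velocity (s : ℝ) (f : Plane → ℝ) (x : Plane) : Plane :=
  WithLp.toLp 2 fun i : Fin 2 =>
    ((𝓕⁻ (fun ξ : Plane =>
      -(2 * Real.pi * Complex.I) * ((perp ξ i : ℝ) : ℂ)
        * (((2 * Real.pi * ‖ξ‖) ^ (-(2 * s)) : ℝ) : ℂ) * fourierL2 f ξ) : Plane → ℂ) x).re

/-- Strong solutions `(θ, z)` on `[0, T)` of the vortex-wave system
`∂ₜθ + (v + H)·∇θ = 0`, `z' = v(t, z)`, `v = -∇^⊥ (-Δ)^(-s) θ`, `H(t, x) = K_s(x - z(t))`,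
of class `L^∞_loc([0, T); H^k) ∩ C¹([0, T) × ℝ²)` in `θ` and `C¹([0, T))` in `z`,
and with `θ(0)` constant in a neighbourhood of `z(0)`. Derivatives at time `0` are one-sided. -/
structure IsStrongSolution (s : ℝ) (k : ℕ) (T : ℝ) (θ : ℝ → Plane → ℝ) (z : ℝ → Plane) :
    Prop where
  memHk : ∀ t ∈ Ico 0 T, MemHk k (θ t)
  locally_bounded : ∀ τ < T, ∃ C : ℝ≥0, ∀ t ∈ Icc 0 τ, sobolevNorm k (θ t) ≤ C
  contDiffOn_scalar : ContDiffOn ℝ 1 (Function.uncurry θ) (Ico 0 T ×ˢ univ)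
  contDiffOn_vortex : ContDiffOn ℝ 1 z (Ico 0 T)
  transport : ∀ t ∈ Ico 0 T, ∀ x : Plane, x ≠ z t →
    HasDerivWithinAt (fun τ => θ τ x)
      (-(inner ℝ (velocity s (θ t) x + kernel s (x - z t)) (gradient (θ t) x))) (Ico 0 T) t
  vortex : ∀ t ∈ Ico 0 T, HasDerivWithinAt z (velocity s (θ t) (z t)) (Ico 0 T) t
  plateau : ∃ β : ℝ, ∃ R₀ > 0, ∀ x ∈ Metric.ball (z 0) R₀, θ 0 x = β

/-- The plateau radius `sup {r ≥ 0 : ∇f ≡ 0 on B(p, r)}`, in `[0, ∞]`. -/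
def plateauRadius (f : Plane → ℝ) (p : Plane) : ℝ≥0∞ :=
  sSup {r : ℝ≥0∞ | ∀ x : Plane, edist x p < r → gradient f x = 0}

/-- The directional log-Lipschitz quantity
`max_{|x-p|=R} -(x-p)·(w(x)-w(p)) / (R²(1 - ln R))` of a continuous vector field `w`,
for `0 < R < 1`. -/
def directionalLogLip (w : Plane → Plane) (p : Plane) (R : ℝ) : ℝ :=
  sSup ((fun x => -(inner ℝ (x - p) (w x - w p)) / (R ^ 2 * (1 - Real.log R))) ''
    Metric.sphere p R)

/-- The quantity `N(t)` attached to `(θ, z)`. -/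
def inwardRate (s : ℝ) (θ : ℝ → Plane → ℝ) (z : ℝ → Plane) (t : ℝ) : ℝ :=
  directionalLogLip (velocity s (θ t)) (z t) (plateauRadius (θ t) (z t)).toReal

/-- The Lebesgue integral `∫ₐᵇ f` is well-defined in `[-∞, +∞]` and equal to `+∞`:
`f` is measurable, its positive part has infinite integral, its negative part a finite one. -/
def IntegralEqTop (f : ℝ → ℝ) (a b : ℝ) : Prop :=
  AEMeasurable f (volume.restrict (Ioo a b)) ∧
    ∫⁻ t in Ioo a b, ENNReal.ofReal (f t) = ∞ ∧
    ∫⁻ t in Ioo a b, ENNReal.ofReal (-f t) < ∞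

end VortexWave

end

/-! At a maximum point `x` of `θ(t)` over a closed ball centred at the vortex, the gradient is a
nonnegative multiple of `x - z(t)`, hence orthogonal to the kernel `K_s(x - z(t))`. The singular
field therefore never enters. If the radius `ρ(t)` grows no faster than the smallest radial
component of `v(t,x) - v(t,z(t))` on `|x - z(t)| = ρ(t)`, the maximum of `θ` over the moving ball
does not increase (`exists_hasDerivWithinAt_ball`, `le_on_ball_of_barrier`). The same holds for
`-θ`, so a plateau persists inside the moving ball, and no characteristics of the singular flow are
needed. A time-reversed version bounds `R` from the other side.

Exponential barriers show that `log R` is locally Lipschitz, so `R` and `N` are continuous. Sharper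
local barriers give, in the sense of upper right derivatives, `-R'/R ≤ N (1 - ln R)`, that is,
`(log(1 - ln R))' ≤ N` (`eventually_slope_lt`, `log_sub_log_le_integral`). Moreover `N ≥ 0`: the
velocity is divergence free and has zero flux through every circle, so somewhere on it the relative
radial velocity is nonpositive. If `R → 0`, then `log(1 - ln R) → ∞` and the integral of `N`
diverges, which is (a).

For the converse in (b), a uniform `H^k` bound makes `v` uniformly Lipschitz, so `N` is bounded and
its integral cannot be infinite. In the other two cases the oscillation `G(t)` of `v(t)` on the unit
ball around `z(t)` is integrable in time, and `R(b) ≥ R(a) - ∫ₐᵇ G` (`radius_sub_integral_le`). Were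
`R` at least `ε` at times close to `T`, it would stay above `ε/2`, where `N ≤ (2/ε) G`, and the
integral of `N` would be finite (`tendsto_of_integralEqTop`).

For `s > 1/2` the oscillation is controlled by `sup |θ|`, which the maximum principle propagates.
The multiplier `|2πξ|^(-2s)` is a superposition of smooth frequency cutoffs at all scales. Each
localized piece is a convolution with a kernel of scale-independent `L¹` norm, and the sum over
scales converges at high frequencies because `s > 1/2` and, for differences of velocities, at low
frequencies because `s < 1` (`exists_norm_velocity_sub_le_mul_sup`). -/

noncomputable section

namespace VortexWave

/-! ### A maximum principle -/

/-- A weak maximum principle: the sign of the time derivative is needed only at spatial maximizers,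
because a space-time maximum is attained at one of them. -/
theorem le_of_deriv_nonpos_at_maximizers {E : Type*} [TopologicalSpace E] {K : Set E}
    (hK : IsCompact K) {f : ℝ → E → ℝ} {a b M : ℝ}
    (hf : ContinuousOn (Function.uncurry f) (Icc a b ×ˢ K))
    (hmax : ∀ t ∈ Icc a b, ∀ y ∈ K, IsMaxOn (f t) K y →
      ∃ d ≤ 0, HasDerivWithinAt (fun τ => f τ y) d (Icc a b) t)
    (ha : ∀ y ∈ K, f a y ≤ M) : ∀ t ∈ Icc a b, ∀ y ∈ K, f t y ≤ M := by
  intro t ht y hy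
  have hab : a ≤ b := ht.1.trans ht.2
  -- The penalty `-ε (t - a)` makes the time derivative at a maximizer strictly negative, which a
  -- space-time maximum at a time later than `a` forbids.
  have key : ∀ ε > 0, f t y ≤ M + ε * (t - a) := by
    intro ε hε
    have hg : ContinuousOn (fun p : ℝ × E => Function.uncurry f p - ε * (p.1 - a))
        (Icc a b ×ˢ K) := hf.sub (by fun_prop)
    obtain ⟨⟨t₁, y₁⟩, ⟨ht₁, hy₁⟩, hmax₁⟩ :=
      (isCompact_Icc.prod hK).exists_isMaxOn ⟨(t, y), ht, hy⟩ hg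
    have hle : ∀ τ ∈ Icc a b, ∀ x ∈ K, f τ x - ε * (τ - a) ≤ f t₁ y₁ - ε * (t₁ - a) :=
      fun τ hτ x hx => hmax₁ (show (τ, x) ∈ Icc a b ×ˢ K from ⟨hτ, hx⟩)
    have h1 := hle t ht y hy
    rcases eq_or_lt_of_le ht₁.1 with h | h
    · have := ha y₁ hy₁
      obtain rfl : a = t₁ := h
      simp only [sub_self, mul_zero, sub_zero] at h1
      linarith
    · exfalso
      obtain ⟨d, hd, hder⟩ := hmax t₁ ht₁ y₁ hy₁ fun x hx => by
        have := hle t₁ ht₁ x hx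
        simpa using this
      have hder' : HasDerivWithinAt (fun τ => f τ y₁ - ε * (τ - a)) (d - ε * 1) (Icc a b) t₁ :=
        hder.sub (((hasDerivWithinAt_id t₁ _).sub_const a).const_mul ε)
      have hloc : IsLocalMaxOn (fun τ => f τ y₁ - ε * (τ - a)) (Icc a b) t₁ :=
        IsMaxOn.localize fun τ hτ => hle τ hτ y₁ hy₁
      -- Only the backward direction `a - t₁` is tested, so the argument also covers `t₁ = b`.
      have := hloc.hasFDerivWithinAt_nonpos hder'.hasFDerivWithinAt (y := a - t₁)
        (sub_mem_posTangentConeAt_of_segment_subset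
          ((convex_Icc a b).segment_subset ht₁ (left_mem_Icc.2 hab)))
      simp at this
      nlinarith
  refine le_of_forall_pos_le_add fun δ hδ => ?_
  rcases eq_or_lt_of_le ht.1 with h | h
  · have := ha y hy
    rw [← h]
    linarith
  · have := key (δ / (t - a)) (div_pos hδ (sub_pos.2 h))
    rwa [div_mul_cancel₀ _ (sub_pos.2 h).ne'] at this

/-- The previous principle under the reflection `t ↦ a + b - t`. -/
theorem le_of_deriv_nonneg_at_maximizers {E : Type*} [TopologicalSpace E] {K : Set E}
    (hK : IsCompact K) {f : ℝ → E → ℝ} {a b M : ℝ}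
    (hf : ContinuousOn (Function.uncurry f) (Icc a b ×ˢ K))
    (hmax : ∀ t ∈ Icc a b, ∀ y ∈ K, IsMaxOn (f t) K y →
      ∃ d ≥ 0, HasDerivWithinAt (fun τ => f τ y) d (Icc a b) t)
    (hb : ∀ y ∈ K, f b y ≤ M) : ∀ t ∈ Icc a b, ∀ y ∈ K, f t y ≤ M := by
  intro t ht y hy
  have hrefl : MapsTo (fun τ => a + b - τ) (Icc a b) (Icc a b) := fun τ hτ => by
    constructor <;> linarith [hτ.1, hτ.2]
  have := le_of_deriv_nonpos_at_maximizers hK (f := fun τ => f (a + b - τ)) (M := M)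
    (a := a) (b := b) (hf.comp (f := fun p : ℝ × E => (a + b - p.1, p.2)) (by fun_prop)
      fun p hp => ⟨hrefl hp.1, hp.2⟩) ?_ (by simpa using hb) (a + b - t) (hrefl ht) y hy
  · simpa using this
  · intro τ hτ x hx hm
    obtain ⟨d, hd, hder⟩ := hmax _ (hrefl hτ) x hx hm
    refine ⟨-d, by linarith, ?_⟩
    have h2 : HasDerivWithinAt (fun τ : ℝ => a + b - τ) (-1) (Icc a b) τ :=
      (hasDerivWithinAt_id τ _).const_sub _
    simpa [Function.comp_def] using hder.scomp τ h2 hrefl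

/-! ### The geometry of circles -/

theorem perp_smul (c : ℝ) (x : Plane) : perp (c • x) = c • perp x := by
  ext i; fin_cases i <;> simp [perp]

theorem inner_perp_self (x : Plane) : inner ℝ (perp x) x = 0 := by
  simp [perp, PiLp.inner_apply, Fin.sum_univ_two]; ring

theorem norm_perp (x : Plane) : ‖perp x‖ = ‖x‖ := by
  simp [perp, EuclideanSpace.norm_eq, Fin.sum_univ_two, add_comm]

/-- The unit vector of polar angle `φ`. -/
def unitVec (φ : ℝ) : Plane := !₂[Real.cos φ, Real.sin φ]

theorem norm_unitVec (φ : ℝ) : ‖unitVec φ‖ = 1 := by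
  simp [unitVec, EuclideanSpace.norm_eq, Fin.sum_univ_two]

theorem hasDerivAt_unitVec (φ : ℝ) : HasDerivAt unitVec (perp (unitVec φ)) φ := by
  rw [hasDerivAt_iff_hasFDerivAt, ← hasFDerivWithinAt_univ, hasFDerivWithinAt_euclidean]
  intro i
  fin_cases i
  · exact (Real.hasDerivAt_cos φ).hasFDerivAt.hasFDerivWithinAt.congr_fderiv
      (by ext; simp [unitVec, perp])
  · exact (Real.hasDerivAt_sin φ).hasFDerivAt.hasFDerivWithinAt.congr_fderiv
      (by ext; simp [unitVec, perp])

theorem unitVec_two_pi : unitVec (2 * Real.pi) = unitVec 0 := by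
  simp [unitVec]

theorem continuous_unitVec : Continuous unitVec :=
  continuous_iff_continuousAt.2 fun φ => (hasDerivAt_unitVec φ).continuousAt

theorem continuous_perp : Continuous perp := by
  unfold perp
  fun_prop

/-- Rolle's theorem for `f` along the circle, a closed curve. At such a point the gradient does not
see a field tangent to the circle. -/
theorem exists_inner_perp_gradient_eq_zero {f : Plane → ℝ} (hf : Differentiable ℝ f) (p : Plane)
    (r : ℝ) : ∃ e : Plane, ‖e‖ = 1 ∧ inner ℝ (r • perp e) (gradient f (p + r • e)) = 0 := by
  have hd : ∀ φ, HasDerivAt (fun φ => f (p + r • unitVec φ))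
      (inner ℝ (r • perp (unitVec φ)) (gradient f (p + r • unitVec φ))) φ := fun φ => by
    have h1 := (hf (p + r • unitVec φ)).hasGradientAt.hasFDerivAt.comp_hasDerivAt φ
      (((hasDerivAt_unitVec φ).const_smul r).const_add p)
    rwa [real_inner_comm]
  obtain ⟨c, -, hc⟩ := exists_hasDerivAt_eq_zero Real.two_pi_pos
    (fun φ _ => (hd φ).continuousAt.continuousWithinAt) (by simp [unitVec_two_pi])
    fun φ _ => hd φ
  exact ⟨unitVec c, norm_unitVec c, hc⟩

/-- Comparing `x` with the point `w` of the ball farthest in the direction of the gradient `g` gives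
`ρ‖g‖ ≤ g·(x - p)`. This forces equality in Cauchy–Schwarz and, if `g ≠ 0`, puts `x` on the
boundary. -/
theorem smul_gradient_eq_of_isMaxOn_closedBall {f : Plane → ℝ} {p x : Plane} {ρ : ℝ} (hρ : 0 < ρ)
    (hf : DifferentiableAt ℝ f x) (hx : x ∈ Metric.closedBall p ρ)
    (hmax : IsMaxOn f (Metric.closedBall p ρ) x) :
    ρ • gradient f x = ‖gradient f x‖ • (x - p) := by
  set g := gradient f x with hg
  rcases eq_or_ne g 0 with h0 | h0
  · simp [h0]
  have hgpos : 0 < ‖g‖ := norm_pos_iff.2 h0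
  have hxp : ‖x - p‖ ≤ ρ := by rwa [mem_closedBall_iff_norm] at hx
  set w : Plane := p + (ρ / ‖g‖) • g
  have hw : w ∈ Metric.closedBall p ρ := by
    rw [mem_closedBall_iff_norm]
    simp only [w, add_sub_cancel_left, norm_smul, norm_div, Real.norm_eq_abs,
      abs_of_pos hρ, abs_norm]
    rw [div_mul_cancel₀ _ hgpos.ne']
  have h1 := hmax.localize.hasFDerivWithinAt_nonpos
    hf.hasGradientAt.hasFDerivAt.hasFDerivWithinAt (y := w - x)
    (sub_mem_posTangentConeAt_of_segment_subset
      ((convex_closedBall p ρ).segment_subset hx hw))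
  have h2 : inner ℝ g (w - x) = ρ * ‖g‖ - inner ℝ g (x - p) := by
    have : w - x = (ρ / ‖g‖) • g - (x - p) := by simp only [w]; abel
    rw [this, inner_sub_right, real_inner_smul_right, real_inner_self_eq_norm_sq]
    field_simp
  have h3 : ρ * ‖g‖ ≤ inner ℝ g (x - p) := by
    have : inner ℝ g (w - x) ≤ 0 := h1
    linarith
  have h4 : inner ℝ g (x - p) ≤ ‖g‖ * ‖x - p‖ := real_inner_le_norm _ _
  have h5 : ‖x - p‖ = ρ := by nlinarith
  have h6 : inner ℝ g (x - p) = ‖g‖ * ‖x - p‖ := le_antisymm h4 (by rw [h5]; linarith)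
  rw [inner_eq_norm_mul_iff_real, h5] at h6
  exact h6

/-! ### Transport by a velocity field and a point vortex -/

/-- `θ` is transported on `[0, T)` by the continuous field `V` and by the point vortex `z`, which
itself moves with `V`. -/
structure IsTransported (s T : ℝ) (θ : ℝ → Plane → ℝ) (z : ℝ → Plane)
    (V : ℝ → Plane → Plane) : Prop where
  contDiffOn_scalar : ContDiffOn ℝ 1 (Function.uncurry θ) (Ico 0 T ×ˢ univ)
  continuous_velocity : ∀ t ∈ Ico 0 T, Continuous (V t)
  transport : ∀ t ∈ Ico 0 T, ∀ x : Plane, x ≠ z t →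
    HasDerivWithinAt (fun τ => θ τ x)
      (-(inner ℝ (V t x + kernel s (x - z t)) (gradient (θ t) x))) (Ico 0 T) t
  vortex : ∀ t ∈ Ico 0 T, HasDerivWithinAt z (V t (z t)) (Ico 0 T) t

namespace IsTransported

variable {s T : ℝ} {θ : ℝ → Plane → ℝ} {z : ℝ → Plane} {V : ℝ → Plane → Plane}

theorem uniqueDiffOn_Ico_prod (T : ℝ) : UniqueDiffOn ℝ (Ico 0 T ×ˢ (univ : Set Plane)) :=
  (uniqueDiffOn_Ico 0 T).prod uniqueDiffOn_univ

theorem hasFDerivWithinAt (h : IsTransported s T θ z V) {t : ℝ} (ht : t ∈ Ico 0 T) (x : Plane) :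
    HasFDerivWithinAt (Function.uncurry θ)
      (fderivWithin ℝ (Function.uncurry θ) (Ico 0 T ×ˢ univ) (t, x)) (Ico 0 T ×ˢ univ) (t, x) :=
  (h.contDiffOn_scalar.differentiableOn one_ne_zero (t, x) ⟨ht, mem_univ x⟩).hasFDerivWithinAt

theorem hasFDerivAt_slice (h : IsTransported s T θ z V) {t : ℝ} (ht : t ∈ Ico 0 T) (x : Plane) :
    HasFDerivAt (θ t) ((fderivWithin ℝ (Function.uncurry θ) (Ico 0 T ×ˢ univ) (t, x)).comp
      (ContinuousLinearMap.inr ℝ ℝ Plane)) x := by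
  have h1 := (h.hasFDerivWithinAt ht x).comp x (hasFDerivWithinAt_univ.2
    ((hasFDerivAt_const t x).prodMk (hasFDerivAt_id x)))
    (fun y _ => show (t, y) ∈ Ico 0 T ×ˢ univ from ⟨ht, mem_univ y⟩)
  exact hasFDerivWithinAt_univ.1 h1

theorem differentiable (h : IsTransported s T θ z V) {t : ℝ} (ht : t ∈ Ico 0 T) :
    Differentiable ℝ (θ t) := fun x => (h.hasFDerivAt_slice ht x).differentiableAt

theorem fderivWithin_zero_right (h : IsTransported s T θ z V) {t : ℝ} (ht : t ∈ Ico 0 T)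
    (x w : Plane) : fderivWithin ℝ (Function.uncurry θ) (Ico 0 T ×ˢ univ) (t, x) (0, w) =
      inner ℝ (gradient (θ t) x) w := by
  have h1 := (h.hasFDerivAt_slice ht x).unique (h.differentiable ht x).hasGradientAt.hasFDerivAt
  simpa using congrArg (fun L => L w) h1

theorem hasDerivWithinAt_time (h : IsTransported s T θ z V) {t : ℝ} (ht : t ∈ Ico 0 T)
    (x : Plane) : HasDerivWithinAt (fun τ => θ τ x)
      (fderivWithin ℝ (Function.uncurry θ) (Ico 0 T ×ˢ univ) (t, x) (1, 0)) (Ico 0 T) t :=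
  (h.hasFDerivWithinAt ht x).comp_hasDerivWithinAt (f := fun τ => (τ, x)) t
    ((hasDerivWithinAt_id t _).prodMk (hasDerivWithinAt_const t _ x))
    (fun τ hτ => (⟨hτ, mem_univ x⟩ : (τ, x) ∈ Ico 0 T ×ˢ univ))

theorem fderivWithin_one_zero (h : IsTransported s T θ z V) {t : ℝ} (ht : t ∈ Ico 0 T)
    {x : Plane} (hx : x ≠ z t) :
    fderivWithin ℝ (Function.uncurry θ) (Ico 0 T ×ˢ univ) (t, x) (1, 0) =
      -(inner ℝ (V t x + kernel s (x - z t)) (gradient (θ t) x)) :=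
  (uniqueDiffOn_Ico 0 T t ht).eq_deriv _ (h.hasDerivWithinAt_time ht x) (h.transport t ht x hx)

theorem continuous_fderivWithin_slice (h : IsTransported s T θ z V) {t : ℝ} (ht : t ∈ Ico 0 T) :
    Continuous fun x => fderivWithin ℝ (Function.uncurry θ) (Ico 0 T ×ˢ univ) (t, x) :=
  (h.contDiffOn_scalar.continuousOn_fderivWithin (uniqueDiffOn_Ico_prod T) le_rfl).comp_continuous
    (f := fun x : Plane => (t, x)) (by fun_prop) fun x =>
      (⟨ht, mem_univ x⟩ : (t, x) ∈ Ico 0 T ×ˢ univ)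

theorem continuous_gradient (h : IsTransported s T θ z V) {t : ℝ} (ht : t ∈ Ico 0 T) :
    Continuous (gradient (θ t)) := by
  have h1 : Continuous (fderiv ℝ (θ t)) := by
    have : fderiv ℝ (θ t) = fun x => (fderivWithin ℝ (Function.uncurry θ) (Ico 0 T ×ˢ univ)
        (t, x)).comp (ContinuousLinearMap.inr ℝ ℝ Plane) :=
      funext fun x => (h.hasFDerivAt_slice ht x).fderiv
    rw [this]
    exact (h.continuous_fderivWithin_slice ht).clm_comp continuous_const
  exact (InnerProductSpace.toDual ℝ Plane).symm.continuous.comp h1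

theorem kernel_smul_eq (s r : ℝ) (e : Plane) :
    ∃ c : ℝ, kernel s (r • e) = c • (r • perp e) :=
  ⟨_, by rw [kernel, perp_smul]⟩

/-- At the vortex, `θ` is transported by the regular part of the field alone. -/
theorem fderivWithin_one_zero_vortex (h : IsTransported s T θ z V) {t : ℝ} (ht : t ∈ Ico 0 T) :
    fderivWithin ℝ (Function.uncurry θ) (Ico 0 T ×ˢ univ) (t, z t) (1, 0) =
      -(inner ℝ (V t (z t)) (gradient (θ t) (z t))) := by
  -- On circles shrinking to the vortex, pick points with vanishing angular derivative. There the
  -- kernel term is exactly zero, however singular the kernel, and the equation passes to the limit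
  -- by continuity.
  choose e he hgrad using fun n : ℕ =>
    exists_inner_perp_gradient_eq_zero (h.differentiable ht) (z t) (1 / ((n : ℝ) + 1))
  have hpos : ∀ n : ℕ, (0 : ℝ) < 1 / ((n : ℝ) + 1) := fun n => by positivity
  have hlim : Tendsto (fun n : ℕ => z t + (1 / ((n : ℝ) + 1)) • e n) atTop (𝓝 (z t)) := by
    rw [tendsto_iff_norm_sub_tendsto_zero]
    refine (tendsto_one_div_add_atTop_nhds_zero_nat (𝕜 := ℝ)).congr fun n => ?_
    rw [add_sub_cancel_left, norm_smul, he, mul_one, Real.norm_of_nonneg (hpos n).le]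
  have hcont : Continuous fun x => fderivWithin ℝ (Function.uncurry θ) (Ico 0 T ×ˢ univ) (t, x)
      ((1 : ℝ), (0 : Plane)) + inner ℝ (V t x) (gradient (θ t) x) :=
    ((h.continuous_fderivWithin_slice ht).clm_apply continuous_const).add
      ((h.continuous_velocity t ht).inner (h.continuous_gradient ht))
  have h1 := (hcont.tendsto (z t)).comp hlim
  have h2 : ∀ n : ℕ, (fun x => fderivWithin ℝ (Function.uncurry θ) (Ico 0 T ×ˢ univ) (t, x)
      ((1 : ℝ), (0 : Plane)) + inner ℝ (V t x) (gradient (θ t) x))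
        (z t + (1 / ((n : ℝ) + 1)) • e n) = 0 := fun n => by
    have hne : z t + (1 / ((n : ℝ) + 1)) • e n ≠ z t := fun heq => by
      have h0 : (1 / ((n : ℝ) + 1)) • e n = 0 := by simpa using heq
      have := congrArg norm h0
      rw [norm_smul, he, mul_one, norm_zero, norm_eq_zero] at this
      exact (hpos n).ne' this
    obtain ⟨c, hc⟩ := kernel_smul_eq s (1 / ((n : ℝ) + 1)) (e n)
    simp only
    rw [h.fderivWithin_one_zero ht hne, add_sub_cancel_left, hc, inner_add_left,
      real_inner_smul_left, hgrad]
    ring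
  have h3 := tendsto_nhds_unique h1 (tendsto_const_nhds.congr fun n => (h2 n).symm)
  linarith

theorem neg (h : IsTransported s T θ z V) : IsTransported s T (fun t x => -θ t x) z V where
  contDiffOn_scalar := h.contDiffOn_scalar.neg
  continuous_velocity := h.continuous_velocity
  transport t ht x hx := by
    have hg : gradient (fun x => -θ t x) x = -gradient (θ t) x := by
      simp [gradient, fderiv_fun_neg]
    rw [hg, inner_neg_right]
    exact (h.transport t ht x hx).neg
  vortex := h.vortex

/-- The derivative of `θ` along a moving ball at a spatial maximizer. -/
theorem exists_hasDerivWithinAt_ball (h : IsTransported s T θ z V) {a b : ℝ}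
    (hab : Icc a b ⊆ Ico 0 T) {ρ : ℝ → ℝ} {t ρ' : ℝ} (ht : t ∈ Icc a b) (hρ : 0 < ρ t)
    (hρ' : HasDerivWithinAt ρ ρ' (Icc a b) t) {y : Plane}
    (hy : y ∈ Metric.closedBall (0 : Plane) 1)
    (hmax : IsMaxOn (fun y => θ t (z t + ρ t • y)) (Metric.closedBall (0 : Plane) 1) y) :
    ∃ c : ℝ, 0 ≤ c ∧ (c ≠ 0 → ‖y‖ = 1) ∧ HasDerivWithinAt (fun τ => θ τ (z τ + ρ τ • y))
      (c * (ρ' - inner ℝ y (V t (z t + ρ t • y) - V t (z t)))) (Icc a b) t := by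
  have htT := hab ht
  set x := z t + ρ t • y with hx
  set g := gradient (θ t) x with hg
  have hy1 : ‖y‖ ≤ 1 := by simpa using hy
  have hxmem : x ∈ Metric.closedBall (z t) (ρ t) := by
    rw [mem_closedBall_iff_norm, hx, add_sub_cancel_left, norm_smul, Real.norm_eq_abs,
      abs_of_pos hρ]
    exact mul_le_of_le_one_right hρ.le hy1
  have hmaxx : IsMaxOn (θ t) (Metric.closedBall (z t) (ρ t)) x := by
    intro w hw
    have hw' : (ρ t)⁻¹ • (w - z t) ∈ Metric.closedBall (0 : Plane) 1 := by
      rw [mem_closedBall_iff_norm] at hw ⊢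
      rw [sub_zero, norm_smul, norm_inv, Real.norm_eq_abs, abs_of_pos hρ]
      exact inv_mul_le_one_of_le₀ hw hρ.le
    have := hmax hw'
    simpa [smul_smul, mul_inv_cancel₀ hρ.ne'] using this
  -- The factor `c` of the conclusion will be `‖g‖`, with `g` parallel to the radius.
  have hgy : g = ‖g‖ • y := by
    have h1 := smul_gradient_eq_of_isMaxOn_closedBall hρ (h.differentiable htT x) hxmem hmaxx
    rw [hx, add_sub_cancel_left, smul_comm ‖_‖ (ρ t)] at h1
    exact smul_right_injective Plane hρ.ne' h1
  have hder : HasDerivWithinAt (fun τ => θ τ (z τ + ρ τ • y))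
      (fderivWithin ℝ (Function.uncurry θ) (Ico 0 T ×ˢ univ) (t, x) (1, V t (z t) + ρ' • y))
      (Icc a b) t :=
    (h.hasFDerivWithinAt htT x).comp_hasDerivWithinAt (f := fun τ => (τ, z τ + ρ τ • y)) t
      ((hasDerivWithinAt_id t _).prodMk (((h.vortex t htT).mono hab).add (hρ'.smul_const y)))
      (fun _ hy => ⟨hab hy, mem_univ _⟩)
  have hsplit : fderivWithin ℝ (Function.uncurry θ) (Ico 0 T ×ˢ univ) (t, x)
      (1, V t (z t) + ρ' • y) = fderivWithin ℝ (Function.uncurry θ) (Ico 0 T ×ˢ univ) (t, x) (1, 0)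
        + inner ℝ g (V t (z t) + ρ' • y) := by
    rw [← h.fderivWithin_zero_right htT, ← map_add]
    simp
  refine ⟨‖g‖, norm_nonneg _, fun hne => ?_, ?_⟩
  · have := congrArg norm hgy
    rw [norm_smul, norm_norm] at this
    exact (mul_eq_left₀ hne).1 this.symm
  rw [hsplit] at hder
  convert! hder using 1
  have hnorm : ‖g‖ * ‖y‖ ^ 2 = ‖g‖ := by
    have := congrArg norm hgy
    rw [norm_smul, norm_norm] at this
    rw [sq, ← mul_assoc, ← this, ← this]
  -- The transport equation is not assumed at the vortex itself; there `y = 0`, hence `g = 0`, and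
  -- the time derivative vanishes.
  rcases eq_or_ne x (z t) with hxz | hxz
  · have hy0 : y = 0 := by
      have : ρ t • y = 0 := by simpa [hx] using hxz
      exact (smul_eq_zero.1 this).resolve_left hρ.ne'
    have hg0 : g = 0 := by rw [hgy, hy0, smul_zero]
    have h2 := h.fderivWithin_one_zero_vortex htT
    rw [hxz, h2, ← hxz, ← hg, hg0]
    simp
  · rw [h.fderivWithin_one_zero htT hxz, ← hg]
    have hk : inner ℝ (kernel s (x - z t)) g = 0 := by
      obtain ⟨c, hc⟩ := kernel_smul_eq s (ρ t) y
      rw [hx, add_sub_cancel_left, hc, hgy, real_inner_smul_left, real_inner_smul_left,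
        real_inner_smul_right, inner_perp_self]
      simp
    rw [inner_add_left, hk]
    have e1 : ∀ w, inner ℝ g w = ‖g‖ * inner ℝ y w := fun w => by
      conv_lhs => rw [hgy, real_inner_smul_left]
    rw [real_inner_comm g, e1, e1, inner_sub_right, inner_add_right, real_inner_smul_right,
      real_inner_self_eq_norm_sq]
    linear_combination (-ρ') * hnorm

end IsTransported

/-! ### Plateaus and barriers -/

/-- The strict inequality leaves room to control the gradient on the closed ball, where the mean
value inequality applies. -/
theorem const_of_lt_plateauRadius {f : Plane → ℝ} (hf : Differentiable ℝ f) {p : Plane} {r : ℝ}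
    (hr : ENNReal.ofReal r < plateauRadius f p) {x : Plane} (hx : x ∈ Metric.closedBall p r) :
    f x = f p := by
  obtain ⟨r', hr', hlt⟩ := lt_sSup_iff.1 hr
  have h0 : 0 ≤ r := dist_nonneg.trans hx
  have := (convex_closedBall p r).norm_image_sub_le_of_norm_fderiv_le (f := f) (C := 0) (𝕜 := ℝ)
    (fun y _ => hf y) (fun y hy => ?_) (Metric.mem_closedBall_self h0) hx
  · rw [zero_mul, norm_le_zero_iff, sub_eq_zero] at this
    exact this
  · have h1 : gradient f y = 0 := hr' y (lt_of_le_of_lt (by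
      rw [edist_dist]; exact ENNReal.ofReal_le_ofReal hy) hlt)
    have h2 : fderiv ℝ f y = 0 := by
      have := (hf y).hasGradientAt.hasFDerivAt.fderiv
      rw [h1, map_zero] at this
      exact this
    rw [h2, norm_zero]

theorem le_plateauRadius {f : Plane → ℝ} {p : Plane} {r β : ℝ}
    (h : ∀ x ∈ Metric.ball p r, f x = β) : ENNReal.ofReal r ≤ plateauRadius f p := by
  refine le_sSup fun x hx => ?_
  have hx' : x ∈ Metric.ball p r := by
    rw [edist_dist, ENNReal.ofReal_lt_ofReal_iff_of_nonneg dist_nonneg] at hx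
    exact hx
  have h1 : f =ᶠ[𝓝 x] fun _ => β :=
    Filter.eventuallyEq_of_mem (Metric.isOpen_ball.mem_nhds hx') h
  rw [gradient, h1.fderiv_eq]
  simp

namespace IsTransported

variable {s T : ℝ} {θ : ℝ → Plane → ℝ} {z : ℝ → Plane} {V : ℝ → Plane → Plane}

theorem continuousOn_ball_param (h : IsTransported s T θ z V) {a b : ℝ}
    (hab : Icc a b ⊆ Ico 0 T) {ρ : ℝ → ℝ} (hρ : ContinuousOn ρ (Icc a b)) (K : Set Plane) :
    ContinuousOn (Function.uncurry fun t y => θ t (z t + ρ t • y)) (Icc a b ×ˢ K) := by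
  have hz : ContinuousOn z (Icc a b) := fun t ht =>
    ((h.vortex t (hab ht)).mono hab).continuousWithinAt
  have h1 : ContinuousOn (fun p : ℝ × Plane => (p.1, z p.1 + ρ p.1 • p.2)) (Icc a b ×ˢ K) := by
    have h2 : ContinuousOn (fun p : ℝ × Plane => z p.1) (Icc a b ×ˢ K) :=
      hz.comp continuousOn_fst fun p hp => hp.1
    have h3 : ContinuousOn (fun p : ℝ × Plane => ρ p.1) (Icc a b ×ˢ K) :=
      hρ.comp continuousOn_fst fun p hp => hp.1
    exact continuousOn_fst.prodMk (h2.add (h3.smul continuousOn_snd))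
  exact h.contDiffOn_scalar.continuousOn.comp h1 fun p hp => ⟨hab hp.1, mem_univ _⟩

theorem mem_closedBall_iff_exists {p x : Plane} {r : ℝ} (hr : 0 < r) :
    x ∈ Metric.closedBall p r ↔ ∃ y ∈ Metric.closedBall (0 : Plane) 1, x = p + r • y := by
  constructor
  · intro hx
    refine ⟨r⁻¹ • (x - p), ?_, by rw [smul_smul, mul_inv_cancel₀ hr.ne']; simp⟩
    rw [mem_closedBall_iff_norm] at hx ⊢
    rw [sub_zero, norm_smul, norm_inv, Real.norm_eq_abs, abs_of_pos hr]
    exact inv_mul_le_one_of_le₀ hx hr.le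
  · rintro ⟨y, hy, rfl⟩
    rw [mem_closedBall_iff_norm] at hy ⊢
    rw [add_sub_cancel_left, norm_smul, Real.norm_eq_abs, abs_of_pos hr]
    rw [sub_zero] at hy
    exact mul_le_of_le_one_right hr.le hy

/-- In the coordinates `x = z(t) + ρ(t) y` the ball is fixed. At a maximizer the derivative is `c
(ρ' - y·(V(x) - V(z)))` with `c ≥ 0`, and `c ≠ 0` only on the boundary, where the barrier condition
makes the bracket nonpositive. -/
theorem le_on_ball_of_barrier (h : IsTransported s T θ z V) {a b : ℝ}
    (hab : Icc a b ⊆ Ico 0 T) {ρ ρ' : ℝ → ℝ} (hρ : ∀ t ∈ Icc a b, 0 < ρ t)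
    (hρ' : ∀ t ∈ Icc a b, HasDerivWithinAt ρ (ρ' t) (Icc a b) t)
    (hbar : ∀ t ∈ Icc a b, ∀ x, ‖x - z t‖ = ρ t →
      ρ t * ρ' t ≤ inner ℝ (x - z t) (V t x - V t (z t))) {M : ℝ}
    (ha : ∀ x ∈ Metric.closedBall (z a) (ρ a), θ a x ≤ M) :
    ∀ t ∈ Icc a b, ∀ x ∈ Metric.closedBall (z t) (ρ t), θ t x ≤ M := by
  intro t ht x hx
  have haI : a ∈ Icc a b := left_mem_Icc.2 (ht.1.trans ht.2)
  obtain ⟨y, hy, rfl⟩ := (mem_closedBall_iff_exists (hρ t ht)).1 hx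
  refine le_of_deriv_nonpos_at_maximizers (isCompact_closedBall (0 : Plane) 1)
    (h.continuousOn_ball_param hab (fun τ hτ => (hρ' τ hτ).continuousWithinAt) _)
    (fun τ hτ y hy hmax => ?_)
    (fun y hy => ha _ ((mem_closedBall_iff_exists (hρ a haI)).2 ⟨y, hy, rfl⟩)) t ht y hy
  obtain ⟨c, hc, hcy, hd⟩ := h.exists_hasDerivWithinAt_ball hab hτ (hρ τ hτ) (hρ' τ hτ) hy hmax
  refine ⟨_, ?_, hd⟩
  rcases eq_or_ne c 0 with rfl | hc0
  · simp
  · have h1 := hbar τ hτ (z τ + ρ τ • y) (by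
      rw [add_sub_cancel_left, norm_smul, hcy hc0, Real.norm_of_nonneg (hρ τ hτ).le, mul_one])
    rw [add_sub_cancel_left, real_inner_smul_left] at h1
    have h2 := le_of_mul_le_mul_left h1 (hρ τ hτ)
    exact mul_nonpos_of_nonneg_of_nonpos hc (by linarith)

/-- Reversing the barrier inequality makes the derivative at maximizers nonnegative, so information
travels from `b` back to `a`. -/
theorem le_on_ball_of_backward_barrier (h : IsTransported s T θ z V) {a b : ℝ}
    (hab : Icc a b ⊆ Ico 0 T) {ρ ρ' : ℝ → ℝ} (hρ : ∀ t ∈ Icc a b, 0 < ρ t)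
    (hρ' : ∀ t ∈ Icc a b, HasDerivWithinAt ρ (ρ' t) (Icc a b) t)
    (hbar : ∀ t ∈ Icc a b, ∀ x, ‖x - z t‖ = ρ t →
      inner ℝ (x - z t) (V t x - V t (z t)) ≤ ρ t * ρ' t) {M : ℝ}
    (hb : ∀ x ∈ Metric.closedBall (z b) (ρ b), θ b x ≤ M) :
    ∀ t ∈ Icc a b, ∀ x ∈ Metric.closedBall (z t) (ρ t), θ t x ≤ M := by
  intro t ht x hx
  have hbI : b ∈ Icc a b := right_mem_Icc.2 (ht.1.trans ht.2)
  obtain ⟨y, hy, rfl⟩ := (mem_closedBall_iff_exists (hρ t ht)).1 hx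
  refine le_of_deriv_nonneg_at_maximizers (isCompact_closedBall (0 : Plane) 1)
    (h.continuousOn_ball_param hab (fun τ hτ => (hρ' τ hτ).continuousWithinAt) _)
    (fun τ hτ y hy hmax => ?_)
    (fun y hy => hb _ ((mem_closedBall_iff_exists (hρ b hbI)).2 ⟨y, hy, rfl⟩)) t ht y hy
  obtain ⟨c, hc, hcy, hd⟩ := h.exists_hasDerivWithinAt_ball hab hτ (hρ τ hτ) (hρ' τ hτ) hy hmax
  refine ⟨_, ?_, hd⟩
  rcases eq_or_ne c 0 with rfl | hc0
  · simp
  · have h1 := hbar τ hτ (z τ + ρ τ • y) (by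
      rw [add_sub_cancel_left, norm_smul, hcy hc0, Real.norm_of_nonneg (hρ τ hτ).le, mul_one])
    rw [add_sub_cancel_left, real_inner_smul_left] at h1
    have h2 := le_of_mul_le_mul_left h1 (hρ τ hτ)
    exact mul_nonneg hc (by linarith)

/-- The barrier estimate for `θ` and for `-θ` keeps both extrema equal to the value on the initial
plateau. -/
theorem ofReal_le_plateauRadius_of_barrier (h : IsTransported s T θ z V) {a b : ℝ} (hle : a ≤ b)
    (hab : Icc a b ⊆ Ico 0 T) {ρ ρ' : ℝ → ℝ} (hρ : ∀ t ∈ Icc a b, 0 < ρ t)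
    (hρ' : ∀ t ∈ Icc a b, HasDerivWithinAt ρ (ρ' t) (Icc a b) t)
    (hbar : ∀ t ∈ Icc a b, ∀ x, ‖x - z t‖ = ρ t →
      ρ t * ρ' t ≤ inner ℝ (x - z t) (V t x - V t (z t)))
    (ha : ENNReal.ofReal (ρ a) < plateauRadius (θ a) (z a)) :
    ENNReal.ofReal (ρ b) ≤ plateauRadius (θ b) (z b) := by
  have hconst := fun x hx => const_of_lt_plateauRadius
    (h.differentiable (hab (left_mem_Icc.2 hle))) ha (x := x) hx
  refine le_plateauRadius (β := θ a (z a)) fun x hx => le_antisymm ?_ ?_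
  · exact h.le_on_ball_of_barrier hab hρ hρ' hbar (fun x hx => (hconst x hx).le) b
      (right_mem_Icc.2 hle) x (Metric.ball_subset_closedBall hx)
  · exact neg_le_neg_iff.1 (h.neg.le_on_ball_of_barrier hab hρ hρ' hbar
      (fun x hx => neg_le_neg (hconst x hx).ge) b
      (right_mem_Icc.2 hle) x (Metric.ball_subset_closedBall hx))

theorem ofReal_le_plateauRadius_of_backward_barrier (h : IsTransported s T θ z V) {a b : ℝ}
    (hle : a ≤ b) (hab : Icc a b ⊆ Ico 0 T) {ρ ρ' : ℝ → ℝ} (hρ : ∀ t ∈ Icc a b, 0 < ρ t)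
    (hρ' : ∀ t ∈ Icc a b, HasDerivWithinAt ρ (ρ' t) (Icc a b) t)
    (hbar : ∀ t ∈ Icc a b, ∀ x, ‖x - z t‖ = ρ t →
      inner ℝ (x - z t) (V t x - V t (z t)) ≤ ρ t * ρ' t)
    (hb : ENNReal.ofReal (ρ b) < plateauRadius (θ b) (z b)) :
    ENNReal.ofReal (ρ a) ≤ plateauRadius (θ a) (z a) := by
  have hconst := fun x hx => const_of_lt_plateauRadius
    (h.differentiable (hab (right_mem_Icc.2 hle))) hb (x := x) hx
  refine le_plateauRadius (β := θ b (z b)) fun x hx => le_antisymm ?_ ?_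
  · exact h.le_on_ball_of_backward_barrier hab hρ hρ' hbar (fun x hx => (hconst x hx).le) a
      (left_mem_Icc.2 hle) x (Metric.ball_subset_closedBall hx)
  · exact neg_le_neg_iff.1 (h.neg.le_on_ball_of_backward_barrier hab hρ hρ' hbar
      (fun x hx => neg_le_neg (hconst x hx).ge) a
      (left_mem_Icc.2 hle) x (Metric.ball_subset_closedBall hx))

/-- Exponential barriers. -/
theorem ofReal_mul_exp_le_plateauRadius (h : IsTransported s T θ z V) {a b : ℝ} (hle : a ≤ b)
    (hab : Icc a b ⊆ Ico 0 T) {c l : ℝ} (hc : 0 < c)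
    (hbar : ∀ t ∈ Icc a b, ∀ x, ‖x - z t‖ = c * Real.exp (-(l * (t - a))) →
      -(l * ‖x - z t‖ ^ 2) ≤ inner ℝ (x - z t) (V t x - V t (z t)))
    (ha : ENNReal.ofReal c < plateauRadius (θ a) (z a)) :
    ENNReal.ofReal (c * Real.exp (-(l * (b - a)))) ≤ plateauRadius (θ b) (z b) := by
  refine h.ofReal_le_plateauRadius_of_barrier hle hab
    (ρ := fun t => c * Real.exp (-(l * (t - a))))
    (ρ' := fun t => c * (Real.exp (-(l * (t - a))) * (-(l * 1)))) (fun t _ => by positivity)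
    (fun t _ => ?_) (fun t ht x hx => ?_) (by simpa using ha)
  · exact (((((hasDerivWithinAt_id t _).sub_const a).const_mul l).neg).exp).const_mul c
  · refine le_trans (le_of_eq ?_) (hbar t ht x hx)
    rw [hx]; ring

theorem ofReal_mul_exp_le_plateauRadius_backward (h : IsTransported s T θ z V) {a b : ℝ}
    (hle : a ≤ b) (hab : Icc a b ⊆ Ico 0 T) {c l : ℝ} (hc : 0 < c)
    (hbar : ∀ t ∈ Icc a b, ∀ x, inner ℝ (x - z t) (V t x - V t (z t)) ≤ l * ‖x - z t‖ ^ 2)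
    (hb : ENNReal.ofReal c < plateauRadius (θ b) (z b)) :
    ENNReal.ofReal (c * Real.exp (-(l * (b - a)))) ≤ plateauRadius (θ a) (z a) := by
  have := h.ofReal_le_plateauRadius_of_backward_barrier hle hab
    (ρ := fun t => c * Real.exp (-(l * (b - t))))
    (ρ' := fun t => c * (Real.exp (-(l * (b - t))) * (-(l * -1)))) (fun t _ => by positivity)
    (fun t _ => ?_) (fun t ht x hx => ?_) (by simpa using hb)
  · exact this
  · exact (((((hasDerivWithinAt_id t _).const_sub b).const_mul l).neg).exp).const_mul c
  · refine (hbar t ht x).trans (le_of_eq ?_)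
    rw [hx]; ring

/-- `θ` obeys the maximum principle as long as the field is bounded. -/
theorem abs_le_of_bounded (h : IsTransported s T θ z V) {b B M : ℝ} (hb : b ∈ Ico 0 T)
    (hB : ∀ t ∈ Icc 0 b, ∀ x, ‖V t x‖ ≤ B) (hM : ∀ x, |θ 0 x| ≤ M) (x : Plane) :
    |θ b x| ≤ M := by
  have hB0 : 0 ≤ B := (norm_nonneg _).trans (hB b ⟨hb.1, le_rfl⟩ x)
  have hab : Icc 0 b ⊆ Ico 0 T := fun t ht => ⟨ht.1, ht.2.trans_lt hb.2⟩
  -- A cone shrinking at speed `2B`, a bound for the speed relative to the vortex; its final ball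
  -- contains `x`.
  set ρ : ℝ → ℝ := fun t => ‖x - z b‖ + 1 + 2 * B * (b - t) with hρdef
  have hρ : ∀ t ∈ Icc 0 b, 0 < ρ t := fun t ht => by
    have := mul_nonneg hB0 (sub_nonneg.2 ht.2)
    have := norm_nonneg (x - z b)
    simp only [hρdef]; linarith
  have hρ' : ∀ t ∈ Icc 0 b, HasDerivWithinAt ρ (2 * B * -1) (Icc 0 b) t := fun t _ =>
    (((hasDerivWithinAt_id t _).const_sub b).const_mul (2 * B)).const_add _
  have hbar : ∀ t ∈ Icc 0 b, ∀ x, ‖x - z t‖ = ρ t →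
      ρ t * (2 * B * -1) ≤ inner ℝ (x - z t) (V t x - V t (z t)) := fun t ht x hx => by
    have h1 := (abs_le.1 (abs_real_inner_le_norm (x - z t) (V t x - V t (z t)))).1
    have h2 : ‖V t x - V t (z t)‖ ≤ 2 * B := (norm_sub_le _ _).trans (by
      linarith [hB t ht x, hB t ht (z t)])
    rw [hx] at h1
    nlinarith [hρ t ht]
  have hx : x ∈ Metric.closedBall (z b) (ρ b) := by
    rw [mem_closedBall_iff_norm]
    simp [hρdef]
  rw [abs_le]
  constructor
  · exact neg_le.1 (h.neg.le_on_ball_of_barrier hab hρ hρ' hbar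
      (fun y _ => neg_le.1 (abs_le.1 (hM y)).1) b ⟨hb.1, le_rfl⟩ x hx)
  · exact h.le_on_ball_of_barrier hab hρ hρ' hbar
      (fun y _ => (abs_le.1 (hM y)).2) b ⟨hb.1, le_rfl⟩ x hx

end IsTransported

/-! ### The radius of the plateau around the vortex -/

/-- Transport by a field that is jointly continuous, Lipschitz in space, and without flux through
the circles around the vortex, `θ` being constant near the vortex at time `0`. -/
structure IsRegularlyTransported (s T : ℝ) (θ : ℝ → Plane → ℝ) (z : ℝ → Plane)
    (V : ℝ → Plane → Plane) : Prop extends IsTransported s T θ z V where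
  continuousOn_velocity : ContinuousOn (Function.uncurry V) (Ico 0 T ×ˢ univ)
  lipschitz : ∀ b ∈ Ico 0 T, ∃ L : ℝ≥0, ∀ t ∈ Icc 0 b, LipschitzWith L (V t)
  exists_inner_nonpos : ∀ t ∈ Ico 0 T, ∀ r : ℝ, 0 < r → ∃ e : Plane, ‖e‖ = 1 ∧
    inner ℝ e (V t (z t + r • e) - V t (z t)) ≤ 0
  plateau : ∃ β : ℝ, ∃ R₀ > 0, ∀ x ∈ Metric.ball (z 0) R₀, θ 0 x = β

theorem abs_inner_sub_le {L : ℝ≥0} {w : Plane → Plane} (hw : LipschitzWith L w) (p x : Plane) :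
    |inner ℝ (x - p) (w x - w p)| ≤ L * ‖x - p‖ ^ 2 := by
  refine (abs_real_inner_le_norm _ _).trans ?_
  have := hw.norm_sub_le x p
  nlinarith [norm_nonneg (x - p)]

/-- Rescaling to a fixed unit sphere makes this a supremum over a compact set independent of `p` and
`r`, as the continuity argument requires. -/
theorem directionalLogLip_eq (w : Plane → Plane) (p : Plane) {r : ℝ} (hr : 0 < r) :
    directionalLogLip w p r = sSup ((fun e => -(inner ℝ e (w (p + r • e) - w p)) /
      (r * (1 - Real.log r))) '' Metric.sphere (0 : Plane) 1) := by
  have himg : Metric.sphere p r = (fun e => p + r • e) '' Metric.sphere (0 : Plane) 1 := by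
    ext x
    simp only [mem_sphere_iff_norm, sub_zero, mem_image]
    constructor
    · intro hx
      refine ⟨r⁻¹ • (x - p), ?_, by rw [smul_smul, mul_inv_cancel₀ hr.ne']; simp⟩
      rw [norm_smul, hx, norm_inv, Real.norm_of_nonneg hr.le, inv_mul_cancel₀ hr.ne']
    · rintro ⟨e, he, rfl⟩
      rw [add_sub_cancel_left, norm_smul, he, Real.norm_of_nonneg hr.le, mul_one]
  rw [directionalLogLip, himg, image_image]
  congr 1
  refine image_congr fun e _ => ?_
  rw [add_sub_cancel_left, real_inner_smul_left, sq, mul_assoc, ← mul_neg,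
    mul_div_mul_left _ _ hr.ne']

theorem le_directionalLogLip {w : Plane → Plane} (hw : Continuous w) (p : Plane) {r : ℝ}
    {x : Plane} (hx : ‖x - p‖ = r) :
    -(inner ℝ (x - p) (w x - w p)) / (r ^ 2 * (1 - Real.log r)) ≤ directionalLogLip w p r :=
  le_csSup ((isCompact_sphere p r).bddAbove_image (by fun_prop))
    (mem_image_of_mem _ (mem_sphere_iff_norm.2 hx))

theorem directionalLogLip_le {w : Plane → Plane} {p : Plane} {r C : ℝ} (hr : 0 < r)
    (h : ∀ x, ‖x - p‖ = r → -(inner ℝ (x - p) (w x - w p)) / (r ^ 2 * (1 - Real.log r)) ≤ C) :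
    directionalLogLip w p r ≤ C := by
  refine csSup_le ?_ ?_
  · exact (NormedSpace.sphere_nonempty.2 hr.le).image _
  · rintro _ ⟨x, hx, rfl⟩
    exact h x (mem_sphere_iff_norm.1 hx)

theorem continuousOn_sSup_image {X E : Type*} [TopologicalSpace X] [TopologicalSpace E]
    {F : X → E → ℝ} {S : Set X} {K : Set E} (hK : IsCompact K)
    (hF : ContinuousOn (Function.uncurry F) (S ×ˢ univ)) :
    ContinuousOn (fun x => sSup (F x '' K)) S := by
  rw [continuousOn_iff_continuous_domRestrict]
  exact hK.continuous_sSup (f := fun (x : S) e => F x e)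
    (hF.comp_continuous (f := fun p : S × E => ((p.1 : X), p.2)) (by fun_prop)
      fun p => ⟨p.1.2, mem_univ _⟩)

/-- Extending `G` by constants beyond the interval makes it continuous everywhere and settles the
endpoints. -/
theorem hasDerivWithinAt_integral_Icc {G : ℝ → ℝ} {a b t : ℝ} (hG : ContinuousOn G (Icc a b))
    (ht : t ∈ Icc a b) :
    HasDerivWithinAt (fun τ => ∫ σ in a..τ, G σ) (G t) (Icc a b) t := by
  have hab : a ≤ b := ht.1.trans ht.2
  have hc : Continuous (IccExtend hab (fun x : Icc a b => G x)) :=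
    (continuousOn_iff_continuous_domRestrict.1 hG).Icc_extend'
  have h1 := (hc.integral_hasStrictDerivAt a t).hasDerivAt.hasDerivWithinAt (s := Icc a b)
  rw [IccExtend_of_mem hab _ ht] at h1
  refine h1.congr (fun τ hτ => ?_) ?_
  · refine intervalIntegral.integral_congr fun σ hσ => ?_
    rw [uIcc_of_le hτ.1] at hσ
    exact (IccExtend_of_mem hab (fun x : Icc a b => G x) ⟨hσ.1, hσ.2.trans hτ.2⟩).symm
  · refine intervalIntegral.integral_congr fun σ hσ => ?_
    rw [uIcc_of_le ht.1] at hσ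
    exact (IccExtend_of_mem hab (fun x : Icc a b => G x) ⟨hσ.1, hσ.2.trans ht.2⟩).symm

/-- The oscillation of `w` on the unit ball around `p`, relative to the value at `p`. -/
def unitOsc (w : Plane → Plane) (p : Plane) : ℝ :=
  sSup ((fun e => ‖w (p + e) - w p‖) '' Metric.closedBall (0 : Plane) 1)

theorem norm_sub_le_unitOsc {w : Plane → Plane} (hw : Continuous w) {p x : Plane}
    (hx : ‖x - p‖ ≤ 1) : ‖w x - w p‖ ≤ unitOsc w p := by
  have := le_csSup ((isCompact_closedBall (0 : Plane) 1).bddAbove_image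
    (f := fun e => ‖w (p + e) - w p‖) (by fun_prop))
    (mem_image_of_mem _ (mem_closedBall_zero_iff.2 hx))
  rw [add_sub_cancel] at this
  exact this

theorem unitOsc_le {w : Plane → Plane} {p : Plane} {C : ℝ}
    (h : ∀ x, ‖x - p‖ ≤ 1 → ‖w x - w p‖ ≤ C) : unitOsc w p ≤ C := by
  refine csSup_le ((Metric.nonempty_closedBall.2 zero_le_one).image _) ?_
  rintro _ ⟨e, he, rfl⟩
  exact h _ (by simpa using he)

theorem unitOsc_nonneg {w : Plane → Plane} (hw : Continuous w) (p : Plane) : 0 ≤ unitOsc w p :=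
  (norm_nonneg _).trans (norm_sub_le_unitOsc hw (x := p) (by simp))

namespace IsRegularlyTransported

variable {s T : ℝ} {θ : ℝ → Plane → ℝ} {z : ℝ → Plane} {V : ℝ → Plane → Plane}

theorem Icc_subset {a b : ℝ} (ha : a ∈ Ico 0 T) (hb : b ∈ Ico 0 T) : Icc a b ⊆ Ico 0 T :=
  fun _ ht => ⟨ha.1.trans ht.1, ht.2.trans_lt hb.2⟩

/-- The Lipschitz constant up to time `t` is the rate of an exponential barrier started at half the
initial radius. -/
theorem plateauRadius_pos (h : IsRegularlyTransported s T θ z V) {t : ℝ} (ht : t ∈ Ico 0 T) :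
    0 < plateauRadius (θ t) (z t) := by
  obtain ⟨β, R₀, hR₀, hβ⟩ := h.plateau
  obtain ⟨L, hL⟩ := h.lipschitz t ht
  refine lt_of_lt_of_le ?_ (h.ofReal_mul_exp_le_plateauRadius (a := 0) (b := t) (c := R₀ / 2)
    (l := L) ht.1 (Icc_subset ⟨le_rfl, ht.1.trans_lt ht.2⟩ ht) (half_pos hR₀)
    (fun τ hτ x _ => (abs_le.1 (abs_inner_sub_le (hL τ hτ) (z τ) x)).1)
    (lt_of_lt_of_le ?_ (le_plateauRadius hβ)))
  · exact ENNReal.ofReal_pos.2 (mul_pos (half_pos hR₀) (Real.exp_pos _))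
  · exact (ENNReal.ofReal_lt_ofReal_iff hR₀).2 (half_lt_self hR₀)

section

variable {t₀ : ℝ}

theorem mem_Ico_of_le (ht₀ : t₀ ∈ Ico 0 T) {t : ℝ} (ht : t ∈ Ico t₀ T) : t ∈ Ico 0 T :=
  ⟨ht₀.1.trans ht.1, ht.2⟩

theorem radius_pos (h : IsRegularlyTransported s T θ z V) (ht₀ : t₀ ∈ Ico 0 T)
    (hR : ∀ t ∈ Ico t₀ T, plateauRadius (θ t) (z t) < 1) {t : ℝ} (ht : t ∈ Ico t₀ T) :
    0 < (plateauRadius (θ t) (z t)).toReal :=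
  ENNReal.toReal_pos (h.plateauRadius_pos (mem_Ico_of_le ht₀ ht)).ne'
    ((hR t ht).trans ENNReal.one_lt_top).ne

theorem radius_lt_one (hR : ∀ t ∈ Ico t₀ T, plateauRadius (θ t) (z t) < 1) {t : ℝ}
    (ht : t ∈ Ico t₀ T) : (plateauRadius (θ t) (z t)).toReal < 1 := by
  have := (ENNReal.toReal_lt_toReal ((hR t ht).trans ENNReal.one_lt_top).ne
    ENNReal.one_ne_top).2 (hR t ht)
  simpa using this

theorem ofReal_lt_plateauRadius_iff (hR : ∀ t ∈ Ico t₀ T, plateauRadius (θ t) (z t) < 1) {t : ℝ}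
    (ht : t ∈ Ico t₀ T) {c : ℝ} (hc : 0 ≤ c) : ENNReal.ofReal c < plateauRadius (θ t) (z t) ↔
      c < (plateauRadius (θ t) (z t)).toReal :=
  ENNReal.ofReal_lt_iff_lt_toReal hc ((hR t ht).trans ENNReal.one_lt_top).ne

theorem ofReal_le_plateauRadius_iff (hR : ∀ t ∈ Ico t₀ T, plateauRadius (θ t) (z t) < 1) {t : ℝ}
    (ht : t ∈ Ico t₀ T) {c : ℝ} : ENNReal.ofReal c ≤ plateauRadius (θ t) (z t) ↔
      c ≤ (plateauRadius (θ t) (z t)).toReal :=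
  ENNReal.ofReal_le_iff_le_toReal ((hR t ht).trans ENNReal.one_lt_top).ne

/-- Barriers must start strictly inside the plateau; this lets the starting radius tend to the
plateau radius. -/
theorem le_of_forall_mem_Ioo {ϱ c₀ k A : ℝ} (hc₀ : c₀ < ϱ) (h : ∀ c ∈ Ioo c₀ ϱ, c * k ≤ A) :
    ϱ * k ≤ A := by
  have h1 : Tendsto (fun c => c * k) (𝓝[<] ϱ) (𝓝 (ϱ * k)) :=
    ((continuous_id.mul continuous_const).tendsto ϱ).mono_left nhdsWithin_le_nhds
  exact le_of_tendsto h1 (Filter.eventually_of_mem (Ioo_mem_nhdsLT hc₀) h)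

/-- The threshold `c₀` means that the barrier condition has to be checked only for starting radii
close to `R(a)`, which is all that a local estimate of the field provides. -/
theorem radius_mul_exp_le (h : IsRegularlyTransported s T θ z V) (ht₀ : t₀ ∈ Ico 0 T)
    (hR : ∀ t ∈ Ico t₀ T, plateauRadius (θ t) (z t) < 1) {a b l c₀ : ℝ} (ha : a ∈ Ico t₀ T)
    (hb : b ∈ Ico t₀ T) (hab : a ≤ b) (hc₀ : c₀ < (plateauRadius (θ a) (z a)).toReal)
    (hbar : ∀ c ∈ Ioo c₀ (plateauRadius (θ a) (z a)).toReal, ∀ t ∈ Icc a b,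
      ∀ x, ‖x - z t‖ = c * Real.exp (-(l * (t - a))) →
      -(l * ‖x - z t‖ ^ 2) ≤ inner ℝ (x - z t) (V t x - V t (z t))) :
    (plateauRadius (θ a) (z a)).toReal * Real.exp (-(l * (b - a))) ≤
      (plateauRadius (θ b) (z b)).toReal := by
  refine le_of_forall_mem_Ioo (max_lt hc₀ (h.radius_pos ht₀ hR ha)) fun c hc => ?_
  have hc0 : 0 < c := (le_max_right _ _).trans_lt hc.1
  exact (ofReal_le_plateauRadius_iff hR hb).1 (h.ofReal_mul_exp_le_plateauRadius hab
    (Icc_subset (mem_Ico_of_le ht₀ ha) (mem_Ico_of_le ht₀ hb)) hc0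
    (hbar c ⟨(le_max_left _ _).trans_lt hc.1, hc.2⟩)
    ((ofReal_lt_plateauRadius_iff hR ha hc0.le).2 hc.2))

theorem radius_mul_exp_le_backward (h : IsRegularlyTransported s T θ z V) (ht₀ : t₀ ∈ Ico 0 T)
    (hR : ∀ t ∈ Ico t₀ T, plateauRadius (θ t) (z t) < 1) {a b l : ℝ} (ha : a ∈ Ico t₀ T)
    (hb : b ∈ Ico t₀ T) (hab : a ≤ b)
    (hbar : ∀ t ∈ Icc a b, ∀ x, inner ℝ (x - z t) (V t x - V t (z t)) ≤ l * ‖x - z t‖ ^ 2) :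
    (plateauRadius (θ b) (z b)).toReal * Real.exp (-(l * (b - a))) ≤
      (plateauRadius (θ a) (z a)).toReal := by
  refine le_of_forall_mem_Ioo (h.radius_pos ht₀ hR hb) fun c hc => ?_
  exact (ofReal_le_plateauRadius_iff hR ha).1 (h.ofReal_mul_exp_le_plateauRadius_backward hab
    (Icc_subset (mem_Ico_of_le ht₀ ha) (mem_Ico_of_le ht₀ hb)) hc.1 hbar
    ((ofReal_lt_plateauRadius_iff hR hb hc.1.le).2 hc.2))

/-- Forward and backward exponential barriers make `log R` Lipschitz on every compact time interval.
-/
theorem continuousOn_radius (h : IsRegularlyTransported s T θ z V) (ht₀ : t₀ ∈ Ico 0 T)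
    (hR : ∀ t ∈ Ico t₀ T, plateauRadius (θ t) (z t) < 1) :
    ContinuousOn (fun t => (plateauRadius (θ t) (z t)).toReal) (Ico t₀ T) := by
  set ϱ : ℝ → ℝ := fun t => (plateauRadius (θ t) (z t)).toReal with hϱ
  have hpos : ∀ t ∈ Ico t₀ T, 0 < ϱ t := fun t ht => h.radius_pos ht₀ hR ht
  suffices hlog : ContinuousOn (fun t => Real.log (ϱ t)) (Ico t₀ T) by
    refine (Real.continuous_exp.comp_continuousOn hlog).congr fun t ht => ?_
    exact (Real.exp_log (hpos t ht)).symm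
  intro t ht
  obtain ⟨b, hb⟩ := exists_between ht.2
  have hbI : b ∈ Ico t₀ T := ⟨ht.1.trans hb.1.le, hb.2⟩
  obtain ⟨L, hL⟩ := h.lipschitz b (mem_Ico_of_le ht₀ hbI)
  have hlip : LipschitzOnWith L (fun t => Real.log (ϱ t)) (Icc t₀ b) := by
    refine LipschitzOnWith.of_le_add_mul _ ?_
    have main : ∀ a ∈ Icc t₀ b, ∀ c ∈ Icc t₀ b, a ≤ c →
        Real.log (ϱ a) ≤ Real.log (ϱ c) + L * (c - a) ∧
        Real.log (ϱ c) ≤ Real.log (ϱ a) + L * (c - a) := by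
      intro a ha c hc hac
      have haI : a ∈ Ico t₀ T := ⟨ha.1, ha.2.trans_lt hb.2⟩
      have hcI : c ∈ Ico t₀ T := ⟨hc.1, hc.2.trans_lt hb.2⟩
      have hsub : ∀ τ ∈ Icc a c, τ ∈ Icc 0 b := fun τ hτ =>
        ⟨ht₀.1.trans (ha.1.trans hτ.1), hτ.2.trans hc.2⟩
      have h1 := h.radius_mul_exp_le ht₀ hR haI hcI hac (l := L) (c₀ := 0) (hpos a haI)
        fun _ _ τ hτ x _ => (abs_le.1 (abs_inner_sub_le (hL τ (hsub τ hτ)) (z τ) x)).1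
      have h2 := h.radius_mul_exp_le_backward ht₀ hR haI hcI hac (l := L)
        fun τ hτ x => (abs_le.1 (abs_inner_sub_le (hL τ (hsub τ hτ)) (z τ) x)).2
      have h3 := Real.log_le_log (mul_pos (hpos a haI) (Real.exp_pos _)) h1
      have h4 := Real.log_le_log (mul_pos (hpos c hcI) (Real.exp_pos _)) h2
      rw [Real.log_mul (hpos a haI).ne' (Real.exp_pos _).ne', Real.log_exp] at h3
      rw [Real.log_mul (hpos c hcI).ne' (Real.exp_pos _).ne', Real.log_exp] at h4
      constructor
      · change _ ≤ Real.log (ϱ c) at h3; linarith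
      · change _ ≤ Real.log (ϱ a) at h4; linarith
    intro x hx y hy
    rcases le_total x y with hxy | hxy
    · rw [Real.dist_eq, abs_sub_comm, abs_of_nonneg (sub_nonneg.2 hxy)]
      exact (main x hx y hy hxy).1
    · rw [Real.dist_eq, abs_of_nonneg (sub_nonneg.2 hxy)]
      exact (main y hy x hx hxy).2
  refine (hlip.continuousOn t ⟨ht.1, hb.1.le⟩).mono_of_mem_nhdsWithin ?_
  filter_upwards [inter_mem_nhdsWithin (Ico t₀ T) (Iio_mem_nhds hb.1)] with τ hτ
  exact ⟨hτ.1.1, hτ.2.le⟩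

theorem continuousOn_vortex (h : IsRegularlyTransported s T θ z V) : ContinuousOn z (Ico 0 T) :=
  fun t ht => (h.vortex t ht).continuousWithinAt

theorem continuousOn_directionalLogLip (h : IsRegularlyTransported s T θ z V) :
    ContinuousOn (fun q : ℝ × ℝ => directionalLogLip (V q.1) (z q.1) q.2)
      (Ico 0 T ×ˢ Ioo 0 1) := by
  refine ContinuousOn.congr (continuousOn_sSup_image (isCompact_sphere (0 : Plane) 1)
    (F := fun q : ℝ × ℝ => fun e => -(inner ℝ e (V q.1 (z q.1 + q.2 • e) - V q.1 (z q.1))) /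
      (q.2 * (1 - Real.log q.2))) ?_) fun q hq => directionalLogLip_eq _ _ hq.2.1
  have hz : ContinuousOn (fun p : (ℝ × ℝ) × Plane => z p.1.1)
      ((Ico 0 T ×ˢ Ioo 0 1) ×ˢ univ) :=
    h.continuousOn_vortex.comp (by fun_prop) fun p hp => hp.1.1
  have h1 : ContinuousOn (fun p : (ℝ × ℝ) × Plane => V p.1.1 (z p.1.1 + p.1.2 • p.2))
      ((Ico 0 T ×ˢ Ioo 0 1) ×ˢ univ) :=
    h.continuousOn_velocity.comp (f := fun p : (ℝ × ℝ) × Plane => (p.1.1, z p.1.1 + p.1.2 • p.2))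
      (continuousOn_fst.fst.prodMk (hz.add (continuousOn_fst.snd.smul continuousOn_snd)))
      fun p hp => ⟨hp.1.1, mem_univ _⟩
  have h2 : ContinuousOn (fun p : (ℝ × ℝ) × Plane => V p.1.1 (z p.1.1))
      ((Ico 0 T ×ˢ Ioo 0 1) ×ˢ univ) :=
    h.continuousOn_velocity.comp (f := fun p : (ℝ × ℝ) × Plane => (p.1.1, z p.1.1))
      (continuousOn_fst.fst.prodMk hz) fun p hp => ⟨hp.1.1, mem_univ _⟩
  have h3 : ContinuousOn (fun p : (ℝ × ℝ) × Plane => Real.log p.1.2)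
      ((Ico 0 T ×ˢ Ioo 0 1) ×ˢ univ) :=
    ContinuousOn.log (by fun_prop) fun p hp => hp.1.2.1.ne'
  refine ContinuousOn.div ((continuousOn_snd.inner (h1.sub h2)).neg) (by fun_prop)
    fun p hp => (mul_pos hp.1.2.1 ?_).ne'
  linarith [Real.log_neg hp.1.2.1 hp.1.2.2]

/-- The maximum is at least its value at the point of the circle where the relative velocity does
not point outwards. -/
theorem directionalLogLip_nonneg (h : IsRegularlyTransported s T θ z V) {t r : ℝ}
    (ht : t ∈ Ico 0 T) (hr : 0 < r) (hr1 : r < 1) : 0 ≤ directionalLogLip (V t) (z t) r := by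
  obtain ⟨e, he, hle⟩ := h.exists_inner_nonpos t ht r hr
  refine le_trans ?_ (le_directionalLogLip (h.continuous_velocity t ht) (z t) (x := z t + r • e)
    (by rw [add_sub_cancel_left, norm_smul, he, Real.norm_of_nonneg hr.le, mul_one]))
  rw [add_sub_cancel_left, real_inner_smul_left]
  have := Real.log_neg hr hr1
  refine div_nonneg ?_ (mul_nonneg (sq_nonneg r) (by linarith))
  exact neg_nonneg.2 (mul_nonpos_of_nonneg_of_nonpos hr.le hle)

theorem continuousOn_rate (h : IsRegularlyTransported s T θ z V) (ht₀ : t₀ ∈ Ico 0 T)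
    (hR : ∀ t ∈ Ico t₀ T, plateauRadius (θ t) (z t) < 1) :
    ContinuousOn (fun t => directionalLogLip (V t) (z t) (plateauRadius (θ t) (z t)).toReal)
      (Ico t₀ T) :=
  h.continuousOn_directionalLogLip.comp
    (f := fun t => (t, (plateauRadius (θ t) (z t)).toReal))
    (continuousOn_id.prodMk (h.continuousOn_radius ht₀ hR))
    fun _ ht => ⟨mem_Ico_of_le ht₀ ht, h.radius_pos ht₀ hR ht, radius_lt_one hR ht⟩

/-- Choose `q` between the rate at `a` and `r`, and let `A = 1 - ln R(a)`. By continuity an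
exponential barrier of rate `l = qA` is valid near `(a, R(a))`. Hence `1 - ln R(b) ≤ A (1 + q (b -
a))`, and `log(1 + x) ≤ x` bounds the slope by `q < r`. -/
theorem eventually_slope_lt (h : IsRegularlyTransported s T θ z V) (ht₀ : t₀ ∈ Ico 0 T)
    (hR : ∀ t ∈ Ico t₀ T, plateauRadius (θ t) (z t) < 1) {a r : ℝ} (ha : a ∈ Ico t₀ T)
    (hr : directionalLogLip (V a) (z a) (plateauRadius (θ a) (z a)).toReal < r) :
    ∀ᶠ b in 𝓝[>] a, slope
      (fun t => Real.log (1 - Real.log (plateauRadius (θ t) (z t)).toReal)) a b < r := by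
  set ϱ : ℝ → ℝ := fun t => (plateauRadius (θ t) (z t)).toReal with hϱ
  have hpos : ∀ t ∈ Ico t₀ T, 0 < ϱ t := fun t ht => h.radius_pos ht₀ hR ht
  have hlt1 : ∀ t ∈ Ico t₀ T, ϱ t < 1 := fun t ht => radius_lt_one hR ht
  have ha0 := mem_Ico_of_le ht₀ ha
  obtain ⟨q, hq1, hq2⟩ := exists_between hr
  have hq0 : 0 < q := (h.directionalLogLip_nonneg ha0 (hpos a ha) (hlt1 a ha)).trans_lt hq1
  set A := 1 - Real.log (ϱ a) with hA
  have hA1 : 1 < A := by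
    have := Real.log_neg (hpos a ha) (hlt1 a ha)
    linarith
  have hcont : ContinuousOn (fun p : ℝ × ℝ => directionalLogLip (V p.1) (z p.1) p.2 *
      (1 - Real.log p.2)) (Ico 0 T ×ˢ Ioo 0 1) :=
    h.continuousOn_directionalLogLip.mul (continuousOn_const.sub
      (ContinuousOn.log continuousOn_snd fun p hp => hp.2.1.ne'))
  have hmem : (a, ϱ a) ∈ Ico 0 T ×ˢ Ioo (0 : ℝ) 1 := ⟨ha0, hpos a ha, hlt1 a ha⟩
  have hev := (hcont _ hmem).eventually_lt_const (u := q * A)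
    (mul_lt_mul_of_pos_right hq1 (by linarith))
  obtain ⟨l, hl⟩ : ∃ l, l = q * A := ⟨_, rfl⟩
  rw [← hl] at hev
  obtain ⟨δ, hδ, hball⟩ := Metric.mem_nhdsWithin_iff.1 hev
  replace hball : ∀ p ∈ Metric.ball (a, ϱ a) δ ∩ Ico 0 T ×ˢ Ioo (0 : ℝ) 1,
      directionalLogLip (V p.1) (z p.1) p.2 * (1 - Real.log p.2) < l := fun p hp => hball hp
  have hl0 : 0 < l := hl ▸ mul_pos hq0 (by linarith)
  -- For times below `δ/(2l)` a barrier starting within `δ/2` of `R(a)` loses less than `δ/2` more,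
  -- so it stays in the neighbourhood where the rate is controlled.
  have hTa : a < min T (a + min δ (δ / (2 * l))) := by
    refine lt_min ha.2 ?_
    have : 0 < min δ (δ / (2 * l)) := lt_min hδ (by positivity)
    linarith
  filter_upwards [Ioo_mem_nhdsGT hTa] with b hb
  have hbT : b < T := hb.2.trans_le (min_le_left _ _)
  have hbδ : b - a < δ := by
    have := hb.2.trans_le ((min_le_right _ _).trans (add_le_add_right (min_le_left _ _) a))
    linarith
  have hbl : l * (b - a) < δ / 2 := by
    have := hb.2.trans_le ((min_le_right _ _).trans (add_le_add_right (min_le_right _ _) a))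
    have h2 : b - a < δ / (2 * l) := by linarith
    calc l * (b - a) < l * (δ / (2 * l)) := mul_lt_mul_of_pos_left h2 hl0
      _ = δ / 2 := by field_simp
  have hbI : b ∈ Ico t₀ T := ⟨ha.1.trans hb.1.le, hbT⟩
  have hrad : ϱ a * Real.exp (-(l * (b - a))) ≤ ϱ b := by
    refine h.radius_mul_exp_le ht₀ hR ha hbI hb.1.le (c₀ := max (ϱ a - δ / 2) 0)
      (max_lt (by linarith) (hpos a ha)) fun c hc t ht x hx => ?_
    have hc0 : 0 < c := (le_max_right _ _).trans_lt hc.1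
    have hcδ : ϱ a - δ / 2 < c := (le_max_left _ _).trans_lt hc.1
    have hcϱ : c < ϱ a := hc.2
    set y := l * (t - a) with hy
    have hy0 : 0 ≤ y := mul_nonneg hl0.le (sub_nonneg.2 ht.1)
    have hyδ : y < δ / 2 := lt_of_le_of_lt
      (mul_le_mul_of_nonneg_left (sub_le_sub_right ht.2 a) hl0.le) hbl
    obtain ⟨r', hr'⟩ : ∃ r', r' = c * Real.exp (-y) := ⟨_, rfl⟩
    rw [← hr'] at hx
    have hr'0 : 0 < r' := hr' ▸ mul_pos hc0 (Real.exp_pos _)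
    have hr'c : r' ≤ c := hr' ▸ mul_le_of_le_one_right hc0.le (Real.exp_le_one_iff.2 (by linarith))
    have hr'l : c - y ≤ r' := by
      have h1 := Real.one_sub_le_exp_neg y
      have h2 := mul_le_mul_of_nonneg_left h1 hc0.le
      have h3 : c * y ≤ y := mul_le_of_le_one_left hy0 (hcϱ.trans (hlt1 a ha)).le
      calc c - y ≤ c * (1 - y) := by linarith
        _ ≤ r' := hr' ▸ h2
    have hr'1 : r' < 1 := hr'c.trans_lt (hcϱ.trans (hlt1 a ha))
    have htT : t ∈ Ico 0 T := mem_Ico_of_le ht₀ ⟨ha.1.trans ht.1, ht.2.trans_lt hbT⟩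
    have hin : (t, r') ∈ Metric.ball (a, ϱ a) δ ∩ Ico 0 T ×ˢ Ioo (0 : ℝ) 1 := by
      refine ⟨?_, htT, hr'0, hr'1⟩
      rw [Metric.mem_ball, Prod.dist_eq, max_lt_iff, Real.dist_eq, Real.dist_eq, abs_lt, abs_lt]
      refine ⟨⟨?_, ?_⟩, ?_, ?_⟩ <;> linarith [ht.1, ht.2]
    have h1 : directionalLogLip (V t) (z t) r' * (1 - Real.log r') < l :=
      hball (t, r') hin
    have h2 : -(inner ℝ (x - z t) (V t x - V t (z t))) / (r' ^ 2 * (1 - Real.log r')) ≤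
        directionalLogLip (V t) (z t) r' :=
      le_directionalLogLip (h.continuous_velocity t htT) (z t) hx
    have hlog : 0 < 1 - Real.log r' := by linarith [Real.log_neg hr'0 hr'1]
    rw [div_le_iff₀ (mul_pos (sq_pos_of_pos hr'0) hlog)] at h2
    rw [hx]
    have h3 := mul_le_mul_of_nonneg_right h1.le (sq_nonneg r')
    linarith
  have h1 := Real.log_le_log (mul_pos (hpos a ha) (Real.exp_pos _)) hrad
  rw [Real.log_mul (hpos a ha).ne' (Real.exp_pos _).ne', Real.log_exp] at h1
  have hAb : 1 - Real.log (ϱ b) ≤ A * (1 + q * (b - a)) := by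
    rw [hl] at h1; linarith
  have hApos : 0 < 1 - Real.log (ϱ b) := by
    linarith [Real.log_neg (hpos b hbI) (hlt1 b hbI)]
  have hba : 0 < b - a := sub_pos.2 hb.1
  have hqba : 0 < 1 + q * (b - a) := by positivity
  have h2 := Real.log_le_log hApos hAb
  rw [Real.log_mul (by linarith) hqba.ne'] at h2
  have h3 := Real.log_le_sub_one_of_pos hqba
  rw [slope_def_field]
  refine lt_of_le_of_lt ?_ hq2
  rw [div_le_iff₀ hba]
  change Real.log (1 - Real.log (ϱ b)) - Real.log A ≤ _
  linarith

/-- The differential inequality for `log(1 - ln R)` is integrated by comparing its upper right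
derivative with the continuous rate. -/
theorem log_sub_log_le_integral (h : IsRegularlyTransported s T θ z V) (ht₀ : t₀ ∈ Ico 0 T)
    (hR : ∀ t ∈ Ico t₀ T, plateauRadius (θ t) (z t) < 1) {b : ℝ} (hb : b ∈ Ico t₀ T) :
    Real.log (1 - Real.log (plateauRadius (θ b) (z b)).toReal) ≤
      Real.log (1 - Real.log (plateauRadius (θ t₀) (z t₀)).toReal) +
      ∫ t in t₀..b, directionalLogLip (V t) (z t) (plateauRadius (θ t) (z t)).toReal := by
  have hsub : Icc t₀ b ⊆ Ico t₀ T := fun t ht => ⟨ht.1, ht.2.trans_lt hb.2⟩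
  have hN := (h.continuousOn_rate ht₀ hR).mono hsub
  have hder := fun t ht => (hasDerivWithinAt_integral_Icc hN (t := t) ht).const_add
    (Real.log (1 - Real.log (plateauRadius (θ t₀) (z t₀)).toReal))
  refine image_le_of_liminf_slope_right_le_deriv_boundary
    (f := fun t => Real.log (1 - Real.log (plateauRadius (θ t) (z t)).toReal))
    (B := fun τ => Real.log (1 - Real.log (plateauRadius (θ t₀) (z t₀)).toReal) +
      ∫ t in t₀..τ, directionalLogLip (V t) (z t) (plateauRadius (θ t) (z t)).toReal)
    ?_ (by simp) (fun t ht => (hder t ht).continuousWithinAt) (fun t ht => ?_)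
    (fun t ht r hr => (h.eventually_slope_lt ht₀ hR (hsub (Ico_subset_Icc_self ht)) hr).frequently)
    (right_mem_Icc.2 hb.1)
  · refine ContinuousOn.log (continuousOn_const.sub (((h.continuousOn_radius ht₀ hR).mono
      hsub).log fun t ht => (h.radius_pos ht₀ hR (hsub ht)).ne')) fun t ht => ?_
    have := Real.log_neg (h.radius_pos ht₀ hR (hsub ht)) (radius_lt_one hR (hsub ht))
    exact (by linarith : (0 : ℝ) < _).ne'
  · exact (hder t (Ico_subset_Icc_self ht)).mono_of_mem_nhdsWithin
      (mem_of_superset (Icc_mem_nhdsGE ht.2) (Icc_subset_Icc_left ht.1))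

end

end IsRegularlyTransported

/-! ### Collapse of the plateau in terms of the inward rate -/

namespace IsRegularlyTransported

variable {s T : ℝ} {θ : ℝ → Plane → ℝ} {z : ℝ → Plane} {V : ℝ → Plane → Plane} {t₀ : ℝ}

theorem rate_nonneg (h : IsRegularlyTransported s T θ z V) (ht₀ : t₀ ∈ Ico 0 T)
    (hR : ∀ t ∈ Ico t₀ T, plateauRadius (θ t) (z t) < 1) {t : ℝ} (ht : t ∈ Ico t₀ T) :
    0 ≤ directionalLogLip (V t) (z t) (plateauRadius (θ t) (z t)).toReal :=
  h.directionalLogLip_nonneg (mem_Ico_of_le ht₀ ht) (h.radius_pos ht₀ hR ht) (radius_lt_one hR ht)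

/-- Letting `b → T` in the integrated inequality forces the divergence; the negative part vanishes
because the rate is nonnegative. -/
theorem integralEqTop_of_tendsto (h : IsRegularlyTransported s T θ z V) (ht₀ : t₀ ∈ Ico 0 T)
    (hR : ∀ t ∈ Ico t₀ T, plateauRadius (θ t) (z t) < 1)
    (hlim : Tendsto (fun t => plateauRadius (θ t) (z t)) (𝓝[<] T) (𝓝 0)) :
    IntegralEqTop (fun t => directionalLogLip (V t) (z t) (plateauRadius (θ t) (z t)).toReal)
      t₀ T := by
  have hcont := h.continuousOn_rate ht₀ hR
  refine ⟨(hcont.mono Ioo_subset_Ico_self).aemeasurable measurableSet_Ioo, ?_, ?_⟩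
  · set N : ℝ → ℝ := fun t => directionalLogLip (V t) (z t) (plateauRadius (θ t) (z t)).toReal
    set f : ℝ → ℝ := fun t => Real.log (1 - Real.log (plateauRadius (θ t) (z t)).toReal)
    have hIoo : Ioo t₀ T ∈ 𝓝[<] T := Ioo_mem_nhdsLT ht₀.2
    have hf : Tendsto f (𝓝[<] T) atTop := by
      have h1 : Tendsto (fun t => (plateauRadius (θ t) (z t)).toReal) (𝓝[<] T) (𝓝[>] 0) := by
        refine tendsto_nhdsWithin_iff.2 ⟨?_, ?_⟩
        · exact (ENNReal.tendsto_toReal ENNReal.zero_ne_top).comp hlim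
        · exact Filter.eventually_of_mem hIoo fun t ht =>
            h.radius_pos ht₀ hR (Ioo_subset_Ico_self ht)
      have h2 := Real.tendsto_log_nhdsGT_zero.comp h1
      refine Real.tendsto_log_atTop.comp ?_
      exact tendsto_atTop_add_const_left _ 1 (tendsto_neg_atBot_atTop.comp h2)
    have hlow : ∀ᶠ t in 𝓝[<] T, ENNReal.ofReal (f t - f t₀) ≤
        ∫⁻ t in Ioo t₀ T, ENNReal.ofReal (N t) := by
      filter_upwards [hIoo] with b hb
      have hsub : Ioc t₀ b ⊆ Ioo t₀ T := fun t ht => ⟨ht.1, ht.2.trans_lt hb.2⟩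
      have h1 := h.log_sub_log_le_integral ht₀ hR (Ioo_subset_Ico_self hb)
      rw [intervalIntegral.integral_of_le hb.1.le] at h1
      have hint : IntegrableOn N (Ioc t₀ b) :=
        ((hcont.mono fun t ht => ⟨ht.1, ht.2.trans_lt hb.2⟩ :
          ContinuousOn N (Icc t₀ b)).integrableOn_Icc).mono_set Ioc_subset_Icc_self
      have h2 := ofReal_integral_eq_lintegral_ofReal hint
        ((ae_restrict_iff' measurableSet_Ioc).2 (Eventually.of_forall fun t ht =>
          h.rate_nonneg ht₀ hR (Ioo_subset_Ico_self (hsub ht))))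
      calc ENNReal.ofReal (f b - f t₀) ≤ ENNReal.ofReal (∫ t in Ioc t₀ b, N t) :=
            ENNReal.ofReal_le_ofReal (sub_le_iff_le_add'.2 h1)
        _ = ∫⁻ t in Ioc t₀ b, ENNReal.ofReal (N t) := h2
        _ ≤ _ := lintegral_mono_set hsub
    have h3 : Tendsto (fun t => ENNReal.ofReal (f t - f t₀)) (𝓝[<] T) (𝓝 ∞) :=
      ENNReal.tendsto_ofReal_atTop.comp (tendsto_atTop_add_const_right _ _ hf)
    exact top_le_iff.1 (le_of_tendsto h3 hlow)
  · refine lt_of_eq_of_lt ?_ ENNReal.zero_lt_top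
    refine (setLIntegral_congr_fun measurableSet_Ioo fun t ht => ?_).trans (lintegral_zero)
    exact ENNReal.ofReal_of_nonpos
      (neg_nonpos.2 (h.rate_nonneg ht₀ hR (Ioo_subset_Ico_self ht)))

/-- Only times near `T` matter: on `[t₀, a]` the rate is continuous. -/
theorem lintegral_rate_lt_top_of_le (h : IsRegularlyTransported s T θ z V) (ht₀ : t₀ ∈ Ico 0 T)
    (hR : ∀ t ∈ Ico t₀ T, plateauRadius (θ t) (z t) < 1) {a C : ℝ} {g : ℝ → ℝ}
    (ha : a ∈ Ico t₀ T) (hC : 0 ≤ C)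
    (hg : ∫⁻ t in Ioo t₀ T, ENNReal.ofReal (g t) < ∞)
    (hle : ∀ t ∈ Ico a T, directionalLogLip (V t) (z t) (plateauRadius (θ t) (z t)).toReal ≤
      C * g t) :
    ∫⁻ t in Ioo t₀ T, ENNReal.ofReal
      (directionalLogLip (V t) (z t) (plateauRadius (θ t) (z t)).toReal) < ∞ := by
  have hunion : Ioo t₀ T ⊆ Icc t₀ a ∪ Ioo a T := fun t ht => by
    rcases le_or_gt t a with h1 | h1
    · exact Or.inl ⟨ht.1.le, h1⟩
    · exact Or.inr ⟨h1, ht.2⟩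
  refine (lintegral_mono_set hunion).trans_lt ((lintegral_union_le _ _ _).trans_lt ?_)
  refine ENNReal.add_lt_top.2 ⟨?_, ?_⟩
  · have hint := ((h.continuousOn_rate ht₀ hR).mono
      (fun t ht => ⟨ht.1, ht.2.trans_lt ha.2⟩ : Icc t₀ a ⊆ Ico t₀ T)).integrableOn_Icc (μ := volume)
    exact hint.lintegral_lt_top
  · calc ∫⁻ t in Ioo a T, ENNReal.ofReal
          (directionalLogLip (V t) (z t) (plateauRadius (θ t) (z t)).toReal)
        ≤ ∫⁻ t in Ioo a T, ENNReal.ofReal C * ENNReal.ofReal (g t) := by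
          refine setLIntegral_mono' measurableSet_Ioo fun t ht => ?_
          rw [← ENNReal.ofReal_mul hC]
          exact ENNReal.ofReal_le_ofReal (hle t (Ioo_subset_Ico_self ht))
      _ = ENNReal.ofReal C * ∫⁻ t in Ioo a T, ENNReal.ofReal (g t) :=
          lintegral_const_mul' _ _ ENNReal.ofReal_ne_top
      _ < ∞ := ENNReal.mul_lt_top ENNReal.ofReal_lt_top
          ((lintegral_mono_set (Ioo_subset_Ioo_left ha.1)).trans_lt hg)

/-- Since `1 - ln R ≥ 1`, the rate is at most `L`, and the time interval is bounded. -/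
theorem not_integralEqTop_of_lipschitz (h : IsRegularlyTransported s T θ z V)
    (ht₀ : t₀ ∈ Ico 0 T) (hR : ∀ t ∈ Ico t₀ T, plateauRadius (θ t) (z t) < 1) {L : ℝ≥0}
    (hL : ∀ t ∈ Ico 0 T, LipschitzWith L (V t)) :
    ¬IntegralEqTop (fun t => directionalLogLip (V t) (z t) (plateauRadius (θ t) (z t)).toReal)
      t₀ T := by
  intro htop
  refine (h.lintegral_rate_lt_top_of_le ht₀ hR (C := L) (g := fun _ => 1) (left_mem_Ico.2 ht₀.2)
    L.2 (by simp) fun t ht => ?_).ne htop.2.1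
  have hpos := h.radius_pos ht₀ hR ht
  have hlog := Real.log_neg hpos (radius_lt_one hR ht)
  refine directionalLogLip_le hpos fun x hx => ?_
  rw [div_le_iff₀ (mul_pos (sq_pos_of_pos hpos) (by linarith))]
  have h1 := (abs_le.1 (abs_inner_sub_le (hL t (mem_Ico_of_le ht₀ ht)) (z t) x)).1
  rw [hx] at h1
  have h2 : 0 ≤ L * (plateauRadius (θ t) (z t)).toReal ^ 2 := by positivity
  nlinarith

theorem continuousOn_unitOsc (h : IsRegularlyTransported s T θ z V) :
    ContinuousOn (fun t => unitOsc (V t) (z t)) (Ico 0 T) := by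
  refine continuousOn_sSup_image (isCompact_closedBall (0 : Plane) 1)
    (F := fun t e => ‖V t (z t + e) - V t (z t)‖) ?_
  have hz : ContinuousOn (fun p : ℝ × Plane => z p.1) (Ico 0 T ×ˢ univ) :=
    h.continuousOn_vortex.comp (by fun_prop) fun p hp => hp.1
  have h1 : ContinuousOn (fun p : ℝ × Plane => V p.1 (z p.1 + p.2)) (Ico 0 T ×ˢ univ) :=
    h.continuousOn_velocity.comp (f := fun p : ℝ × Plane => (p.1, z p.1 + p.2))
      (continuousOn_fst.prodMk (hz.add continuousOn_snd)) fun p hp => ⟨hp.1, mem_univ _⟩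
  have h2 : ContinuousOn (fun p : ℝ × Plane => V p.1 (z p.1)) (Ico 0 T ×ˢ univ) :=
    h.continuousOn_velocity.comp (f := fun p : ℝ × Plane => (p.1, z p.1))
      (continuousOn_fst.prodMk hz) fun p hp => ⟨hp.1, mem_univ _⟩
  exact (h1.sub h2).norm

/-- A barrier whose radius shrinks at speed `G`, the oscillation on the unit ball. Since `R < 1`,
the barrier never leaves the region where `G` bounds the relative velocity. -/
theorem radius_sub_integral_le (h : IsRegularlyTransported s T θ z V) (ht₀ : t₀ ∈ Ico 0 T)
    (hR : ∀ t ∈ Ico t₀ T, plateauRadius (θ t) (z t) < 1) {a b : ℝ} (ha : a ∈ Ico t₀ T)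
    (hb : b ∈ Ico t₀ T) (hab : a ≤ b) :
    (plateauRadius (θ a) (z a)).toReal - ∫ t in a..b, unitOsc (V t) (z t) ≤
      (plateauRadius (θ b) (z b)).toReal := by
  have hsub : Icc a b ⊆ Ico 0 T := Icc_subset (mem_Ico_of_le ht₀ ha) (mem_Ico_of_le ht₀ hb)
  have hG : ContinuousOn (fun t => unitOsc (V t) (z t)) (Icc a b) :=
    h.continuousOn_unitOsc.mono hsub
  have hG0 : ∀ t ∈ Icc a b, 0 ≤ unitOsc (V t) (z t) := fun t ht =>
    unitOsc_nonneg (h.continuous_velocity t (hsub ht)) _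
  have hint : ∀ t ∈ Icc a b, ∀ u ∈ Icc a b,
      IntervalIntegrable (fun t => unitOsc (V t) (z t)) volume t u := fun t ht u hu =>
    (hG.mono (uIcc_subset_Icc ht hu)).intervalIntegrable
  have haI : a ∈ Icc a b := left_mem_Icc.2 hab
  have hbI : b ∈ Icc a b := right_mem_Icc.2 hab
  by_contra! hlt
  obtain ⟨c, hc1, hc2⟩ := exists_between hlt
  have hϱb := h.radius_pos ht₀ hR hb
  set I := ∫ t in a..b, unitOsc (V t) (z t) with hI
  have hI0 : 0 ≤ I := intervalIntegral.integral_nonneg hab hG0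
  -- The barrier starts at `c + I < R(a)` and ends at `c > R(b)`, which contradicts persistence of
  -- the plateau.
  have hρ : ∀ t ∈ Icc a b, c ≤ c + I - ∫ τ in a..t, unitOsc (V τ) (z τ) ∧
      c + I - ∫ τ in a..t, unitOsc (V τ) (z τ) ≤ c + I := fun t ht => by
    have h1 := intervalIntegral.integral_add_adjacent_intervals (hint a haI t ht) (hint t ht b hbI)
    have h2 : 0 ≤ ∫ τ in t..b, unitOsc (V τ) (z τ) :=
      intervalIntegral.integral_nonneg ht.2 fun τ hτ => hG0 τ ⟨ht.1.trans hτ.1, hτ.2⟩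
    have h3 : 0 ≤ ∫ τ in a..t, unitOsc (V τ) (z τ) :=
      intervalIntegral.integral_nonneg ht.1 fun τ hτ => hG0 τ ⟨hτ.1, hτ.2.trans ht.2⟩
    constructor <;> linarith
  have hc0 : 0 < c := hϱb.trans hc1
  have hϱa := radius_lt_one hR ha
  have key := h.ofReal_le_plateauRadius_of_barrier hab hsub
    (ρ := fun t => c + I - ∫ τ in a..t, unitOsc (V τ) (z τ))
    (ρ' := fun t => -unitOsc (V t) (z t)) (fun t ht => hc0.trans_le (hρ t ht).1)
    (fun t ht => (hasDerivWithinAt_integral_Icc hG ht).const_sub _) (fun t ht x hx => ?_) ?_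
  · rw [ofReal_le_plateauRadius_iff hR hb] at key
    simp only [← hI] at key
    linarith
  · have h1 := (abs_le.1 (abs_real_inner_le_norm (x - z t) (V t x - V t (z t)))).1
    have h2 : ‖V t x - V t (z t)‖ ≤ unitOsc (V t) (z t) :=
      norm_sub_le_unitOsc (h.continuous_velocity t (hsub ht)) (by linarith [(hρ t ht).2])
    have h3 := mul_le_mul_of_nonneg_left h2 (norm_nonneg (x - z t))
    rw [← hx]
    linarith
  · rw [ofReal_lt_plateauRadius_iff hR ha (by simp; linarith)]
    simp only [intervalIntegral.integral_same]
    linarith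

/-- If the oscillation of the field near the vortex is integrable in time, the plateau can only
collapse when the inward rate has infinite integral, and conversely. -/
theorem tendsto_of_integralEqTop (h : IsRegularlyTransported s T θ z V) (ht₀ : t₀ ∈ Ico 0 T)
    (hR : ∀ t ∈ Ico t₀ T, plateauRadius (θ t) (z t) < 1)
    (hosc : ∫⁻ t in Ioo t₀ T, ENNReal.ofReal (unitOsc (V t) (z t)) < ∞)
    (htop : IntegralEqTop
      (fun t => directionalLogLip (V t) (z t) (plateauRadius (θ t) (z t)).toReal) t₀ T) :
    Tendsto (fun t => plateauRadius (θ t) (z t)) (𝓝[<] T) (𝓝 0) := by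
  set G : ℝ → ℝ := fun t => unitOsc (V t) (z t) with hGdef
  have hGcont : ContinuousOn G (Ico t₀ T) :=
    h.continuousOn_unitOsc.mono fun t ht => mem_Ico_of_le ht₀ ht
  have hG0 : ∀ t ∈ Ico t₀ T, 0 ≤ G t := fun t ht =>
    unitOsc_nonneg (h.continuous_velocity t (mem_Ico_of_le ht₀ ht)) _
  have hint : ∀ t ∈ Ico t₀ T, ∀ u ∈ Ico t₀ T, IntervalIntegrable G volume t u :=
    fun t ht u hu => (hGcont.mono (ordConnected_Ico.uIcc_subset ht hu)).intervalIntegrable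
  have ht₀I : t₀ ∈ Ico t₀ T := left_mem_Ico.2 ht₀.2
  have hbdd : BddAbove ((fun t => ∫ τ in t₀..t, G τ) '' Ico t₀ T) := by
    refine ⟨(∫⁻ t in Ioo t₀ T, ENNReal.ofReal (G t)).toReal, ?_⟩
    rintro _ ⟨t, ht, rfl⟩
    have hsub : Ioc t₀ t ⊆ Ioo t₀ T := fun τ hτ => ⟨hτ.1, hτ.2.trans_lt ht.2⟩
    simp only
    rw [intervalIntegral.integral_of_le ht.1, integral_eq_lintegral_of_nonneg_ae]
    · exact ENNReal.toReal_mono hosc.ne (lintegral_mono_set hsub)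
    · exact (ae_restrict_iff' measurableSet_Ioc).2 (Eventually.of_forall fun τ hτ =>
        hG0 τ (Ioo_subset_Ico_self (hsub hτ)))
    · exact (hGcont.mono (hsub.trans Ioo_subset_Ico_self)).aestronglyMeasurable measurableSet_Ioc
  -- Tails of the convergent integral are small: start where its bounded primitive is within `ε` of
  -- the supremum.
  have hsmall : ∀ ε > 0, ∃ a ∈ Ico t₀ T, ∀ t ∈ Ico a T, (∫ τ in a..t, G τ) < ε := by
    intro ε hε
    obtain ⟨_, ⟨a, ha, rfl⟩, hlt⟩ := exists_lt_of_lt_csSup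
      ((nonempty_Ico.2 ht₀.2).image (fun t => ∫ τ in t₀..t, G τ))
      (sub_lt_self (sSup ((fun t => ∫ τ in t₀..t, G τ) '' Ico t₀ T)) hε)
    refine ⟨a, ha, fun t ht => ?_⟩
    have htI : t ∈ Ico t₀ T := ⟨ha.1.trans ht.1, ht.2⟩
    have h1 := intervalIntegral.integral_add_adjacent_intervals (hint t₀ ht₀I a ha)
      (hint a ha t htI)
    have h2 := le_csSup hbdd (mem_image_of_mem _ htI)
    simp only at hlt h2
    linarith
  have main : ∀ ε > 0, ∃ a ∈ Ico t₀ T, ∀ t ∈ Ico a T,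
      (plateauRadius (θ t) (z t)).toReal < ε := by
    intro ε hε
    obtain ⟨a, ha, hIa⟩ := hsmall (ε / 2) (half_pos hε)
    refine ⟨a, ha, fun t₁ ht₁ => ?_⟩
    -- A single late time with `R ≥ ε` keeps `R ≥ ε/2` afterwards, so `N ≤ (2/ε) G` is integrable up
    -- to `T`.
    by_contra! hge
    have ht₁I : t₁ ∈ Ico t₀ T := ⟨ha.1.trans ht₁.1, ht₁.2⟩
    refine (h.lintegral_rate_lt_top_of_le ht₀ hR (C := 2 / ε) ht₁I (by positivity) hosc
      fun t ht => ?_).ne htop.2.1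
    have htI : t ∈ Ico t₀ T := ⟨ht₁I.1.trans ht.1, ht.2⟩
    have hpos := h.radius_pos ht₀ hR htI
    have hlt1 := radius_lt_one hR htI
    have hlog := Real.log_neg hpos hlt1
    have hlow : ε / 2 ≤ (plateauRadius (θ t) (z t)).toReal := by
      have h1 := h.radius_sub_integral_le ht₀ hR ht₁I htI ht.1
      have h2 := hIa t ⟨ht₁.1.trans ht.1, ht.2⟩
      have h3 := intervalIntegral.integral_add_adjacent_intervals (hint a ha t₁ ht₁I)
        (hint t₁ ht₁I t htI)
      have h4 : 0 ≤ ∫ τ in a..t₁, G τ := intervalIntegral.integral_nonneg ht₁.1 fun τ hτ =>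
        hG0 τ ⟨ha.1.trans hτ.1, hτ.2.trans_lt ht₁.2⟩
      simp only [hGdef] at h2 h3 h4
      linarith
    set r := (plateauRadius (θ t) (z t)).toReal
    refine directionalLogLip_le hpos fun x hx => ?_
    rw [div_le_iff₀ (mul_pos (sq_pos_of_pos hpos) (by linarith))]
    have h1 := (abs_le.1 (abs_real_inner_le_norm (x - z t) (V t x - V t (z t)))).1
    have h2 : ‖V t x - V t (z t)‖ ≤ G t :=
      norm_sub_le_unitOsc (h.continuous_velocity t (mem_Ico_of_le ht₀ htI)) (by linarith)
    have h3 := mul_le_mul_of_nonneg_left h2 hpos.le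
    rw [hx] at h1
    have hGt := hG0 t htI
    have h4 : 1 ≤ 2 / ε * r := by
      rw [div_mul_eq_mul_div, le_div_iff₀ hε]; linarith
    have h5 : r * G t ≤ r * G t * (2 / ε * r) := le_mul_of_one_le_right (by positivity) h4
    have h6 : r * G t * (2 / ε * r) ≤ r * G t * (2 / ε * r) * (1 - Real.log r) :=
      le_mul_of_one_le_right (by positivity) (by linarith)
    calc -(inner ℝ (x - z t) (V t x - V t (z t))) ≤ r * G t := by linarith
      _ ≤ r * G t * (2 / ε * r) * (1 - Real.log r) := h5.trans h6
      _ = _ := by ring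
  rw [ENNReal.tendsto_nhds_zero]
  intro ε hε
  rcases eq_or_ne ε ∞ with rfl | hεtop
  · simp
  obtain ⟨a, ha, hlt⟩ := main ε.toReal (ENNReal.toReal_pos hε.ne' hεtop)
  filter_upwards [Ioo_mem_nhdsLT ha.2] with t ht
  have htI : t ∈ Ico t₀ T := ⟨ha.1.trans ht.1.le, ht.2⟩
  exact (ENNReal.toReal_le_toReal ((hR t htI).trans ENNReal.one_lt_top).ne hεtop).1
    (hlt t (Ioo_subset_Ico_self ht)).le

end IsRegularlyTransported

/-! ### Weighted integrability of the Fourier transform -/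

/-- The weight `|2πξ|^α (1 + |2πξ|²)^(-k/2)`. -/
def freqWeight (k : ℕ) (α : ℝ) (ξ : Plane) : ℝ :=
  (2 * Real.pi * ‖ξ‖) ^ α * (1 + (2 * Real.pi * ‖ξ‖) ^ 2) ^ (-((k : ℝ) / 2))

theorem measurable_freqWeight (k : ℕ) (α : ℝ) : Measurable (freqWeight k α) := by
  unfold freqWeight
  fun_prop

/-- In polar coordinates the squared weight behaves like `r^(2α+1)` at the origin, integrable as `α
> -1`, and like `r^(2α-2k+1)` at infinity, integrable as `α < 3 ≤ k - 1`. -/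
theorem memLp_freqWeight {k : ℕ} (hk : 4 ≤ k) {α : ℝ} (hα : -1 < α) (hα3 : α < 3) :
    MemLp (freqWeight k α) 2 volume := by
  have hpi := Real.pi_pos
  rw [memLp_two_iff_integrable_sq (measurable_freqWeight k α).aestronglyMeasurable]
  have hk' : (4 : ℝ) ≤ k := by exact_mod_cast hk
  set F : ℝ → ℝ := fun r =>
    ((2 * Real.pi * r) ^ α * (1 + (2 * Real.pi * r) ^ 2) ^ (-((k : ℝ) / 2))) ^ 2 with hF
  have hFm : Measurable F := by fun_prop
  change Integrable (fun ξ : Plane => F ‖ξ‖) volume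
  rw [integrable_fun_norm_addHaar (volume : Measure Plane) (f := F)]
  simp only [finrank_euclideanSpace, Fintype.card_fin, Nat.add_one_sub_one, pow_one, smul_eq_mul]
  rw [← Ioc_union_Ioi_eq_Ioi zero_le_one]
  refine IntegrableOn.union ?_ ?_
  · have h1 : IntegrableOn (fun r : ℝ => (2 * Real.pi) ^ (2 * α) * r ^ (2 * α + 1)) (Ioc 0 1) := by
      refine Integrable.const_mul ?_ _
      rw [← IntegrableOn, ← intervalIntegrable_iff_integrableOn_Ioc_of_le zero_le_one]
      exact intervalIntegral.intervalIntegrable_rpow' (by linarith)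
    refine h1.mono' (by fun_prop) ((ae_restrict_iff' measurableSet_Ioc).2
      (Eventually.of_forall fun r hr => ?_))
    have hr0 : 0 < r := hr.1
    rw [Real.norm_of_nonneg (by positivity)]
    have hle : (1 + (2 * Real.pi * r) ^ 2) ^ (-((k : ℝ) / 2)) ≤ 1 :=
      Real.rpow_le_one_of_one_le_of_nonpos (by nlinarith [sq_nonneg (2 * Real.pi * r)])
        (by linarith)
    have hnn : 0 ≤ (1 + (2 * Real.pi * r) ^ 2) ^ (-((k : ℝ) / 2)) := by positivity
    calc r * F r ≤ r * ((2 * Real.pi * r) ^ α * 1) ^ 2 := by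
          simp only [hF]; gcongr
      _ = (2 * Real.pi) ^ (2 * α) * r ^ (2 * α + 1) := by
          rw [mul_one, ← Real.rpow_natCast, ← Real.rpow_mul (by positivity),
            Real.mul_rpow (by positivity) hr0.le, Real.rpow_add hr0, Real.rpow_one]
          push_cast
          rw [mul_comm α 2]
          ring
  · have h1 : IntegrableOn (fun r : ℝ => (2 * Real.pi) ^ (2 * α - 2 * k) *
        r ^ (2 * α - 2 * k + 1)) (Ioi 1) :=
      Integrable.const_mul (integrableOn_Ioi_rpow_of_lt (by linarith) zero_lt_one) _
    refine h1.mono' (by fun_prop) ((ae_restrict_iff' measurableSet_Ioi).2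
      (Eventually.of_forall fun r hr => ?_))
    have hr0 : 0 < r := zero_lt_one.trans hr
    rw [Real.norm_of_nonneg (by positivity)]
    have hb : 0 < 2 * Real.pi * r := by positivity
    have hle : (1 + (2 * Real.pi * r) ^ 2) ^ (-((k : ℝ) / 2)) ≤ (2 * Real.pi * r) ^ (-(k : ℝ)) := by
      calc (1 + (2 * Real.pi * r) ^ 2) ^ (-((k : ℝ) / 2))
          ≤ ((2 * Real.pi * r) ^ 2) ^ (-((k : ℝ) / 2)) :=
            Real.rpow_le_rpow_of_nonpos (by positivity) (by linarith) (by linarith)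
        _ = (2 * Real.pi * r) ^ (-(k : ℝ)) := by
            rw [← Real.rpow_natCast, ← Real.rpow_mul hb.le]
            congr 1; push_cast; ring
    calc r * F r ≤ r * ((2 * Real.pi * r) ^ α * (2 * Real.pi * r) ^ (-(k : ℝ))) ^ 2 := by
          simp only [hF]; gcongr
      _ = (2 * Real.pi) ^ (2 * α - 2 * k) * r ^ (2 * α - 2 * k + 1) := by
          rw [← Real.rpow_add hb, ← Real.rpow_natCast, ← Real.rpow_mul hb.le,
            Real.mul_rpow (by positivity) hr0.le, Real.rpow_add hr0, Real.rpow_one]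
          push_cast
          rw [show (α + -(k : ℝ)) * 2 = 2 * α - 2 * k by ring]
          ring

theorem aestronglyMeasurable_fourierL2 (f : Plane → ℝ) :
    AEStronglyMeasurable (fourierL2 f) volume := by
  unfold fourierL2
  split_ifs
  · exact Lp.aestronglyMeasurable _
  · exact aestronglyMeasurable_const

/-- Cauchy–Schwarz after inserting the Sobolev weight and its inverse. The exponents `1 - 2s` and `2
- 2s` then give boundedness and the Lipschitz property of the velocity. -/
theorem eLpNorm_rpow_smul_fourierL2_le (k : ℕ) (α : ℝ) (f : Plane → ℝ) :
    eLpNorm (fun ξ => (2 * Real.pi * ‖ξ‖) ^ α • fourierL2 f ξ) 1 volume ≤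
      eLpNorm (freqWeight k α) 2 volume * sobolevNorm k f := by
  have h1 : (fun ξ => (2 * Real.pi * ‖ξ‖) ^ α • fourierL2 f ξ) = (freqWeight k α) •
      (fun ξ => (((1 + (2 * Real.pi * ‖ξ‖) ^ 2) ^ ((k : ℝ) / 2) : ℝ) : ℂ) * fourierL2 f ξ) := by
    ext ξ
    have hpos : (0 : ℝ) < 1 + (2 * Real.pi * ‖ξ‖) ^ 2 := by positivity
    simp only [Pi.smul_apply', freqWeight]
    rw [← Complex.real_smul, smul_smul, mul_assoc ((_ : ℝ) ^ α), ← Real.rpow_add hpos]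
    simp
  rw [h1]
  refine eLpNorm_smul_le_mul_eLpNorm ?_ (measurable_freqWeight k α).aestronglyMeasurable
  refine AEStronglyMeasurable.mul ?_ (aestronglyMeasurable_fourierL2 f)
  exact (Complex.measurable_ofReal.comp (by fun_prop)).aestronglyMeasurable

/-- The constant `‖|2πξ|^α (1 + |2πξ|²)^(-k/2)‖_{L²}`. -/
def freqConst (k : ℕ) (α : ℝ) : ℝ := (eLpNorm (freqWeight k α) 2 volume).toReal

theorem freqConst_nonneg (k : ℕ) (α : ℝ) : 0 ≤ freqConst k α := ENNReal.toReal_nonneg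

theorem integrable_rpow_smul_fourierL2 {k : ℕ} (hk : 4 ≤ k) {α : ℝ} (hα : -1 < α) (hα3 : α < 3)
    {f : Plane → ℝ} (hf : sobolevNorm k f < ∞) :
    Integrable (fun ξ => (2 * Real.pi * ‖ξ‖) ^ α • fourierL2 f ξ) volume := by
  rw [← memLp_one_iff_integrable]
  have hm : Measurable fun ξ : Plane => (2 * Real.pi * ‖ξ‖) ^ α := by fun_prop
  exact ⟨hm.aestronglyMeasurable.smul (aestronglyMeasurable_fourierL2 f),
    (eLpNorm_rpow_smul_fourierL2_le k α f).trans_lt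
      (ENNReal.mul_lt_top (memLp_freqWeight hk hα hα3).2 hf)⟩

theorem integral_rpow_mul_norm_fourierL2_le {k : ℕ} (hk : 4 ≤ k) {α : ℝ} (hα : -1 < α)
    (hα3 : α < 3) {f : Plane → ℝ} (hf : sobolevNorm k f < ∞) :
    ∫ ξ, (2 * Real.pi * ‖ξ‖) ^ α * ‖fourierL2 f ξ‖ ≤ freqConst k α * (sobolevNorm k f).toReal := by
  have hint := integrable_rpow_smul_fourierL2 hk hα hα3 hf
  have h1 : ∫ ξ, (2 * Real.pi * ‖ξ‖) ^ α * ‖fourierL2 f ξ‖ =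
      (eLpNorm (fun ξ => (2 * Real.pi * ‖ξ‖) ^ α • fourierL2 f ξ) 1 volume).toReal := by
    rw [eLpNorm_one_eq_lintegral_enorm, ← integral_norm_eq_lintegral_enorm hint.1]
    refine integral_congr_ae (Eventually.of_forall fun ξ => ?_)
    simp only [norm_smul]
    rw [Real.norm_of_nonneg (by positivity)]
  rw [h1, freqConst, ← ENNReal.toReal_mul]
  exact ENNReal.toReal_mono (ENNReal.mul_lt_top (memLp_freqWeight hk hα hα3).2 hf).ne
    (eLpNorm_rpow_smul_fourierL2_le k α f)

/-! ### Inverse Fourier transforms of integrable functions -/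

theorem norm_fourierInv_le (h : Plane → ℂ) (x : Plane) : ‖𝓕⁻ h x‖ ≤ ∫ ξ, ‖h ξ‖ := by
  rw [Real.fourierInv_eq']
  refine (norm_integral_le_integral_norm _).trans (le_of_eq ?_)
  refine integral_congr_ae (Eventually.of_forall fun ξ => ?_)
  simp only [norm_smul, Complex.norm_exp_ofReal_mul_I, one_mul]

theorem integrable_exp_smul {h : Plane → ℂ} (hh : Integrable h volume) (x : Plane) :
    Integrable (fun ξ : Plane => Complex.exp ((2 * Real.pi * inner ℝ ξ x : ℝ) * Complex.I) • h ξ)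
      volume := by
  have hc : Continuous fun ξ : Plane =>
      Complex.exp ((2 * Real.pi * inner ℝ ξ x : ℝ) * Complex.I) := by fun_prop
  refine hh.mono (hc.aestronglyMeasurable.smul hh.1)
    (Eventually.of_forall fun ξ => ?_)
  rw [norm_smul, Complex.norm_exp_ofReal_mul_I, one_mul]

theorem norm_exp_sub_exp_le (a b : ℝ) :
    ‖Complex.exp (a * Complex.I) - Complex.exp (b * Complex.I)‖ ≤ |a - b| := by
  have h1 : Complex.exp (a * Complex.I) - Complex.exp (b * Complex.I) =
      Complex.exp (b * Complex.I) * (Complex.exp (Complex.I * ((a - b : ℝ) : ℂ)) - 1) := by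
    rw [mul_sub, ← Complex.exp_add, mul_one]
    congr 2
    push_cast; ring
  rw [h1, norm_mul, Complex.norm_exp_ofReal_mul_I, one_mul]
  exact Real.norm_exp_I_mul_ofReal_sub_one_le

theorem norm_fourierInv_sub_le {h : Plane → ℂ} (hh : Integrable h volume)
    (hh1 : Integrable (fun ξ => (2 * Real.pi * ‖ξ‖) * ‖h ξ‖) volume) (x y : Plane) :
    ‖𝓕⁻ h x - 𝓕⁻ h y‖ ≤ (∫ ξ, (2 * Real.pi * ‖ξ‖) * ‖h ξ‖) * ‖x - y‖ := by
  rw [Real.fourierInv_eq', Real.fourierInv_eq', ← integral_sub (integrable_exp_smul hh x)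
    (integrable_exp_smul hh y), ← integral_mul_const]
  refine norm_integral_le_of_norm_le (hh1.mul_const _) (Eventually.of_forall fun ξ => ?_)
  rw [← sub_smul, norm_smul]
  have h1 := norm_exp_sub_exp_le (2 * Real.pi * inner ℝ ξ x) (2 * Real.pi * inner ℝ ξ y)
  have h2 : |2 * Real.pi * inner ℝ ξ x - 2 * Real.pi * inner ℝ ξ y| ≤
      2 * Real.pi * ‖ξ‖ * ‖x - y‖ := by
    rw [← mul_sub, ← inner_sub_right, abs_mul, abs_of_pos Real.two_pi_pos,
      mul_assoc (2 * Real.pi)]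
    exact mul_le_mul_of_nonneg_left (abs_real_inner_le_norm ξ (x - y)) Real.two_pi_pos.le
  calc _ ≤ (2 * Real.pi * ‖ξ‖ * ‖x - y‖) * ‖h ξ‖ :=
        mul_le_mul_of_nonneg_right (h1.trans h2) (norm_nonneg _)
    _ = _ := by ring

theorem norm_le_abs_add_abs (x : Plane) : ‖x‖ ≤ |x 0| + |x 1| := by
  rw [EuclideanSpace.norm_eq, Fin.sum_univ_two, Real.norm_eq_abs, Real.norm_eq_abs]
  exact Real.sqrt_le_iff.2 ⟨by positivity, by nlinarith [abs_nonneg (x 0), abs_nonneg (x 1)]⟩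

/-! ### The velocity field of a function in `H^k` -/

/-- The Fourier transform of the `i`-th component of the velocity. -/
def velocityHat (s : ℝ) (f : Plane → ℝ) (i : Fin 2) (ξ : Plane) : ℂ :=
  -(2 * Real.pi * Complex.I) * ((perp ξ i : ℝ) : ℂ)
    * (((2 * Real.pi * ‖ξ‖) ^ (-(2 * s)) : ℝ) : ℂ) * fourierL2 f ξ

theorem velocity_apply (s : ℝ) (f : Plane → ℝ) (x : Plane) (i : Fin 2) :
    velocity s f x i = (𝓕⁻ (velocityHat s f i) x).re := rfl

theorem abs_perp_apply_le (ξ : Plane) (i : Fin 2) : |perp ξ i| ≤ ‖ξ‖ := by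
  rw [← norm_perp]
  exact PiLp.norm_apply_le (perp ξ) i

theorem norm_velocityHat_le (s : ℝ) (f : Plane → ℝ) (i : Fin 2) (ξ : Plane) :
    ‖velocityHat s f i ξ‖ ≤ (2 * Real.pi * ‖ξ‖) ^ (1 - 2 * s) * ‖fourierL2 f ξ‖ := by
  have hpi := Real.pi_pos
  rcases eq_or_ne ξ 0 with rfl | hξ
  · have : perp (0 : Plane) i = 0 := by simpa using abs_perp_apply_le 0 i
    simp only [velocityHat, this]
    simp
    positivity
  · have hpos : 0 < 2 * Real.pi * ‖ξ‖ := by positivity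
    have h1 : ‖velocityHat s f i ξ‖ = 2 * Real.pi * |perp ξ i| * (2 * Real.pi * ‖ξ‖) ^ (-(2 * s)) *
        ‖fourierL2 f ξ‖ := by
      simp only [velocityHat, norm_mul, norm_neg, Complex.norm_real, Complex.norm_I, mul_one,
        Complex.norm_ofNat, Real.norm_eq_abs]
      rw [abs_of_pos hpi, abs_of_nonneg (Real.rpow_nonneg hpos.le _)]
    rw [h1, sub_eq_add_neg, Real.rpow_add hpos, Real.rpow_one]
    gcongr
    exact abs_perp_apply_le ξ i

theorem aestronglyMeasurable_velocityHat (s : ℝ) (f : Plane → ℝ) (i : Fin 2) :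
    AEStronglyMeasurable (velocityHat s f i) volume := by
  have h1 : Measurable fun ξ : Plane => -(2 * Real.pi * Complex.I) * ((perp ξ i : ℝ) : ℂ)
      * (((2 * Real.pi * ‖ξ‖) ^ (-(2 * s)) : ℝ) : ℂ) := by
    have : Measurable fun ξ : Plane => perp ξ i :=
      ((EuclideanSpace.proj i).continuous.comp continuous_perp).measurable
    fun_prop
  exact h1.aestronglyMeasurable.mul (aestronglyMeasurable_fourierL2 f)

section

variable {s : ℝ} {k : ℕ} {f : Plane → ℝ}

theorem integrable_velocityHat (hs₀ : 0 < s) (hs₁ : s < 1) (hk : 4 ≤ k)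
    (hf : sobolevNorm k f < ∞) (i : Fin 2) : Integrable (velocityHat s f i) volume := by
  refine (integrable_rpow_smul_fourierL2 hk (α := 1 - 2 * s) (by linarith) (by linarith)
    hf).mono (aestronglyMeasurable_velocityHat s f i) (Eventually.of_forall fun ξ => ?_)
  rw [norm_smul, Real.norm_of_nonneg (by positivity)]
  exact norm_velocityHat_le s f i ξ

theorem norm_mul_norm_velocityHat_le (hs₁ : s < 1) (i : Fin 2) (ξ : Plane) :
    (2 * Real.pi * ‖ξ‖) * ‖velocityHat s f i ξ‖ ≤
      (2 * Real.pi * ‖ξ‖) ^ (2 - 2 * s) * ‖fourierL2 f ξ‖ := by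
  have h0 : 0 ≤ 2 * Real.pi * ‖ξ‖ := by positivity
  refine (mul_le_mul_of_nonneg_left (norm_velocityHat_le s f i ξ) h0).trans (le_of_eq ?_)
  rw [← mul_assoc, show 2 - 2 * s = 1 + (1 - 2 * s) by ring,
    Real.rpow_add' h0 (by linarith), Real.rpow_one]

theorem integrable_norm_mul_velocityHat (hs₀ : 0 < s) (hs₁ : s < 1) (hk : 4 ≤ k)
    (hf : sobolevNorm k f < ∞) (i : Fin 2) :
    Integrable (fun ξ => (2 * Real.pi * ‖ξ‖) * ‖velocityHat s f i ξ‖) volume := by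
  refine (integrable_rpow_smul_fourierL2 hk (α := 2 - 2 * s) (by linarith) (by linarith)
    hf).mono ?_ (Eventually.of_forall fun ξ => ?_)
  · exact ((by fun_prop : Measurable fun ξ : Plane => 2 * Real.pi * ‖ξ‖).aestronglyMeasurable).mul
      (aestronglyMeasurable_velocityHat s f i).norm
  · rw [norm_smul, Real.norm_of_nonneg (by positivity), Real.norm_of_nonneg (by positivity)]
    exact norm_mul_norm_velocityHat_le hs₁ i ξ

theorem integral_norm_velocityHat_le (hs₀ : 0 < s) (hs₁ : s < 1) (hk : 4 ≤ k)
    (hf : sobolevNorm k f < ∞) (i : Fin 2) :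
    ∫ ξ, ‖velocityHat s f i ξ‖ ≤ freqConst k (1 - 2 * s) * (sobolevNorm k f).toReal := by
  refine le_trans (integral_mono (integrable_velocityHat hs₀ hs₁ hk hf i).norm ?_
    (norm_velocityHat_le s f i))
    (integral_rpow_mul_norm_fourierL2_le hk (by linarith) (by linarith) hf)
  refine (integrable_rpow_smul_fourierL2 hk (α := 1 - 2 * s) (by linarith) (by linarith)
    hf).norm.congr (Eventually.of_forall fun ξ => ?_)
  simp only [norm_smul]
  rw [Real.norm_of_nonneg (by positivity)]

theorem integral_norm_mul_velocityHat_le (hs₀ : 0 < s) (hs₁ : s < 1) (hk : 4 ≤ k)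
    (hf : sobolevNorm k f < ∞) (i : Fin 2) :
    ∫ ξ, (2 * Real.pi * ‖ξ‖) * ‖velocityHat s f i ξ‖ ≤
      freqConst k (2 - 2 * s) * (sobolevNorm k f).toReal := by
  refine le_trans (integral_mono (integrable_norm_mul_velocityHat hs₀ hs₁ hk hf i) ?_
    (norm_mul_norm_velocityHat_le hs₁ i))
    (integral_rpow_mul_norm_fourierL2_le hk (by linarith) (by linarith) hf)
  refine (integrable_rpow_smul_fourierL2 hk (α := 2 - 2 * s) (by linarith) (by linarith)
    hf).norm.congr (Eventually.of_forall fun ξ => ?_)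
  simp only [norm_smul]
  rw [Real.norm_of_nonneg (by positivity)]

theorem norm_velocity_le (hs₀ : 0 < s) (hs₁ : s < 1) (hk : 4 ≤ k)
    (hf : sobolevNorm k f < ∞) (x : Plane) :
    ‖velocity s f x‖ ≤ 2 * freqConst k (1 - 2 * s) * (sobolevNorm k f).toReal := by
  have h1 : ∀ i, |velocity s f x i| ≤ freqConst k (1 - 2 * s) * (sobolevNorm k f).toReal :=
    fun i => by
      rw [velocity_apply]
      exact (Complex.abs_re_le_norm _).trans ((norm_fourierInv_le _ _).trans
        (integral_norm_velocityHat_le hs₀ hs₁ hk hf i))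
  linarith [norm_le_abs_add_abs (velocity s f x), h1 0, h1 1]

theorem norm_velocity_sub_le (hs₀ : 0 < s) (hs₁ : s < 1) (hk : 4 ≤ k)
    (hf : sobolevNorm k f < ∞) (x y : Plane) :
    ‖velocity s f x - velocity s f y‖ ≤
      2 * freqConst k (2 - 2 * s) * (sobolevNorm k f).toReal * ‖x - y‖ := by
  have h1 : ∀ i, |(velocity s f x - velocity s f y) i| ≤
      freqConst k (2 - 2 * s) * (sobolevNorm k f).toReal * ‖x - y‖ := fun i => by
    rw [PiLp.sub_apply, velocity_apply, velocity_apply, ← Complex.sub_re]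
    refine (Complex.abs_re_le_norm _).trans ((norm_fourierInv_sub_le
      (integrable_velocityHat hs₀ hs₁ hk hf i)
      (integrable_norm_mul_velocityHat hs₀ hs₁ hk hf i) x y).trans ?_)
    exact mul_le_mul_of_nonneg_right (integral_norm_mul_velocityHat_le hs₀ hs₁ hk hf i)
      (norm_nonneg _)
  linarith [norm_le_abs_add_abs (velocity s f x - velocity s f y), h1 0, h1 1]

theorem lipschitzWith_velocity (hs₀ : 0 < s) (hs₁ : s < 1) (hk : 4 ≤ k) {C : ℝ≥0}
    (hf : sobolevNorm k f ≤ C) :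
    LipschitzWith (Real.toNNReal (2 * freqConst k (2 - 2 * s) * C)) (velocity s f) := by
  have h0 := freqConst_nonneg k (2 - 2 * s)
  refine LipschitzWith.of_dist_le_mul fun x y => ?_
  rw [dist_eq_norm, dist_eq_norm, Real.coe_toNNReal _ (by positivity)]
  refine (norm_velocity_sub_le hs₀ hs₁ hk (hf.trans_lt ENNReal.coe_lt_top) x y).trans ?_
  have h1 : (sobolevNorm k f).toReal ≤ C := ENNReal.toReal_le_coe_of_le_coe hf
  gcongr

end

/-! ### The velocity has no flux through circles -/

theorem continuous_velocity_of_sobolevNorm_lt_top {s : ℝ} {k : ℕ} {f : Plane → ℝ} (hs₀ : 0 < s)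
    (hs₁ : s < 1) (hk : 4 ≤ k) (hf : sobolevNorm k f < ∞) : Continuous (velocity s f) :=
  (lipschitzWith_velocity hs₀ hs₁ hk (C := (sobolevNorm k f).toNNReal)
    (ENNReal.coe_toNNReal hf.ne).ge).continuous

theorem inner_perp_right (x y : Plane) : inner ℝ x (perp y) = -inner ℝ (perp x) y := by
  simp [perp, PiLp.inner_apply, Fin.sum_univ_two]

/-- Up to a nonzero constant the integrand is the angular derivative of the plane wave, a periodic
function. -/
theorem integral_circle_eq_zero (ξ p : Plane) {r : ℝ} (hr : r ≠ 0) :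
    ∫ φ in (0)..(2 * Real.pi), ((inner ℝ (unitVec φ) (perp ξ) : ℝ) : ℂ) *
      Complex.exp ((2 * Real.pi * inner ℝ ξ (p + r • unitVec φ) : ℝ) * Complex.I) = 0 := by
  have hd : ∀ φ : ℝ, HasDerivAt (fun φ : ℝ =>
      Complex.exp ((2 * Real.pi * inner ℝ ξ (p + r • unitVec φ) : ℝ) * Complex.I))
      ((-(2 * Real.pi * r * Complex.I)) * (((inner ℝ (unitVec φ) (perp ξ) : ℝ) : ℂ) *
        Complex.exp ((2 * Real.pi * inner ℝ ξ (p + r • unitVec φ) : ℝ) * Complex.I))) φ := by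
    intro φ
    have h1 : HasDerivAt (fun φ : ℝ => 2 * Real.pi * inner ℝ ξ (p + r • unitVec φ))
        (2 * Real.pi * inner ℝ ξ (r • perp (unitVec φ))) φ := by
      have h3 := ((innerSL ℝ ξ).hasFDerivAt.comp_hasDerivAt φ
        (((hasDerivAt_unitVec φ).const_smul r).const_add p)).const_mul (2 * Real.pi)
      exact h3
    have h2 := (h1.ofReal_comp.mul_const Complex.I).cexp
    convert! h2 using 1
    rw [real_inner_smul_right, inner_perp_right ξ, real_inner_comm (perp ξ)]
    push_cast
    ring
  have hint := intervalIntegral.integral_eq_sub_of_hasDerivAt (a := 0) (b := 2 * Real.pi)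
    (fun φ _ => hd φ) (Continuous.intervalIntegrable (by
      have := continuous_unitVec
      fun_prop) _ _)
  rw [unitVec_two_pi, sub_self, intervalIntegral.integral_const_mul] at hint
  refine (mul_eq_zero.1 hint).resolve_left ?_
  have := Real.pi_ne_zero
  simp [hr, this]

theorem integrable_circle_prod {h : Plane → ℂ} (hh : Integrable h volume) (i : Fin 2) (p : Plane)
    (r : ℝ) : Integrable (Function.uncurry fun φ ξ => ((unitVec φ i : ℝ) : ℂ) *
      (Complex.exp ((2 * Real.pi * inner ℝ ξ (p + r • unitVec φ) : ℝ) * Complex.I) • h ξ))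
      ((volume.restrict (Ioc 0 (2 * Real.pi))).prod (volume : Measure Plane)) := by
  have hcu := continuous_unitVec
  have hc : Continuous fun q : ℝ × Plane => ((unitVec q.1 i : ℝ) : ℂ) *
      Complex.exp ((2 * Real.pi * inner ℝ q.2 (p + r • unitVec q.1) : ℝ) * Complex.I) := by
    fun_prop
  have h1 : Integrable (fun q : ℝ × Plane => h q.2)
      ((volume.restrict (Ioc 0 (2 * Real.pi))).prod (volume : Measure Plane)) :=
    hh.comp_snd (volume.restrict (Ioc 0 (2 * Real.pi)))
  have h2 : Integrable (fun q : ℝ × Plane => (((unitVec q.1 i : ℝ) : ℂ) *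
      Complex.exp ((2 * Real.pi * inner ℝ q.2 (p + r • unitVec q.1) : ℝ) * Complex.I)) * h q.2)
      ((volume.restrict (Ioc 0 (2 * Real.pi))).prod (volume : Measure Plane)) := by
    refine h1.mono (hc.aestronglyMeasurable.mul h1.1) (Eventually.of_forall fun q => ?_)
    rw [norm_mul, norm_mul, Complex.norm_exp_ofReal_mul_I, mul_one, Complex.norm_real]
    refine mul_le_of_le_one_left (norm_nonneg _) ?_
    rw [← norm_unitVec q.1]
    exact PiLp.norm_apply_le _ i
  refine h2.congr (Eventually.of_forall fun q => ?_)
  simp only [Function.uncurry, smul_eq_mul, mul_assoc]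

/-- Each Fourier mode of the velocity is divergence free and has no flux through the circle; Fubini
transfers this to the whole field. -/
theorem integral_inner_velocity_circle {s : ℝ} {k : ℕ} {f : Plane → ℝ} (hs₀ : 0 < s)
    (hs₁ : s < 1) (hk : 4 ≤ k) (hf : sobolevNorm k f < ∞) (p : Plane) {r : ℝ} (hr : r ≠ 0) :
    ∫ φ in (0)..(2 * Real.pi), inner ℝ (unitVec φ) (velocity s f (p + r • unitVec φ)) = 0 := by
  have hcu := continuous_unitVec
  set Q : Fin 2 → ℝ → Plane → ℂ := fun i φ ξ => ((unitVec φ i : ℝ) : ℂ) *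
    (Complex.exp ((2 * Real.pi * inner ℝ ξ (p + r • unitVec φ) : ℝ) * Complex.I) •
      velocityHat s f i ξ) with hQ
  have hQint : ∀ i, Integrable (Function.uncurry (Q i))
      ((volume.restrict (Ioc 0 (2 * Real.pi))).prod (volume : Measure Plane)) := fun i =>
    integrable_circle_prod (integrable_velocityHat hs₀ hs₁ hk hf i) i p r
  have hsum : ∀ ξ, ∫ φ in Ioc 0 (2 * Real.pi), (Q 0 φ ξ + Q 1 φ ξ) = 0 := by
    intro ξ
    have h1 := integral_circle_eq_zero ξ p hr
    rw [intervalIntegral.integral_of_le Real.two_pi_pos.le] at h1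
    have h2 : ∀ φ, Q 0 φ ξ + Q 1 φ ξ = (-(2 * Real.pi * Complex.I) *
        (((2 * Real.pi * ‖ξ‖) ^ (-(2 * s)) : ℝ) : ℂ) * fourierL2 f ξ) *
        (((inner ℝ (unitVec φ) (perp ξ) : ℝ) : ℂ) *
      Complex.exp ((2 * Real.pi * inner ℝ ξ (p + r • unitVec φ) : ℝ) * Complex.I)) := by
      intro φ
      have h3 : (inner ℝ (unitVec φ) (perp ξ) : ℝ) =
          unitVec φ 0 * perp ξ 0 + unitVec φ 1 * perp ξ 1 := by
        simp [PiLp.inner_apply, Fin.sum_univ_two, mul_comm]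
      rw [h3]
      simp only [hQ, velocityHat, smul_eq_mul]
      push_cast
      ring
    simp_rw [h2]
    rw [integral_const_mul, h1, mul_zero]
  have hre : ∀ φ, inner ℝ (unitVec φ) (velocity s f (p + r • unitVec φ)) =
      (∫ ξ, (Q 0 φ ξ + Q 1 φ ξ)).re := by
    intro φ
    have h4 : ∀ i, Integrable (Q i φ) volume := fun i =>
      (integrable_exp_smul (integrable_velocityHat hs₀ hs₁ hk hf i) (p + r • unitVec φ)).const_mul _
    have h5 : ∀ i, (∫ ξ, Q i φ ξ).re = unitVec φ i * velocity s f (p + r • unitVec φ) i := by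
      intro i
      rw [velocity_apply, Real.fourierInv_eq', ← Complex.re_ofReal_mul, ← integral_const_mul]
    rw [integral_add (h4 0) (h4 1), Complex.add_re, h5, h5]
    simp [PiLp.inner_apply, Fin.sum_univ_two, mul_comm]
  rw [intervalIntegral.integral_of_le Real.two_pi_pos.le]
  simp_rw [hre]
  have hadd : Integrable (Function.uncurry fun φ ξ => Q 0 φ ξ + Q 1 φ ξ)
      ((volume.restrict (Ioc 0 (2 * Real.pi))).prod (volume : Measure Plane)) :=
    (hQint 0).add (hQint 1)
  have h6 := integral_integral_swap hadd
  simp_rw [hsum, integral_zero] at h6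
  have h7 := integral_re (hadd.integral_prod_left)
  simp only [RCLike.re_eq_complex_re, Function.uncurry] at h7
  rw [h7, h6]
  simp

/-- Otherwise the flux of `v - v(p)` through the circle would be positive, whereas `v` and the
constant `v(p)` both have zero flux. -/
theorem exists_inner_velocity_sub_nonpos {s : ℝ} {k : ℕ} {f : Plane → ℝ} (hs₀ : 0 < s)
    (hs₁ : s < 1) (hk : 4 ≤ k) (hf : sobolevNorm k f < ∞) (p : Plane) {r : ℝ} (hr : 0 < r) :
    ∃ e : Plane, ‖e‖ = 1 ∧ inner ℝ e (velocity s f (p + r • e) - velocity s f p) ≤ 0 := by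
  by_contra! hcon
  have hcu := continuous_unitVec
  have hcv := continuous_velocity_of_sobolevNorm_lt_top hs₀ hs₁ hk hf
  have hpos : 0 < ∫ φ in (0)..(2 * Real.pi),
      inner ℝ (unitVec φ) (velocity s f (p + r • unitVec φ) - velocity s f p) :=
    intervalIntegral.intervalIntegral_pos_of_pos_on
      (Continuous.intervalIntegrable (by fun_prop) _ _)
      (fun φ _ => hcon _ (norm_unitVec φ)) Real.two_pi_pos
  simp_rw [inner_sub_right] at hpos
  rw [intervalIntegral.integral_sub (Continuous.intervalIntegrable (by fun_prop) _ _)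
    (Continuous.intervalIntegrable (by fun_prop) _ _),
    integral_inner_velocity_circle hs₀ hs₁ hk hf p hr.ne'] at hpos
  have h1 : ∀ φ : ℝ, inner ℝ (unitVec φ) (velocity s f p) =
      velocity s f p 0 * Real.cos φ + velocity s f p 1 * Real.sin φ := fun φ => by
    simp [unitVec, PiLp.inner_apply, Fin.sum_univ_two]
  simp_rw [h1] at hpos
  rw [intervalIntegral.integral_add (Continuous.intervalIntegrable (by fun_prop) _ _)
    (Continuous.intervalIntegrable (by fun_prop) _ _)] at hpos
  simp at hpos

/-! ### Duality for the Fourier-Plancherel transform -/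

theorem fourierL2_eq {f : Plane → ℝ} (hf : MemLp (fun x => (f x : ℂ)) 2 volume) :
    fourierL2 f =
      ((𝓕 (hf.toLp (fun x => (f x : ℂ))) : Lp ℂ 2 (volume : Measure Plane)) : Plane → ℂ) :=
  dif_pos hf

theorem memLp_fourierL2 (f : Plane → ℝ) : MemLp (fourierL2 f) 2 volume := by
  unfold fourierL2
  split_ifs
  · exact Lp.memLp _
  · exact MemLp.zero

/-- Plancherel, the Sobolev weight being at least `1`. -/
theorem eLpNorm_le_sobolevNorm {f : Plane → ℝ} (hf : MemLp f 2 volume) (k : ℕ) :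
    eLpNorm (fun x => (f x : ℂ)) 2 volume ≤ sobolevNorm k f := by
  have hfc : MemLp (fun x => (f x : ℂ)) 2 volume := hf.ofReal
  have h1 : eLpNorm (fourierL2 f) 2 volume = eLpNorm (fun x => (f x : ℂ)) 2 volume := by
    rw [fourierL2_eq hfc, ← Lp.enorm_def, ← Lp.enorm_toLp hfc, enorm_eq_iff_norm_eq]
    exact Lp.norm_fourier_eq _
  rw [← h1, sobolevNorm]
  refine eLpNorm_mono fun ξ => ?_
  rw [norm_mul, Complex.norm_real, Real.norm_of_nonneg (by positivity)]
  refine le_mul_of_one_le_left (norm_nonneg _) (Real.one_le_rpow ?_ (by positivity))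
  nlinarith [sq_nonneg (2 * Real.pi * ‖ξ‖)]

/-- Parseval's identity: `φ` is the conjugate of the inverse transform of the conjugate of `ψ`. This
moves continuity in time from physical space to frequency space. -/
theorem integral_mul_fourierL2_eq {ψ : Plane → ℂ} (hψ : MemLp ψ 2 volume) :
    ∃ φ : Plane → ℂ, MemLp φ 2 volume ∧ ∀ f : Plane → ℝ, MemLp f 2 volume →
      ∫ ξ, ψ ξ * fourierL2 f ξ = ∫ x, φ x * (f x : ℂ) := by
  have hψc : MemLp (fun ξ => (starRingEnd ℂ) (ψ ξ)) 2 volume := hψ.star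
  set a : Lp ℂ 2 (volume : Measure Plane) := 𝓕⁻ (hψc.toLp _) with ha
  refine ⟨fun x => (starRingEnd ℂ) (a x), (Lp.memLp a).star, fun f hf => ?_⟩
  have hfc : MemLp (fun x => (f x : ℂ)) 2 volume := hf.ofReal
  have h1 := Lp.inner_fourier_eq a (hfc.toLp _)
  rw [ha, FourierTransform.fourier_fourierInv_eq, ← ha, L2.inner_def, L2.inner_def] at h1
  rw [fourierL2_eq hfc]
  refine Eq.trans ?_ (h1.trans ?_)
  · refine integral_congr_ae ?_
    filter_upwards [hψc.coeFn_toLp] with ξ hξ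
    rw [hξ, RCLike.inner_apply', Complex.conj_conj]
  · refine integral_congr_ae ?_
    filter_upwards [hfc.coeFn_toLp] with x hx
    rw [hx, RCLike.inner_apply']

theorem norm_integral_mul_le {a b : Plane → ℂ} (ha : MemLp a 2 volume) (hb : MemLp b 2 volume) :
    Integrable (fun x => a x * b x) volume ∧
      ‖∫ x, a x * b x‖ ≤ (eLpNorm a 2 volume).toReal * (eLpNorm b 2 volume).toReal := by
  have h1 : eLpNorm (a • b) 1 volume ≤ eLpNorm a 2 volume * eLpNorm b 2 volume :=
    eLpNorm_smul_le_mul_eLpNorm hb.1 ha.1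
  have h2 : (a • b) = fun x => a x * b x := rfl
  rw [h2] at h1
  have hint : Integrable (fun x => a x * b x) volume :=
    memLp_one_iff_integrable.1 ⟨ha.1.mul hb.1, h1.trans_lt (ENNReal.mul_lt_top ha.2 hb.2)⟩
  refine ⟨hint, (norm_integral_le_integral_norm _).trans ?_⟩
  rw [integral_norm_eq_lintegral_enorm hint.1, ← eLpNorm_one_eq_lintegral_enorm,
    ← ENNReal.toReal_mul]
  exact ENNReal.toReal_mono (ENNReal.mul_lt_top ha.2 hb.2).ne h1

/-! ### Continuity of the velocity in time -/

theorem continuousOn_Ico_of_Icc {E : Type*} [TopologicalSpace E] {f : ℝ → E} {a T : ℝ}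
    (h : ∀ b ∈ Ico a T, ContinuousOn f (Icc a b)) : ContinuousOn f (Ico a T) := by
  intro t ht
  obtain ⟨b, hb⟩ := exists_between ht.2
  refine (h b ⟨ht.1.trans hb.1.le, hb.2⟩ t ⟨ht.1, hb.1.le⟩).mono_of_mem_nhdsWithin ?_
  filter_upwards [inter_mem_nhdsWithin (Ico a T) (Iio_mem_nhds hb.1)] with τ hτ
  exact ⟨hτ.1.1, hτ.2.le⟩

theorem continuousOn_of_forall_exists_norm_sub_le {f : ℝ → ℂ} {S : Set ℝ}
    (h : ∀ ε > 0, ∃ F : ℝ → ℂ, ContinuousOn F S ∧ ∀ t ∈ S, ‖f t - F t‖ ≤ ε) :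
    ContinuousOn f S := by
  refine continuousOn_of_uniform_approx_of_continuousOn fun u hu => ?_
  obtain ⟨ε, hε, hεu⟩ := Metric.mem_uniformity_dist.1 hu
  obtain ⟨F, hF, hle⟩ := h (ε / 2) (half_pos hε)
  refine ⟨F, hF, fun t ht => hεu ?_⟩
  rw [dist_eq_norm]
  exact (hle t ht).trans_lt (half_lt_self hε)

section

variable {T : ℝ} {k : ℕ} {θ : ℝ → Plane → ℝ}

/-- Joint continuity handles compactly supported continuous weights; density in `L²` and the local
bound on the norm of `θ(t)` make the approximation uniform in time. -/
theorem continuousOn_integral_mul (hcont : ContinuousOn (Function.uncurry θ) (Ico 0 T ×ˢ univ))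
    (hmem : ∀ t ∈ Ico 0 T, MemHk k (θ t))
    (hbdd : ∀ τ < T, ∃ C : ℝ≥0, ∀ t ∈ Icc 0 τ, sobolevNorm k (θ t) ≤ C)
    {φ : Plane → ℂ} (hφ : MemLp φ 2 volume) :
    ContinuousOn (fun t => ∫ x, φ x * (θ t x : ℂ)) (Ico 0 T) := by
  refine continuousOn_Ico_of_Icc fun b hb => continuousOn_of_forall_exists_norm_sub_le
    fun ε hε => ?_
  obtain ⟨C, hC⟩ := hbdd b hb.2
  have hη : ENNReal.ofReal (ε / (C + 1)) ≠ 0 := by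
    have : 0 < ε / (C + 1) := by positivity
    simpa using this
  obtain ⟨g, hgs, hgle, hgc, hgm⟩ :=
    hφ.exists_hasCompactSupport_eLpNorm_sub_le ENNReal.ofNat_ne_top hη
  refine ⟨fun t => ∫ x, g x * (θ t x : ℂ), ?_, fun t ht => ?_⟩
  · refine continuousOn_integral_of_compact_support (k := tsupport g) hgs ?_ fun t x _ hx => ?_
    · refine ContinuousOn.mul (hgc.comp continuous_snd).continuousOn
        (Complex.continuous_ofReal.comp_continuousOn (hcont.mono ?_))
      exact prod_mono (fun t ht => ⟨ht.1, ht.2.trans_lt hb.2⟩) subset_rfl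
    · rw [image_eq_zero_of_notMem_tsupport hx, zero_mul]
  · have htm := hmem t ⟨ht.1, ht.2.trans_lt hb.2⟩
    have hθ : MemLp (fun x => (θ t x : ℂ)) 2 volume := htm.1.ofReal
    rw [← integral_sub (norm_integral_mul_le hφ hθ).1 (norm_integral_mul_le hgm hθ).1]
    simp_rw [← sub_mul]
    refine (norm_integral_mul_le (hφ.sub hgm) hθ).2.trans ?_
    have h1 : (eLpNorm (φ - g) 2 volume).toReal ≤ ε / (C + 1) :=
      ENNReal.toReal_le_of_le_ofReal (by positivity) hgle
    have h2 : (eLpNorm (fun x => (θ t x : ℂ)) 2 volume).toReal ≤ C :=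
      ENNReal.toReal_le_coe_of_le_coe ((eLpNorm_le_sobolevNorm htm.1 k).trans (hC t ht))
    calc _ ≤ ε / (C + 1) * C := mul_le_mul h1 h2 ENNReal.toReal_nonneg (by positivity)
      _ ≤ ε := by
        rw [div_mul_eq_mul_div, div_le_iff₀ (by positivity)]
        nlinarith

theorem continuousOn_integral_mul_fourierL2
    (hcont : ContinuousOn (Function.uncurry θ) (Ico 0 T ×ˢ univ))
    (hmem : ∀ t ∈ Ico 0 T, MemHk k (θ t))
    (hbdd : ∀ τ < T, ∃ C : ℝ≥0, ∀ t ∈ Icc 0 τ, sobolevNorm k (θ t) ≤ C)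
    {ψ : Plane → ℂ} (hψ : MemLp ψ 2 volume) :
    ContinuousOn (fun t => ∫ ξ, ψ ξ * fourierL2 (θ t) ξ) (Ico 0 T) := by
  obtain ⟨φ, hφ, heq⟩ := integral_mul_fourierL2_eq hψ
  exact (continuousOn_integral_mul hcont hmem hbdd hφ).congr fun t ht => heq _ (hmem t ht).1

/-- The symbol of the inverse Fourier transform giving `velocity` at the point `x`. -/
def velocitySymbol (s : ℝ) (i : Fin 2) (x ξ : Plane) : ℂ :=
  Complex.exp ((2 * Real.pi * inner ℝ ξ x : ℝ) * Complex.I) *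
    (-(2 * Real.pi * Complex.I) * ((perp ξ i : ℝ) : ℂ)
    * (((2 * Real.pi * ‖ξ‖) ^ (-(2 * s)) : ℝ) : ℂ))

theorem measurable_velocitySymbol (s : ℝ) (i : Fin 2) (x : Plane) :
    Measurable (velocitySymbol s i x) := by
  have : Measurable fun ξ : Plane => perp ξ i :=
    ((EuclideanSpace.proj i).continuous.comp continuous_perp).measurable
  unfold velocitySymbol
  fun_prop

theorem velocitySymbol_mul (s : ℝ) (i : Fin 2) (x ξ : Plane) (f : Plane → ℝ) :
    velocitySymbol s i x ξ * fourierL2 f ξ =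
      Complex.exp ((2 * Real.pi * inner ℝ ξ x : ℝ) * Complex.I) • velocityHat s f i ξ := by
  simp only [velocitySymbol, velocityHat, smul_eq_mul, mul_assoc]

theorem norm_velocitySymbol_le (s : ℝ) (i : Fin 2) (x ξ : Plane) :
    ‖velocitySymbol s i x ξ‖ ≤ (2 * Real.pi * ‖ξ‖) ^ (1 - 2 * s) := by
  have hpi := Real.pi_pos
  rcases eq_or_ne ξ 0 with rfl | hξ
  · have : perp (0 : Plane) i = 0 := by simpa using abs_perp_apply_le 0 i
    simp only [velocitySymbol, this]
    simp
    positivity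
  · have hpos : 0 < 2 * Real.pi * ‖ξ‖ := by positivity
    have h1 : ‖velocitySymbol s i x ξ‖ =
        2 * Real.pi * |perp ξ i| * (2 * Real.pi * ‖ξ‖) ^ (-(2 * s)) := by
      simp only [velocitySymbol, norm_mul, norm_neg, Complex.norm_real, Complex.norm_I, mul_one,
        Complex.norm_ofNat, Real.norm_eq_abs, Complex.norm_exp_ofReal_mul_I, one_mul]
      rw [abs_of_pos hpi, abs_of_nonneg (Real.rpow_nonneg hpos.le _)]
    rw [h1, sub_eq_add_neg, Real.rpow_add hpos, Real.rpow_one]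
    gcongr
    exact abs_perp_apply_le ξ i

/-- On a bounded ball the factor `(1 + |2πξ|²)^(-2)` is bounded below, so the truncated symbol is
dominated by a multiple of a square-integrable weight. -/
theorem memLp_indicator_velocitySymbol {s : ℝ} (hs₀ : 0 < s) (hs₁ : s < 1) (i : Fin 2)
    (x : Plane) (n : ℝ) :
    MemLp ((Metric.closedBall (0 : Plane) n).indicator (velocitySymbol s i x)) 2 volume := by
  have h1 := (memLp_freqWeight (k := 4) le_rfl (α := 1 - 2 * s) (by linarith)
    (by linarith)).const_mul ((1 + (2 * Real.pi * n) ^ 2) ^ ((4 : ℝ) / 2))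
  refine h1.mono ((measurable_velocitySymbol s i x).indicator
    measurableSet_closedBall).aestronglyMeasurable (Eventually.of_forall fun ξ => ?_)
  by_cases hξ : ξ ∈ Metric.closedBall (0 : Plane) n
  · rw [indicator_of_mem hξ]
    have hξn : ‖ξ‖ ≤ n := by simpa using hξ
    have hpos : (0 : ℝ) < 1 + (2 * Real.pi * ‖ξ‖) ^ 2 := by positivity
    rw [Real.norm_of_nonneg (by unfold freqWeight; positivity)]
    refine (norm_velocitySymbol_le s i x ξ).trans ?_
    rw [freqWeight, mul_left_comm]
    refine le_mul_of_one_le_right (by positivity) ?_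
    calc (1 : ℝ) = (1 + (2 * Real.pi * ‖ξ‖) ^ 2) ^ ((4 : ℝ) / 2) *
          (1 + (2 * Real.pi * ‖ξ‖) ^ 2) ^ (-((4 : ℕ) : ℝ) / 2) := by
          rw [← Real.rpow_add hpos]; norm_num
      _ ≤ _ := by
          push_cast
          rw [neg_div]
          gcongr
  · rw [indicator_of_notMem hξ, norm_zero]
    exact norm_nonneg _

/-- Truncating the symbol at frequency `n` leaves an `L²` pairing, continuous in time; the tail is
uniformly small because the first moment of the transformed velocity is locally bounded. -/
theorem continuousOn_velocity_time {s : ℝ} (hs₀ : 0 < s) (hs₁ : s < 1) (hk : 4 ≤ k)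
    (hcont : ContinuousOn (Function.uncurry θ) (Ico 0 T ×ˢ univ))
    (hmem : ∀ t ∈ Ico 0 T, MemHk k (θ t))
    (hbdd : ∀ τ < T, ∃ C : ℝ≥0, ∀ t ∈ Icc 0 τ, sobolevNorm k (θ t) ≤ C) (x : Plane) :
    ContinuousOn (fun t => velocity s (θ t) x) (Ico 0 T) := by
  have hcoord : ∀ i, ContinuousOn (fun t => 𝓕⁻ (velocityHat s (θ t) i) x) (Ico 0 T) := by
    intro i
    refine continuousOn_Ico_of_Icc fun b hb => continuousOn_of_forall_exists_norm_sub_le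
      fun ε hε => ?_
    obtain ⟨C, hC⟩ := hbdd b hb.2
    set D := freqConst k (2 - 2 * s) * C with hD
    have hD0 : 0 ≤ D := mul_nonneg (freqConst_nonneg _ _) C.2
    -- The tail is at most `D/(2πn) ≤ ε`; the `+ 1` keeps `n` positive when `D = 0`.
    set n : ℝ := (D + 1) / (2 * Real.pi * ε) with hn
    have hpi := Real.pi_pos
    have hn0 : 0 < n := by positivity
    refine ⟨fun t => ∫ ξ, (Metric.closedBall (0 : Plane) n).indicator (velocitySymbol s i x) ξ *
      fourierL2 (θ t) ξ, (continuousOn_integral_mul_fourierL2 hcont hmem hbdd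
        (memLp_indicator_velocitySymbol hs₀ hs₁ i x n)).mono
          fun t ht => ⟨ht.1, ht.2.trans_lt hb.2⟩, fun t ht => ?_⟩
    have hf := (hmem t ⟨ht.1, ht.2.trans_lt hb.2⟩).2
    rw [Real.fourierInv_eq']
    simp_rw [← velocitySymbol_mul]
    have hint : Integrable (fun ξ => velocitySymbol s i x ξ * fourierL2 (θ t) ξ) volume := by
      simp_rw [velocitySymbol_mul]
      exact integrable_exp_smul (integrable_velocityHat hs₀ hs₁ hk hf i) x
    rw [← integral_sub hint (norm_integral_mul_le
      (memLp_indicator_velocitySymbol hs₀ hs₁ i x n) (memLp_fourierL2 _)).1]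
    refine (norm_integral_le_of_norm_le
      ((integrable_norm_mul_velocityHat hs₀ hs₁ hk hf i).const_mul (1 / (2 * Real.pi * n)))
      (Eventually.of_forall fun ξ => ?_)).trans ?_
    · by_cases hξ : ξ ∈ Metric.closedBall (0 : Plane) n
      · rw [indicator_of_mem hξ, sub_self, norm_zero]
        positivity
      · rw [indicator_of_notMem hξ, zero_mul, sub_zero, velocitySymbol_mul, norm_smul,
          Complex.norm_exp_ofReal_mul_I, one_mul, ← mul_assoc]
        have hξn : n ≤ ‖ξ‖ := by
          rw [mem_closedBall_zero_iff, not_le] at hξ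
          exact hξ.le
        refine le_mul_of_one_le_left (norm_nonneg _) ?_
        rw [div_mul_eq_mul_div, one_mul, le_div_iff₀ (by positivity), one_mul]
        gcongr
    · rw [integral_const_mul]
      have h1 := integral_norm_mul_velocityHat_le hs₀ hs₁ hk hf i
      have h2 : (sobolevNorm k (θ t)).toReal ≤ C := ENNReal.toReal_le_coe_of_le_coe (hC t ht)
      have h3 : ∫ ξ, 2 * Real.pi * ‖ξ‖ * ‖velocityHat s (θ t) i ξ‖ ≤ D :=
        h1.trans (mul_le_mul_of_nonneg_left h2 (freqConst_nonneg _ _))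
      rw [div_mul_eq_mul_div, one_mul, div_le_iff₀ (by positivity), hn]
      refine h3.trans ?_
      have : ε * (2 * Real.pi * ((D + 1) / (2 * Real.pi * ε))) = D + 1 := by field_simp
      linarith
  have hpi : ContinuousOn (fun t => fun i : Fin 2 => (𝓕⁻ (velocityHat s (θ t) i) x).re)
      (Ico 0 T) :=
    continuousOn_pi.2 fun i => Complex.continuous_re.comp_continuousOn (hcoord i)
  exact (PiLp.continuous_toLp 2 _).comp_continuousOn hpi

theorem continuousOn_velocity {s : ℝ} (hs₀ : 0 < s) (hs₁ : s < 1) (hk : 4 ≤ k)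
    (hcont : ContinuousOn (Function.uncurry θ) (Ico 0 T ×ˢ univ))
    (hmem : ∀ t ∈ Ico 0 T, MemHk k (θ t))
    (hbdd : ∀ τ < T, ∃ C : ℝ≥0, ∀ t ∈ Icc 0 τ, sobolevNorm k (θ t) ≤ C) :
    ContinuousOn (Function.uncurry fun t => velocity s (θ t)) (Ico 0 T ×ˢ univ) := by
  rintro ⟨t, x⟩ ⟨ht, -⟩
  obtain ⟨b, hb⟩ := exists_between (show t < T from ht.2)
  obtain ⟨C, hC⟩ := hbdd b hb.2
  have h1 : ContinuousOn (Function.uncurry fun t => velocity s (θ t)) (Icc 0 b ×ˢ univ) :=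
    continuousOn_prod_of_continuousOn_lipschitzOnWith' _
      (Real.toNNReal (2 * freqConst k (2 - 2 * s) * C))
      (fun τ hτ => (lipschitzWith_velocity hs₀ hs₁ hk (hC τ hτ)).lipschitzOnWith)
      (fun y _ => (continuousOn_velocity_time hs₀ hs₁ hk hcont hmem hbdd y).mono
        fun τ hτ => ⟨hτ.1, hτ.2.trans_lt hb.2⟩)
  refine (h1 (t, x) ⟨⟨ht.1, hb.1.le⟩, mem_univ x⟩).mono_of_mem_nhdsWithin ?_
  filter_upwards [inter_mem_nhdsWithin (Ico 0 T ×ˢ (univ : Set Plane))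
    (continuous_fst.continuousAt.preimage_mem_nhds (Iio_mem_nhds hb.1))] with p hp
  exact ⟨⟨hp.1.1.1, le_of_lt hp.2⟩, mem_univ _⟩

end

/-! ### Functions in `H^k` are bounded -/

theorem integral_schwartz_mul_fourierL2 (Φ : SchwartzMap Plane ℂ) {f : Plane → ℝ}
    (hf : MemLp f 2 volume) :
    ∫ ξ, Φ ξ * fourierL2 f ξ = ∫ x, (𝓕 (Φ : Plane → ℂ)) x * (f x : ℂ) := by
  have hfc : MemLp (fun x => (f x : ℂ)) 2 volume := hf.ofReal
  have h1 := congrArg (fun L => L Φ) (Lp.fourier_toTemperedDistribution_eq (hfc.toLp _))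
  simp only [TemperedDistribution.fourier_apply, Lp.toTemperedDistribution_apply,
    smul_eq_mul] at h1
  rw [fourierL2_eq hfc, ← h1]
  refine integral_congr_ae ?_
  filter_upwards [hfc.coeFn_toLp] with x hx
  rw [hx, SchwartzMap.fourier_coe]

theorem integral_fourierInv_mul_fourierL2 (Φ : SchwartzMap Plane ℂ) {f : Plane → ℝ}
    (hf : MemLp f 2 volume) :
    ∫ ξ, (𝓕⁻ (Φ : Plane → ℂ)) ξ * fourierL2 f ξ = ∫ x, Φ x * (f x : ℂ) := by
  have h1 := integral_schwartz_mul_fourierL2 (𝓕⁻ Φ) hf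
  rw [← SchwartzMap.fourier_coe, FourierTransform.fourier_fourierInv_eq] at h1
  rw [← h1, SchwartzMap.fourierInv_coe]

/-- The transform is integrable, so Fourier inversion holds almost everywhere, by testing against
smooth functions, and then everywhere by continuity. -/
theorem exists_abs_le_of_memHk {k : ℕ} (hk : 4 ≤ k) {f : Plane → ℝ} (hf : MemHk k f)
    (hfc : Continuous f) : ∃ M, ∀ x, |f x| ≤ M := by
  have hg : Integrable (fourierL2 f) volume := by
    simpa using integrable_rpow_smul_fourierL2 hk (α := 0) (by norm_num) (by norm_num) hf.2
  refine ⟨∫ ξ, ‖fourierL2 f ξ‖, ?_⟩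
  have hcont : Continuous (𝓕⁻ (fourierL2 f)) := by
    exact VectorFourier.fourierIntegral_continuous Real.continuous_fourierChar
      (L := -innerₗ Plane) (continuous_inner (𝕜 := ℝ)).neg hg
  have hae : ∀ᵐ x, (f x : ℂ) = 𝓕⁻ (fourierL2 f) x := by
    refine ae_eq_of_integral_contDiff_smul_eq
      (Complex.continuous_ofReal.comp hfc).locallyIntegrable hcont.locallyIntegrable
      fun η hη hηs => ?_
    have hηs' : HasCompactSupport (fun x => (η x : ℂ)) := hηs.comp_left Complex.ofReal_zero
    set Φ : SchwartzMap Plane ℂ :=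
      hηs'.toSchwartzMap (Complex.ofRealCLM.contDiff.comp hη) with hΦ
    have hΦx : ∀ x, Φ x = (η x : ℂ) := fun x => rfl
    have h1 := integral_fourierInv_mul_fourierL2 Φ hf.1
    have h2 := VectorFourier.integral_fourierIntegral_smul_eq_flip (μ := (volume : Measure Plane))
      (ν := (volume : Measure Plane)) (L := -innerₗ Plane) Real.continuous_fourierChar
      (continuous_inner (𝕜 := ℝ)).neg Φ.integrable hg
    have hflip : (-innerₗ Plane).flip = -innerₗ Plane := by
      ext x y; simp [real_inner_comm]
    rw [hflip] at h2
    simp_rw [Complex.real_smul, ← hΦx]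
    rw [← h1]
    exact h2
  have heq : (fun x => (f x : ℂ)) = 𝓕⁻ (fourierL2 f) :=
    (Continuous.ae_eq_iff_eq volume (Complex.continuous_ofReal.comp hfc) hcont).1 hae
  intro x
  have h3 := norm_fourierInv_le (fourierL2 f) x
  rwa [← heq, Complex.norm_real, Real.norm_eq_abs] at h3

/-! ### Frequency-localized bounds by the supremum of the function -/

/-- The plane wave `exp(2πi x·ξ)`. -/
def planeWave (x ξ : Plane) : ℂ :=
  Complex.exp ((2 * Real.pi * inner ℝ ξ x : ℝ) * Complex.I)

theorem norm_planeWave (x ξ : Plane) : ‖planeWave x ξ‖ = 1 :=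
  Complex.norm_exp_ofReal_mul_I _

theorem contDiff_planeWave (x : Plane) : ContDiff ℝ (⊤ : ℕ∞) (planeWave x) := by
  unfold planeWave
  refine ContDiff.cexp (ContDiff.mul (Complex.ofRealCLM.contDiff.comp ?_) contDiff_const)
  exact contDiff_const.mul (contDiff_id.inner ℝ contDiff_const)

theorem fourier_scaled_wave (h : Plane → ℂ) (x y : Plane) {l : ℝ} (hl : 0 < l) :
    𝓕 (fun ξ => planeWave x ξ * h (l • ξ)) y = (l ^ 2)⁻¹ • 𝓕 h (l⁻¹ • (y - x)) := by
  rw [Real.fourier_eq', Real.fourier_eq']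
  have h1 := Measure.integral_comp_smul (volume : Measure Plane) (fun v : Plane =>
    Complex.exp ((-2 * Real.pi * inner ℝ v (l⁻¹ • (y - x)) : ℝ) * Complex.I) • h v) l
  rw [finrank_euclideanSpace, Fintype.card_fin, abs_of_pos (by positivity)] at h1
  rw [← h1]
  refine integral_congr_ae (Eventually.of_forall fun ξ => ?_)
  simp only [smul_eq_mul, planeWave]
  rw [← mul_assoc, ← Complex.exp_add, real_inner_smul_left, real_inner_smul_right,
    mul_inv_cancel_left₀ hl.ne', inner_sub_right]
  congr 2
  push_cast
  ring

/-- By duality the integral is `f` tested against a translated and rescaled copy of the transform of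
`h`, whose `L¹` norm depends neither on `x` nor on `l`. -/
theorem norm_integral_wave_mul_fourierL2_le {h : Plane → ℂ} (hh : ContDiff ℝ (⊤ : ℕ∞) h)
    (hs : HasCompactSupport h) {f : Plane → ℝ} (hf : MemLp f 2 volume) {M : ℝ}
    (hM : ∀ x, |f x| ≤ M) (x : Plane) {l : ℝ} (hl : 0 < l) :
    ‖∫ ξ, planeWave x ξ * h (l • ξ) * fourierL2 f ξ‖ ≤ M * ∫ y, ‖𝓕 h y‖ := by
  have hd : ContDiff ℝ (⊤ : ℕ∞) fun ξ => planeWave x ξ * h (l • ξ) :=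
    (contDiff_planeWave x).mul (hh.comp (contDiff_const_smul l))
  have hcs : HasCompactSupport fun ξ => planeWave x ξ * h (l • ξ) :=
    HasCompactSupport.mul_left (hs.comp_smul hl.ne')
  have h1 := integral_schwartz_mul_fourierL2 (hcs.toSchwartzMap hd) hf
  have hΦ : ⇑(hcs.toSchwartzMap hd) = fun ξ => planeWave x ξ * h (l • ξ) := rfl
  rw [hΦ] at h1
  rw [h1]
  have hint : Integrable (𝓕 h) volume := by
    have := (𝓕 (hs.toSchwartzMap hh)).integrable (μ := (volume : Measure Plane))
    rwa [SchwartzMap.fourier_coe] at this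
  have hint2 : Integrable (fun y => (l ^ 2)⁻¹ * ‖𝓕 h (l⁻¹ • (y - x))‖) volume :=
    (((hint.norm.comp_smul (inv_ne_zero hl.ne')).comp_sub_right x).const_mul _)
  refine (norm_integral_le_of_norm_le (hint2.const_mul M)
    (Eventually.of_forall fun y => ?_)).trans (le_of_eq ?_)
  · rw [fourier_scaled_wave h x y hl, norm_mul, norm_smul, Complex.norm_real,
      Real.norm_of_nonneg (by positivity : 0 ≤ (l ^ 2)⁻¹), Real.norm_eq_abs, mul_comm]
    exact mul_le_mul_of_nonneg_right (hM y) (by positivity)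
  · rw [integral_const_mul, integral_const_mul,
      integral_sub_right_eq_self (fun y => ‖𝓕 h (l⁻¹ • y)‖) x,
      Measure.integral_comp_smul (volume : Measure Plane) (fun y => ‖𝓕 h y‖),
      finrank_euclideanSpace, Fintype.card_fin, abs_of_pos (by positivity), smul_eq_mul,
      inv_pow, inv_inv, inv_mul_cancel_left₀ (by positivity)]

theorem integrable_wave_mul_fourierL2 {k : ℕ} (hk : 4 ≤ k) {f : Plane → ℝ}
    (hf : sobolevNorm k f < ∞) {h : Plane → ℂ} (hh : Continuous h) (hs : HasCompactSupport h)
    (x : Plane) (l : ℝ) :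
    Integrable (fun ξ => planeWave x ξ * h (l • ξ) * fourierL2 f ξ) volume := by
  have hg : Integrable (fourierL2 f) volume := by
    simpa using integrable_rpow_smul_fourierL2 hk (α := 0) (by norm_num) (by norm_num) hf
  obtain ⟨C, hC⟩ := hs.exists_bound_of_continuous hh
  refine hg.bdd_mul (c := C) (Continuous.aestronglyMeasurable
    ((contDiff_planeWave x).continuous.mul (hh.comp (continuous_const_smul l))))
    (Eventually.of_forall fun ξ => ?_)
  rw [norm_mul, norm_planeWave, one_mul]
  exact hC _

/-- Differentiating along the segment from `y` to `x` brings down a factor `ξⱼ = l⁻¹ (lξ)ⱼ`. The new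
symbol `ξⱼ h(ξ)` is again smooth and compactly supported, so the uniform bound applies with a gain
`l⁻¹`. -/
theorem norm_integral_wave_sub_le {k : ℕ} (hk : 4 ≤ k) {h : Plane → ℂ}
    (hh : ContDiff ℝ (⊤ : ℕ∞) h) (hs : HasCompactSupport h) :
    ∃ C : ℝ, 0 ≤ C ∧ ∀ f : Plane → ℝ, MemHk k f → ∀ M : ℝ, (∀ x, |f x| ≤ M) → ∀ x y : Plane,
      ∀ l > 0, ‖(∫ ξ, planeWave x ξ * h (l • ξ) * fourierL2 f ξ) -
        ∫ ξ, planeWave y ξ * h (l • ξ) * fourierL2 f ξ‖ ≤ C * M * (l⁻¹ * ‖x - y‖) := by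
  set H : Fin 2 → Plane → ℂ := fun j ξ => ((ξ j : ℝ) : ℂ) * h ξ with hH
  have hcoord : ∀ j : Fin 2, ContDiff ℝ (⊤ : ℕ∞) fun ξ : Plane => ((ξ j : ℝ) : ℂ) := fun j =>
    Complex.ofRealCLM.contDiff.comp (EuclideanSpace.proj (𝕜 := ℝ) j).contDiff
  have hHd : ∀ j, ContDiff ℝ (⊤ : ℕ∞) (H j) := fun j => (hcoord j).mul hh
  have hHs : ∀ j, HasCompactSupport (H j) := fun j => HasCompactSupport.mul_left hs
  set K : ℝ := (∫ y, ‖𝓕 (H 0) y‖) + ∫ y, ‖𝓕 (H 1) y‖ with hK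
  have hK0 : ∀ j, 0 ≤ ∫ y, ‖𝓕 (H j) y‖ := fun j => integral_nonneg fun _ => norm_nonneg _
  refine ⟨2 * Real.pi * K, mul_nonneg Real.two_pi_pos.le (add_nonneg (hK0 0) (hK0 1)), ?_⟩
  intro f hf M hM x y l hl
  have hM0 : 0 ≤ M := (abs_nonneg _).trans (hM 0)
  set p : ℝ → Plane := fun τ => y + τ • (x - y) with hp
  set F' : ℝ → Plane → ℂ := fun τ ξ => ((2 * Real.pi * inner ℝ ξ (x - y) : ℝ) * Complex.I) *
    (planeWave (p τ) ξ * h (l • ξ) * fourierL2 f ξ) with hF'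
  have hgn : Integrable (fun ξ => (2 * Real.pi * ‖ξ‖) * ‖fourierL2 f ξ‖) volume := by
    refine (integrable_rpow_smul_fourierL2 hk (α := 1) (by norm_num) (by norm_num)
      hf.2).norm.congr (Eventually.of_forall fun ξ => ?_)
    simp only [norm_smul, Real.rpow_one]
    rw [Real.norm_of_nonneg (by positivity)]
  obtain ⟨B, hB⟩ := hs.exists_bound_of_continuous hh.continuous
  have hInt := fun x => integrable_wave_mul_fourierL2 hk hf.2 hh.continuous hs x l
  have hder : ∀ τ : ℝ, HasDerivAt
      (fun τ => ∫ ξ, planeWave (p τ) ξ * h (l • ξ) * fourierL2 f ξ) (∫ ξ, F' τ ξ) τ := by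
    intro τ
    refine (hasDerivAt_integral_of_dominated_loc_of_deriv_le (s := univ) univ_mem
      (bound := fun ξ => ‖x - y‖ * B * ((2 * Real.pi * ‖ξ‖) * ‖fourierL2 f ξ‖))
      (Eventually.of_forall fun τ => (hInt (p τ)).1) (hInt (p τ)) ?_
      (Eventually.of_forall fun ξ σ _ => ?_) (hgn.const_mul _)
      (Eventually.of_forall fun ξ σ _ => ?_)).2
    · exact (Continuous.aestronglyMeasurable (by fun_prop)).mul (hInt (p τ)).1
    · simp only [hF', norm_mul, norm_planeWave, Complex.norm_real, Complex.norm_I, mul_one, one_mul]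
      have h1 : ‖2 * Real.pi * inner ℝ ξ (x - y)‖ ≤ 2 * Real.pi * ‖ξ‖ * ‖x - y‖ := by
        rw [Real.norm_eq_abs, abs_mul, abs_of_pos Real.two_pi_pos, mul_assoc (2 * Real.pi)]
        exact mul_le_mul_of_nonneg_left (abs_real_inner_le_norm _ _) Real.two_pi_pos.le
      calc _ ≤ (2 * Real.pi * ‖ξ‖ * ‖x - y‖) * (B * ‖fourierL2 f ξ‖) := by
            refine mul_le_mul ?_ (mul_le_mul_of_nonneg_right (hB _) (norm_nonneg _))
              (by positivity) (by positivity)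
            simpa using h1
        _ = _ := by ring
    · have h1 : HasDerivAt (fun σ : ℝ => 2 * Real.pi * inner ℝ ξ (p σ))
          (2 * Real.pi * inner ℝ ξ (x - y)) σ := by
        have h2 : HasDerivAt p ((1 : ℝ) • (x - y)) σ :=
          ((hasDerivAt_id σ).smul_const (x - y)).const_add y
        rw [one_smul] at h2
        exact ((innerSL ℝ ξ).hasFDerivAt.comp_hasDerivAt σ h2).const_mul (2 * Real.pi)
      have h3 := ((h1.ofReal_comp.mul_const Complex.I).cexp.mul_const (h (l • ξ))).mul_const
        (fourierL2 f ξ)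
      convert! h3 using 1
      simp only [hF', planeWave]
      ring
  have hbound : ∀ τ : ℝ, ‖∫ ξ, F' τ ξ‖ ≤ 2 * Real.pi * K * M * (l⁻¹ * ‖x - y‖) := by
    intro τ
    have hsplit : ∀ ξ, F' τ ξ = ((2 * Real.pi * l⁻¹ * (x - y) 0 : ℝ) * Complex.I) *
        (planeWave (p τ) ξ * H 0 (l • ξ) * fourierL2 f ξ) +
        ((2 * Real.pi * l⁻¹ * (x - y) 1 : ℝ) * Complex.I) *
        (planeWave (p τ) ξ * H 1 (l • ξ) * fourierL2 f ξ) := by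
      intro ξ
      have hin : (inner ℝ ξ (x - y) : ℝ) = ξ 0 * (x - y) 0 + ξ 1 * (x - y) 1 := by
        simp [PiLp.inner_apply, Fin.sum_univ_two, mul_comm]
      have hlc : (l : ℂ) ≠ 0 := by exact_mod_cast hl.ne'
      simp only [hF', hH, hin, PiLp.smul_apply, smul_eq_mul]
      push_cast
      field_simp
    simp_rw [hsplit]
    have hI := fun j => integrable_wave_mul_fourierL2 hk hf.2 (hHd j).continuous (hHs j) (p τ) l
    rw [integral_add ((hI 0).const_mul _) ((hI 1).const_mul _), integral_const_mul,
      integral_const_mul]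
    have hj : ∀ j, ‖((2 * Real.pi * l⁻¹ * (x - y) j : ℝ) * Complex.I) *
        ∫ ξ, planeWave (p τ) ξ * H j (l • ξ) * fourierL2 f ξ‖ ≤
        2 * Real.pi * l⁻¹ * ‖x - y‖ * (M * ∫ z, ‖𝓕 (H j) z‖) := fun j => by
      rw [norm_mul, norm_mul, Complex.norm_I, mul_one, Complex.norm_real, Real.norm_eq_abs,
        abs_mul, abs_of_pos (by positivity : 0 < 2 * Real.pi * l⁻¹)]
      exact mul_le_mul (mul_le_mul_of_nonneg_left (PiLp.norm_apply_le (x - y) j) (by positivity))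
        (norm_integral_wave_mul_fourierL2_le (hHd j) (hHs j) hf.1 hM (p τ) hl) (norm_nonneg _)
        (by positivity)
    refine (norm_add_le _ _).trans ((add_le_add (hj 0) (hj 1)).trans (le_of_eq ?_))
    rw [hK]; ring
  have := norm_image_sub_le_of_norm_deriv_le_segment_01'
    (fun τ _ => (hder τ).hasDerivWithinAt) fun τ _ => hbound τ
  simpa [hp] using this

/-! ### Subordination of the velocity to frequency-localized pieces -/

/-- A smooth cutoff, equal to `1` on `(-∞, 1]` and to `0` on `[2, ∞)`. -/
def cutoff (u : ℝ) : ℝ := Real.smoothTransition (2 - u)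

theorem cutoff_nonneg (u : ℝ) : 0 ≤ cutoff u := Real.smoothTransition.nonneg _

theorem cutoff_le_one (u : ℝ) : cutoff u ≤ 1 := Real.smoothTransition.le_one _

theorem cutoff_of_le_one {u : ℝ} (hu : u ≤ 1) : cutoff u = 1 :=
  Real.smoothTransition.one_of_one_le (by linarith)

theorem cutoff_of_two_le {u : ℝ} (hu : 2 ≤ u) : cutoff u = 0 :=
  Real.smoothTransition.zero_of_nonpos (by linarith)

theorem contDiff_cutoff : ContDiff ℝ (⊤ : ℕ∞) cutoff :=
  Real.smoothTransition.contDiff.comp (contDiff_const.sub contDiff_id)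

theorem integrableOn_rpow_mul_cutoff {s : ℝ} (hs : 0 < s) :
    IntegrableOn (fun u : ℝ => u ^ (s - 1) * cutoff u) (Ioi 0) := by
  have hm : Measurable fun u : ℝ => u ^ (s - 1) * cutoff u := by
    have := contDiff_cutoff.continuous.measurable
    fun_prop
  rw [← Ioc_union_Ioi_eq_Ioi (zero_le_two : (0 : ℝ) ≤ 2)]
  refine IntegrableOn.union ?_ ?_
  · have h1 : IntegrableOn (fun u : ℝ => u ^ (s - 1)) (Ioc 0 2) := by
      rw [← intervalIntegrable_iff_integrableOn_Ioc_of_le zero_le_two]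
      exact intervalIntegral.intervalIntegrable_rpow' (by linarith)
    refine h1.mono' hm.aestronglyMeasurable ((ae_restrict_iff' measurableSet_Ioc).2
      (Eventually.of_forall fun u hu => ?_))
    have hu0 : 0 ≤ u ^ (s - 1) := Real.rpow_nonneg hu.1.le _
    rw [Real.norm_of_nonneg (mul_nonneg hu0 (cutoff_nonneg u))]
    exact mul_le_of_le_one_right hu0 (cutoff_le_one u)
  · refine integrableOn_zero.congr_fun (fun u hu => ?_) measurableSet_Ioi
    rw [cutoff_of_two_le (le_of_lt hu), mul_zero]

/-- The normalization `∫₀^∞ u^(s-1) χ(u) du` of the subordination formula. -/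
def cutoffMass (s : ℝ) : ℝ := ∫ u in Ioi (0 : ℝ), u ^ (s - 1) * cutoff u

theorem cutoffMass_pos {s : ℝ} (hs : 0 < s) : 0 < cutoffMass s := by
  have hint := integrableOn_rpow_mul_cutoff hs
  have h1 : ∫ u in Ioc (0 : ℝ) 1, u ^ (s - 1) * cutoff u = 1 / s := by
    rw [setIntegral_congr_fun measurableSet_Ioc (g := fun u : ℝ => u ^ (s - 1)) fun u hu => by
      simp only [cutoff_of_le_one hu.2, mul_one],
      ← intervalIntegral.integral_of_le zero_le_one, integral_rpow (Or.inl (by linarith))]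
    simp [hs.ne']
  refine lt_of_lt_of_le (one_div_pos.2 hs) (h1.symm.trans_le ?_)
  refine setIntegral_mono_set hint ?_ (Eventually.of_forall Ioc_subset_Ioi_self)
  exact (ae_restrict_iff' measurableSet_Ioi).2 (Eventually.of_forall fun u hu =>
    mul_nonneg (Real.rpow_nonneg (le_of_lt hu) _) (cutoff_nonneg u))

/-- The substitution `u = a t`. With `a = |2πξ|²` it writes the multiplier `|2πξ|^(-2s)` as an
average of cutoffs. -/
theorem subordination {s : ℝ} (hs : 0 < s) {a : ℝ} (ha : 0 < a) :
    IntegrableOn (fun t : ℝ => t ^ (s - 1) * cutoff (a * t)) (Ioi 0) ∧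
      ∫ t in Ioi (0 : ℝ), t ^ (s - 1) * cutoff (a * t) = cutoffMass s * a ^ (-s) := by
  have h1 : ∀ t ∈ Ioi (0 : ℝ), (a ^ (s - 1))⁻¹ * ((a * t) ^ (s - 1) * cutoff (a * t)) =
      t ^ (s - 1) * cutoff (a * t) := fun t ht => by
    rw [Real.mul_rpow ha.le (le_of_lt ht), mul_assoc, inv_mul_cancel_left₀]
    exact (Real.rpow_pos_of_pos ha _).ne'
  constructor
  · have h2 := (integrableOn_Ioi_comp_mul_left_iff (fun u : ℝ => u ^ (s - 1) * cutoff u) 0 ha).2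
      (by simpa using integrableOn_rpow_mul_cutoff hs)
    exact IntegrableOn.congr_fun (h2.const_mul (a ^ (s - 1))⁻¹) h1 measurableSet_Ioi
  · rw [← setIntegral_congr_fun measurableSet_Ioi h1, integral_const_mul,
      integral_comp_mul_left_Ioi (fun u : ℝ => u ^ (s - 1) * cutoff u) 0 ha, mul_zero, smul_eq_mul]
    rw [← cutoffMass, ← mul_assoc, mul_comm, ← mul_inv, ← Real.rpow_add_one ha.ne',
      ← Real.rpow_neg ha.le]
    congr 2
    ring

/-- The localized symbol `-2πi ξ^⊥ χ(|2πξ|²)`. -/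
def localSymbol (i : Fin 2) (ξ : Plane) : ℂ :=
  -(2 * Real.pi * Complex.I) * ((perp ξ i : ℝ) : ℂ) *
    ((cutoff ((2 * Real.pi) ^ 2 * ‖ξ‖ ^ 2) : ℝ) : ℂ)

theorem contDiff_localSymbol (i : Fin 2) : ContDiff ℝ (⊤ : ℕ∞) (localSymbol i) := by
  have h1 : ContDiff ℝ (⊤ : ℕ∞) fun ξ : Plane => perp ξ i := by
    fin_cases i
    · exact (EuclideanSpace.proj (𝕜 := ℝ) (1 : Fin 2)).contDiff.neg
    · exact (EuclideanSpace.proj (𝕜 := ℝ) (0 : Fin 2)).contDiff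
  exact (contDiff_const.mul (Complex.ofRealCLM.contDiff.comp h1)).mul
    (Complex.ofRealCLM.contDiff.comp (contDiff_cutoff.comp
      (contDiff_const.mul (contDiff_norm_sq ℝ))))

theorem hasCompactSupport_localSymbol (i : Fin 2) : HasCompactSupport (localSymbol i) := by
  refine HasCompactSupport.intro (isCompact_closedBall (0 : Plane) 1) fun ξ hξ => ?_
  rw [mem_closedBall_zero_iff, not_le] at hξ
  have hpi := Real.pi_gt_three
  have h1 : 1 ≤ ‖ξ‖ ^ 2 := by nlinarith
  have h2 : 2 ≤ (2 * Real.pi) ^ 2 := by nlinarith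
  rw [localSymbol, cutoff_of_two_le (by nlinarith)]
  simp

theorem localSymbol_sqrt_smul (i : Fin 2) (ξ : Plane) {t : ℝ} (ht : 0 < t) :
    localSymbol i (√t • ξ) = (√t : ℂ) * (-(2 * Real.pi * Complex.I) * ((perp ξ i : ℝ) : ℂ) *
      ((cutoff ((2 * Real.pi * ‖ξ‖) ^ 2 * t) : ℝ) : ℂ)) := by
  have h1 : (2 * Real.pi) ^ 2 * ‖√t • ξ‖ ^ 2 = (2 * Real.pi * ‖ξ‖) ^ 2 * t := by
    rw [norm_smul, Real.norm_of_nonneg (Real.sqrt_nonneg t), mul_pow (√t), Real.sq_sqrt ht.le]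
    ring
  rw [localSymbol, h1, perp_smul, PiLp.smul_apply, smul_eq_mul]
  push_cast
  ring

/-- The part of the velocity carried by frequencies below `1/√t`, before integration in `t`. -/
def localVelocity (f : Plane → ℝ) (i : Fin 2) (t : ℝ) (x : Plane) : ℂ :=
  ∫ ξ, planeWave x ξ * localSymbol i (√t • ξ) * fourierL2 f ξ

/-- Subordination under the Fourier integral and Fubini. It is stated for differences because only
these have a decaying sup-norm bound as `t → ∞`. -/
theorem subordination_velocity {s : ℝ} {k : ℕ} {f : Plane → ℝ} (hs₀ : 0 < s) (hs₁ : s < 1)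
    (hk : 4 ≤ k) (hf : sobolevNorm k f < ∞) (i : Fin 2) (x y : Plane) :
    cutoffMass s * (𝓕⁻ (velocityHat s f i) x - 𝓕⁻ (velocityHat s f i) y) =
      ∫ t in Ioi (0 : ℝ), ((t ^ (s - 3 / 2) : ℝ) : ℂ) *
        (localVelocity f i t x - localVelocity f i t y) := by
  set P : Plane → ℂ := fun ξ => (planeWave x ξ - planeWave y ξ) *
    (-(2 * Real.pi * Complex.I) * ((perp ξ i : ℝ) : ℂ)) * fourierL2 f ξ with hP
  have hPm : AEStronglyMeasurable P volume := by
    refine AEStronglyMeasurable.mul (Continuous.aestronglyMeasurable ?_)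
      (aestronglyMeasurable_fourierL2 f)
    have h1 := (contDiff_planeWave x).continuous
    have h2 := (contDiff_planeWave y).continuous
    have h3 : Continuous fun ξ : Plane => perp ξ i :=
      (EuclideanSpace.proj i).continuous.comp continuous_perp
    fun_prop
  have hint := integrable_velocityHat hs₀ hs₁ hk hf i
  have hdiff : 𝓕⁻ (velocityHat s f i) x - 𝓕⁻ (velocityHat s f i) y =
      ∫ ξ, (((2 * Real.pi * ‖ξ‖) ^ (-(2 * s)) : ℝ) : ℂ) * P ξ := by
    rw [Real.fourierInv_eq', Real.fourierInv_eq', ← integral_sub (integrable_exp_smul hint x)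
      (integrable_exp_smul hint y)]
    refine integral_congr_ae (Eventually.of_forall fun ξ => ?_)
    simp only [hP, planeWave, velocityHat, smul_eq_mul]
    ring
  have hPint : Integrable (fun ξ => (((2 * Real.pi * ‖ξ‖) ^ (-(2 * s)) : ℝ) : ℂ) * P ξ)
      volume := by
    refine ((integrable_exp_smul hint x).sub (integrable_exp_smul hint y)).congr
      (Eventually.of_forall fun ξ => ?_)
    simp only [hP, planeWave, velocityHat, smul_eq_mul, Pi.sub_apply]
    ring
  have hfreq : ∀ ξ : Plane, ξ ≠ 0 → 0 < (2 * Real.pi * ‖ξ‖) ^ 2 ∧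
      ((2 * Real.pi * ‖ξ‖) ^ 2) ^ (-s) = (2 * Real.pi * ‖ξ‖) ^ (-(2 * s)) := fun ξ hξ => by
    have hpos : 0 < 2 * Real.pi * ‖ξ‖ := by
      have := Real.pi_pos
      positivity
    refine ⟨by positivity, ?_⟩
    rw [← Real.rpow_natCast, ← Real.rpow_mul hpos.le]
    congr 1; push_cast; ring
  set Q : Plane → ℝ → ℂ := fun ξ t =>
    ((t ^ (s - 1) * cutoff ((2 * Real.pi * ‖ξ‖) ^ 2 * t) : ℝ) : ℂ) * P ξ with hQ
  have hne : ∀ᵐ ξ : Plane, ξ ≠ 0 := by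
    simp [ae_iff, measure_singleton]
  have hQint : Integrable (Function.uncurry Q)
      ((volume : Measure Plane).prod (volume.restrict (Ioi (0 : ℝ)))) := by
    have hm : AEStronglyMeasurable (Function.uncurry Q)
        ((volume : Measure Plane).prod (volume.restrict (Ioi (0 : ℝ)))) := by
      have h1 : Measurable fun q : Plane × ℝ =>
          ((q.2 ^ (s - 1) * cutoff ((2 * Real.pi * ‖q.1‖) ^ 2 * q.2) : ℝ) : ℂ) := by
        have := contDiff_cutoff.continuous.measurable
        fun_prop
      exact h1.aestronglyMeasurable.mul hPm.comp_fst
    rw [integrable_prod_iff hm]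
    constructor
    · filter_upwards [hne] with ξ hξ
      exact ((subordination hs₀ (hfreq ξ hξ).1).1.ofReal (𝕜 := ℂ)).mul_const (P ξ)
    · refine (hPint.norm.const_mul (cutoffMass s)).congr ?_
      filter_upwards [hne] with ξ hξ
      have h1 : ∀ t ∈ Ioi (0 : ℝ), ‖Function.uncurry Q (ξ, t)‖ =
          t ^ (s - 1) * cutoff ((2 * Real.pi * ‖ξ‖) ^ 2 * t) * ‖P ξ‖ := fun t ht => by
        simp only [hQ, Function.uncurry, norm_mul, Complex.norm_real]
        rw [Real.norm_of_nonneg (Real.rpow_nonneg (le_of_lt ht) _),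
          Real.norm_of_nonneg (cutoff_nonneg _)]
      rw [setIntegral_congr_fun measurableSet_Ioi h1, integral_mul_const,
        (subordination hs₀ (hfreq ξ hξ).1).2, (hfreq ξ hξ).2, norm_mul, Complex.norm_real,
        Real.norm_of_nonneg (by positivity)]
      ring
  have hswap := integral_integral_swap hQint
  have hleft : ∫ ξ, ∫ t in Ioi (0 : ℝ), Q ξ t =
      cutoffMass s * ∫ ξ, (((2 * Real.pi * ‖ξ‖) ^ (-(2 * s)) : ℝ) : ℂ) * P ξ := by
    rw [← integral_const_mul]
    refine integral_congr_ae ?_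
    filter_upwards [hne] with ξ hξ
    simp only [hQ]
    rw [integral_mul_const, integral_complex_ofReal, (subordination hs₀ (hfreq ξ hξ).1).2,
      (hfreq ξ hξ).2]
    push_cast
    ring
  rw [hdiff, ← hleft, hswap]
  refine setIntegral_congr_fun measurableSet_Ioi fun t ht => ?_
  have ht0 : (0 : ℝ) < t := ht
  have hI := fun x => integrable_wave_mul_fourierL2 hk hf (contDiff_localSymbol i).continuous
    (hasCompactSupport_localSymbol i) x (√t)
  simp only [localVelocity]
  rw [← integral_sub (hI x) (hI y), ← integral_const_mul]
  refine integral_congr_ae (Eventually.of_forall fun ξ => ?_)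
  -- Rescaling the symbol to `localSymbol (√t ξ)` absorbs a factor `√t` from the derivative, which
  -- turns `s - 1` into `s - 3/2`.
  have hpow : t ^ (s - 1) = t ^ (s - 3 / 2) * √t := by
    rw [Real.sqrt_eq_rpow, ← Real.rpow_add ht0]
    congr 1; ring
  simp only [hQ, hP]
  rw [localSymbol_sqrt_smul i ξ ht0, hpow]
  push_cast
  ring

/-- Integrability at `0` uses `s > 1/2`, at infinity `s < 1`. -/
theorem integrableOn_dyadic_bound {s : ℝ} (hs : 1 / 2 < s) (hs₁ : s < 1) (A B : ℝ) :
    IntegrableOn (fun t : ℝ => if t ≤ 1 then A * t ^ (s - 3 / 2) else B * t ^ (s - 2)) (Ioi 0) := by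
  rw [← Ioc_union_Ioi_eq_Ioi (zero_le_one : (0 : ℝ) ≤ 1)]
  refine IntegrableOn.union ?_ ?_
  · have h1 : IntegrableOn (fun u : ℝ => A * u ^ (s - 3 / 2)) (Ioc 0 1) := by
      refine Integrable.const_mul ?_ _
      rw [← IntegrableOn, ← intervalIntegrable_iff_integrableOn_Ioc_of_le zero_le_one]
      exact intervalIntegral.intervalIntegrable_rpow' (by linarith)
    exact h1.congr_fun (fun t ht => (if_pos ht.2).symm) measurableSet_Ioc
  · have h1 : IntegrableOn (fun u : ℝ => B * u ^ (s - 2)) (Ioi 1) :=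
      Integrable.const_mul (integrableOn_Ioi_rpow_of_lt (by linarith) zero_lt_one) _
    exact h1.congr_fun (fun t ht => (if_neg (not_le.2 ht)).symm) measurableSet_Ioi

/-- For `s > 1/2` the oscillation of the velocity at unit scale is controlled by `sup |f|`. -/
theorem exists_norm_velocity_sub_le_mul_sup {s : ℝ} {k : ℕ} (hs : 1 / 2 < s) (hs₁ : s < 1)
    (hk : 4 ≤ k) : ∃ C : ℝ, ∀ f : Plane → ℝ, MemHk k f → ∀ M : ℝ, (∀ x, |f x| ≤ M) →
      ∀ x y : Plane, ‖x - y‖ ≤ 1 → ‖velocity s f x - velocity s f y‖ ≤ C * M := by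
  have hs₀ : 0 < s := by linarith
  choose C₂ hC₂0 hC₂ using fun i => norm_integral_wave_sub_le hk (contDiff_localSymbol i)
    (hasCompactSupport_localSymbol i)
  set C₁ : Fin 2 → ℝ := fun i => ∫ y, ‖𝓕 (localSymbol i) y‖ with hC₁
  set D : Fin 2 → ℝ := fun i => ∫ t in Ioi (0 : ℝ),
    (if t ≤ 1 then 2 * C₁ i * t ^ (s - 3 / 2) else C₂ i * t ^ (s - 2)) with hD
  have hmass := cutoffMass_pos hs₀
  refine ⟨(cutoffMass s)⁻¹ * (D 0 + D 1), fun f hf M hM x y hxy => ?_⟩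
  have hM0 : 0 ≤ M := (abs_nonneg _).trans (hM 0)
  have hcoord : ∀ i, |(velocity s f x - velocity s f y) i| ≤ (cutoffMass s)⁻¹ * (D i * M) := by
    intro i
    rw [PiLp.sub_apply, velocity_apply, velocity_apply, ← Complex.sub_re]
    refine (Complex.abs_re_le_norm _).trans ?_
    rw [← div_eq_inv_mul, le_div_iff₀ hmass, mul_comm]
    have h1 : cutoffMass s * ‖𝓕⁻ (velocityHat s f i) x - 𝓕⁻ (velocityHat s f i) y‖ =
        ‖(cutoffMass s : ℂ) * (𝓕⁻ (velocityHat s f i) x - 𝓕⁻ (velocityHat s f i) y)‖ := by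
      rw [norm_mul, Complex.norm_real, Real.norm_of_nonneg hmass.le]
    rw [h1, subordination_velocity hs₀ hs₁ hk hf.2, hD, ← integral_mul_const]
    refine norm_integral_le_of_norm_le ((integrableOn_dyadic_bound hs hs₁ _ _).mul_const M)
      ((ae_restrict_iff' measurableSet_Ioi).2 (Eventually.of_forall fun t ht => ?_))
    have ht0 : (0 : ℝ) < t := ht
    have hsq : 0 < √t := Real.sqrt_pos.2 ht0
    rw [norm_mul, Complex.norm_real, Real.norm_of_nonneg (Real.rpow_nonneg ht0.le _)]
    -- For `t ≤ 1` (high frequencies) the two values are bounded separately; for `t > 1` their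
    -- difference gains `t^(-1/2)`.
    split_ifs with h
    · have hx := norm_integral_wave_mul_fourierL2_le (contDiff_localSymbol i)
        (hasCompactSupport_localSymbol i) hf.1 hM x hsq
      have hy := norm_integral_wave_mul_fourierL2_le (contDiff_localSymbol i)
        (hasCompactSupport_localSymbol i) hf.1 hM y hsq
      have h2 : ‖localVelocity f i t x - localVelocity f i t y‖ ≤ 2 * C₁ i * M := by
        refine (norm_sub_le _ _).trans ((add_le_add hx hy).trans (le_of_eq ?_))
        simp only [hC₁]; ring
      calc _ ≤ t ^ (s - 3 / 2) * (2 * C₁ i * M) :=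
            mul_le_mul_of_nonneg_left h2 (Real.rpow_nonneg ht0.le _)
        _ = _ := by ring
    · have h2 : ‖localVelocity f i t x - localVelocity f i t y‖ ≤ C₂ i * M * (√t)⁻¹ := by
        refine (hC₂ i f hf M hM x y (√t) hsq).trans ?_
        refine mul_le_mul_of_nonneg_left ?_ (mul_nonneg (hC₂0 i) hM0)
        exact mul_le_of_le_one_right (inv_nonneg.2 hsq.le) hxy
      calc _ ≤ t ^ (s - 3 / 2) * (C₂ i * M * (√t)⁻¹) :=
            mul_le_mul_of_nonneg_left h2 (Real.rpow_nonneg ht0.le _)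
        _ = C₂ i * (t ^ (s - 3 / 2) * (√t)⁻¹) * M := by ring
        _ = C₂ i * t ^ (s - 2) * M := by
            rw [Real.sqrt_eq_rpow, ← Real.rpow_neg ht0.le, ← Real.rpow_add ht0]
            norm_num
            left; left; congr 1; ring
  calc _ ≤ _ := norm_le_abs_add_abs _
    _ ≤ _ := add_le_add (hcoord 0) (hcoord 1)
    _ = _ := by ring

/-! ### The collapse criterion for strong solutions -/

namespace IsStrongSolution

variable {s T : ℝ} {k : ℕ} {θ : ℝ → Plane → ℝ} {z : ℝ → Plane}

theorem isRegularlyTransported (hsol : IsStrongSolution s k T θ z) (hs₀ : 0 < s) (hs₁ : s < 1)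
    (hk : 4 ≤ k) : IsRegularlyTransported s T θ z fun t => velocity s (θ t) where
  contDiffOn_scalar := hsol.contDiffOn_scalar
  continuous_velocity t ht :=
    continuous_velocity_of_sobolevNorm_lt_top hs₀ hs₁ hk (hsol.memHk t ht).2
  transport := hsol.transport
  vortex := hsol.vortex
  continuousOn_velocity := VortexWave.continuousOn_velocity hs₀ hs₁ hk
    hsol.contDiffOn_scalar.continuousOn hsol.memHk hsol.locally_bounded
  lipschitz b hb := by
    obtain ⟨C, hC⟩ := hsol.locally_bounded b hb.2
    exact ⟨_, fun t ht => lipschitzWith_velocity hs₀ hs₁ hk (hC t ht)⟩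
  exists_inner_nonpos t ht _ hr :=
    exists_inner_velocity_sub_nonpos hs₀ hs₁ hk (hsol.memHk t ht).2 (z t) hr
  plateau := hsol.plateau

/-- The initial datum is bounded by Sobolev embedding, and the maximum principle preserves that
bound. The velocity bound may degenerate as `b → T`, but the bound on `θ` does not depend on it. -/
theorem exists_abs_le (hsol : IsStrongSolution s k T θ z) (hs₀ : 0 < s) (hs₁ : s < 1)
    (hk : 4 ≤ k) : ∃ M, ∀ t ∈ Ico 0 T, ∀ x, |θ t x| ≤ M := by
  have h := hsol.isRegularlyTransported hs₀ hs₁ hk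
  rcases le_or_gt T 0 with hT | hT
  · exact ⟨0, fun t ht => absurd (ht.1.trans_lt ht.2) hT.not_gt⟩
  have h0 : (0 : ℝ) ∈ Ico 0 T := ⟨le_rfl, hT⟩
  obtain ⟨M, hM⟩ := exists_abs_le_of_memHk hk (hsol.memHk 0 h0) (h.differentiable h0).continuous
  refine ⟨M, fun b hb x => ?_⟩
  obtain ⟨C, hC⟩ := hsol.locally_bounded b hb.2
  have hfreq := freqConst_nonneg k (1 - 2 * s)
  refine h.abs_le_of_bounded hb (B := 2 * freqConst k (1 - 2 * s) * C) (fun t ht y => ?_) hM x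
  refine (norm_velocity_le hs₀ hs₁ hk ((hC t ht).trans_lt ENNReal.coe_lt_top) y).trans ?_
  have := ENNReal.toReal_le_coe_of_le_coe (hC t ht)
  gcongr

theorem lintegral_unitOsc_lt_top_of_half_lt (hsol : IsStrongSolution s k T θ z)
    (hs : 1 / 2 < s) (hs₁ : s < 1) (hk : 4 ≤ k) {t₀ : ℝ} (ht₀ : 0 ≤ t₀) :
    ∫⁻ t in Ioo t₀ T, ENNReal.ofReal (unitOsc (velocity s (θ t)) (z t)) < ∞ := by
  obtain ⟨M, hM⟩ := hsol.exists_abs_le (by linarith) hs₁ hk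
  obtain ⟨C, hC⟩ := exists_norm_velocity_sub_le_mul_sup hs hs₁ hk
  have hle : ∀ t ∈ Ioo t₀ T, ENNReal.ofReal (unitOsc (velocity s (θ t)) (z t)) ≤
      ENNReal.ofReal (C * M) := fun t ht => by
    have ht' : t ∈ Ico 0 T := ⟨ht₀.trans ht.1.le, ht.2⟩
    exact ENNReal.ofReal_le_ofReal
      (unitOsc_le fun x hx => hC _ (hsol.memHk t ht') M (hM t ht') x _ hx)
  refine (setLIntegral_mono' measurableSet_Ioo hle).trans_lt ?_
  rw [setLIntegral_const, Real.volume_Ioo]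
  exact ENNReal.mul_lt_top ENNReal.ofReal_lt_top ENNReal.ofReal_lt_top

end IsStrongSolution

theorem ofReal_unitOsc_le (w : Plane → Plane) (p : Plane) :
    ENNReal.ofReal (unitOsc w p) ≤ 2 * ⨆ x, ‖w x‖ₑ := by
  rcases eq_or_ne (⨆ x, ‖w x‖ₑ) ∞ with htop | htop
  · simp [htop]
  have hle : ∀ x, ‖w x‖ ≤ (⨆ x, ‖w x‖ₑ).toReal := fun x => by
    rw [← toReal_enorm]
    exact ENNReal.toReal_mono htop (le_iSup (fun x => ‖w x‖ₑ) x)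
  refine ENNReal.ofReal_le_of_le_toReal (unitOsc_le fun x _ => ?_)
  rw [ENNReal.toReal_mul, ENNReal.toReal_ofNat]
  linarith [norm_sub_le (w x) (w p), hle x, hle p]

end VortexWave

end

theorem theorem2 (s : ℝ) (hs₀ : 0 < s) (hs₁ : s < 1) (k : ℕ) (hk : 4 ≤ k)
    (T : ℝ) (θ : ℝ → VortexWave.Plane → ℝ) (z : ℝ → VortexWave.Plane)
    (hsol : VortexWave.IsStrongSolution s k T θ z)
    (t₀ : ℝ) (ht₀ : t₀ ∈ Ico 0 T)
    (hR : ∀ t ∈ Ico t₀ T, VortexWave.plateauRadius (θ t) (z t) < 1) :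
    (Tendsto (fun t => VortexWave.plateauRadius (θ t) (z t)) (𝓝[<] T) (𝓝 0) →
      VortexWave.IntegralEqTop (VortexWave.inwardRate s θ z) t₀ T) ∧
    (((∃ C : ℝ≥0, ∀ t ∈ Ico 0 T, VortexWave.sobolevNorm k (θ t) ≤ C) ∨
        1 / 2 < s ∨
        ∫⁻ t in Ioo 0 T, ⨆ x, ‖VortexWave.velocity s (θ t) x‖ₑ < ∞) →
      (Tendsto (fun t => VortexWave.plateauRadius (θ t) (z t)) (𝓝[<] T) (𝓝 0) ↔
        VortexWave.IntegralEqTop (VortexWave.inwardRate s θ z) t₀ T)) := by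
  have h := hsol.isRegularlyTransported hs₀ hs₁ hk
  have hIoo : Ioo t₀ T ⊆ Ioo 0 T := Ioo_subset_Ioo_left ht₀.1
  refine ⟨h.integralEqTop_of_tendsto ht₀ hR, fun hcase =>
    ⟨h.integralEqTop_of_tendsto ht₀ hR, fun htop => ?_⟩⟩
  rcases hcase with ⟨C, hC⟩ | hs | hv
  -- With a uniform `H^k` bound the integral of the rate is never infinite, so this implication is
  -- vacuous.
  · exact absurd htop (h.not_integralEqTop_of_lipschitz ht₀ hR fun t ht =>
      VortexWave.lipschitzWith_velocity hs₀ hs₁ hk (hC t ht))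
  · exact h.tendsto_of_integralEqTop ht₀ hR
      (hsol.lintegral_unitOsc_lt_top_of_half_lt hs hs₁ hk ht₀.1) htop
  · refine h.tendsto_of_integralEqTop ht₀ hR ?_ htop
    refine (lintegral_mono fun t => VortexWave.ofReal_unitOsc_le _ _).trans_lt ?_
    -- The finite constant comes out without any measurability of the supremum in time.
    rw [lintegral_const_mul' _ _ ENNReal.ofNat_ne_top]
    exact ENNReal.mul_lt_top ENNReal.ofNat_lt_top ((lintegral_mono_set hIoo).trans_lt hv)
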